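/- **Setting.** Let $K$ be $\mathbb R$ or $\mathbb C$ with the usual absolute value, or a field with an ultrametric (real-valued) absolute value $|\cdot|$, and let $n\ge 0$. Let $\omega$ be a non-principal ultrafilter on $\mathbb N$ and $(\lambda_k)$ a sequence in $[1,\infty)$ with $\lambda_k\to\infty$. *Good norms.* If $K=\mathbb R$ or $\mathbb C$, a norm $N$ on $K^n$ is good if it is Euclidean, resp. Hermitian ($N=\sqrt q$, $q$ a positive definite quadratic, resp. Hermitian, form), and a basis $(e_i)$ is adapted to $N$ if $N(\sum a_ie_i)=\sqrt{\sum N(e_i)^2|a_i|^2}$ for all $a_i\in K$. If $K$ is ultrametric, a basis is adapted to $N$ if $N(\sum a_ie_i)=\max_i N(e_i)|a_i|$ for all $a_i \in K$, and an ultrametric norm is good if it has an adapted basis. A good norm has volume $1$ if $\prod_i N(e_i)=1$ for every adapted basis of determinant $1$. Let $Es(K)$ be the set of good norms of volume $1$ on $K^n$, with the action $g\cdot N=N\circ g^{-1}$ of $SL_n(K)$, the distance $d(N,N')=\big(\sum_i|\log (N'(e_i)/N(e_i))|^2\big)^{1/2}$ where $e$ is a basis adapted to both $N$ and $N'$, and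 the base point $N_0$, the canonical norm ($\sqrt{\sum|a_i|^2}$, resp. $\max|a_i|$). Let $\mathbb A=\{\alpha\in\mathbb R^n:\sum\alpha_i=0\}$. The marked flats (marked apartments) of $Es(K)$ are the maps $f_e:\mathbb A\to Es(K)$, for $e$ a basis of determinant $1$, where $f_e(\alpha)$ is the norm adapted to $e$ with $f_e(\alpha)(e_i)=e^{-\alpha_i}$. For $K$ ultrametric this is the Bruhat–Tits building of $SL_n(K)$. *Cones.* $K_\omega$ is the ring of sequences $(a_k)$ in $K$ with $|a_k|^{1/\lambda_k}$ $\omega$-bounded, modulo those with $\lim_\omega|a_k|^{1/\lambda_k}=0$; it is a field with the ultrametric absolute value $|[a_k]|_\omega=\lim_\omega|a_k|^{1/\lambda_k}$. $Es_\omega(K)$ is the asymptotic cone of $Es(K)$: sequences $(N_k)$ with $d(N_0,N_k)/\lambda_k$ $\omega$-bounded, modulo $\lim_\omega d(N_k,N'_k)/\lambda_k=0$, with the distance $d_\omega([N_k],[N_k'])=\lim_\omega d(N_k,N_k')/\lambda_k$; its marked apartments are the maps $\alpha\mapsto[f_k(\lambda_k\alpha)]$, for sequences $(f_k)$ of marked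 flats of $Es(K)$ with $d(N_0,f_k(0))/\lambda_k$ $\omega$-bounded. $SL_n(K)_\omega$ is the group of sequences $(g_k)$ in $SL_n(K)$ with $\|g_k\|^{1/\lambda_k}$ $\omega$-bounded, modulo $\lim_\omega\|g_k-h_k\|^{1/\lambda_k}=0$, where $\|\cdot\|$ is the operator norm associated with $N_0$; let $\psi:SL_n(K)_\omega\to SL_n(K_\omega)$ be the homomorphism $[g_k]\mapsto([(g_k)_{ij}])_{ij}$. *Affine buildings.* Let $W$ be the group of affine maps of $\mathbb A$ composed of a permutation of the coordinates and a translation by a vector of $\mathbb A$ with coordinates in $\log|K_\omega^\times|_\omega$. A set $X$ with a set $\mathcal A$ of injections $\mathbb A\to X$ (marked apartments) is an affine building modelled on $(\mathbb A,W)$ if: (A1) $f\circ w\in\mathcal A$ for $f\in\mathcal A$, $w\in W$; (A2) for $f,f'\in\mathcal A$, $f^{-1}(f'(\mathbb A))$ is closed and convex, and $f=f'\circ w$ on it for some $w\in W$; (A3) any two points lie in a common apartment; (A4) any two Weyl chambers contain subchambers lying in a common apartment; (A5) three apartments meeting pairwise in half-apartments have a common point. An isomorphism is a bijection exchanging the systems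 of marked apartments. **Theorem.** $Es_\omega(K)$ and $Es(K_\omega)$, with their marked apartments, are affine buildings modelled on $(\mathbb A,W)$, and $\psi$ is an isomorphism of groups. The map $$\phi:Es_\omega(K)\to Es(K_\omega),\qquad \phi([N_k])\big([a^1_k],\dots,[a^n_k]\big)=\lim_\omega N_k(a^1_k,\dots,a^n_k)^{1/\lambda_k},$$ is well defined. It is an isomorphism of affine buildings onto the Bruhat–Tits building $Es(K_\omega)$ of $SL_n(K_\omega)$ (a bijection exchanging the systems of marked apartments), it is isometric, and it is $\psi$-equivariant: $\phi([g_k\cdot N_k])=\psi([g_k])\cdot\phi([N_k])$ for all $[g_k]\in SL_n(K)_\omega$ and $[N_k]\in Es_\omega(K)$, the sequence $(g_k\cdot N_k)$ being again $\omega$-bounded. -/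

import Mathlib

open Filter Topology

noncomputable section

namespace AsymptoticCone

/-! ### Non-principal ultrafilter and scalars -/

/-- A non-principal ultrafilter `ω` on `ℕ` together with a sequence of scalars
`lam k ∈ [1, ∞)` tending to infinity. -/
structure Scale where
  ω : Ultrafilter ℕ
  le_cofinite : (ω : Filter ℕ) ≤ Filter.cofinite
  lam : ℕ → ℝ
  one_le : ∀ k, 1 ≤ lam k
  tendsto_lam : Tendsto lam atTop atTop

namespace Scale

variable (S : Scale)

/-- `x ^ (1 / lam k)`. -/
def root (k : ℕ) (x : ℝ) : ℝ := x ^ (S.lam k)⁻¹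

lemma lam_pos (k : ℕ) : 0 < S.lam k := lt_of_lt_of_le one_pos (S.one_le k)

lemma root_nonneg (k : ℕ) {x : ℝ} (hx : 0 ≤ x) : 0 ≤ S.root k x := Real.rpow_nonneg hx _

lemma root_zero (k : ℕ) : S.root k 0 = 0 :=
  Real.zero_rpow (inv_ne_zero (S.lam_pos k).ne')

lemma root_one (k : ℕ) : S.root k 1 = 1 := Real.one_rpow _

lemma root_mono (k : ℕ) {x y : ℝ} (hx : 0 ≤ x) (h : x ≤ y) : S.root k x ≤ S.root k y :=
  Real.rpow_le_rpow hx h (inv_nonneg.2 (S.lam_pos k).le)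

lemma root_mul (k : ℕ) {x y : ℝ} (hx : 0 ≤ x) (hy : 0 ≤ y) :
    S.root k (x * y) = S.root k x * S.root k y := Real.mul_rpow hx hy

lemma root_inv (k : ℕ) {x : ℝ} (hx : 0 ≤ x) : S.root k x⁻¹ = (S.root k x)⁻¹ :=
  Real.inv_rpow hx _

lemma root_add_le (k : ℕ) {x y : ℝ} (hx : 0 ≤ x) (hy : 0 ≤ y) :
    S.root k (x + y) ≤ S.root k x + S.root k y := by
  have := NNReal.rpow_add_le_add_rpow ⟨x, hx⟩ ⟨y, hy⟩ (inv_nonneg.2 (S.lam_pos k).le)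
    (inv_le_one_of_one_le₀ (S.one_le k))
  exact_mod_cast this

lemma root_sum_le (k : ℕ) {ι : Type*} (s : Finset ι) (f : ι → ℝ) (hf : ∀ i, 0 ≤ f i) :
    S.root k (∑ i ∈ s, f i) ≤ ∑ i ∈ s, S.root k (f i) := by
  classical
  induction s using Finset.induction_on with
  | empty => simp [root_zero]
  | insert a s ha ih =>
    rw [Finset.sum_insert ha, Finset.sum_insert ha]
    exact (S.root_add_le k (hf a) (Finset.sum_nonneg fun i _ => hf i)).trans (by gcongr)

lemma tendsto_root_two : Tendsto (fun k => S.root k 2) S.ω (𝓝 1) := by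
  have h : Tendsto (fun k => (S.lam k)⁻¹) S.ω (𝓝 0) :=
    (tendsto_inv_atTop_zero.comp S.tendsto_lam).mono_left
      (S.le_cofinite.trans Nat.cofinite_eq_atTop.le)
  have := (Real.continuous_const_rpow (a := 2) two_ne_zero).tendsto 0 |>.comp h
  simpa [root, Function.comp_def] using this

/-- A real sequence bounded along `ω` converges along `ω`. -/
lemma exists_tendsto {f : ℕ → ℝ} (h0 : ∀ k, 0 ≤ f k) {C : ℝ} (hC : ∀ᶠ k in S.ω, f k ≤ C) :
    ∃ l, 0 ≤ l ∧ Tendsto f S.ω (𝓝 l) := by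
  have hmem : Set.Icc 0 C ∈ S.ω.map f :=
    hC.mono fun k hk => ⟨h0 k, hk⟩
  obtain ⟨l, hl, hlim⟩ := (isCompact_Icc (a := (0 : ℝ)) (b := C)).ultrafilter_le_nhds' _ hmem
  exact ⟨l, hl.1, hlim⟩

end Scale

/-! ### The asymptotic cone of a valued field -/

section Field

variable (S : Scale) (K : Type*) [NormedField K]

/-- The ring of sequences `a` in `K` such that `|a_k| ^ (1 / lam k)` is `ω`-bounded. -/
def boundedSeq : Subring (ℕ → K) where
  carrier := {a | ∃ C : ℝ, ∀ᶠ k in S.ω, S.root k ‖a k‖ ≤ C}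
  mul_mem' := by
    rintro a b ⟨C, hC⟩ ⟨D, hD⟩
    refine ⟨C * D, ?_⟩
    filter_upwards [hC, hD] with k h1 h2
    rw [Pi.mul_apply, norm_mul, S.root_mul k (norm_nonneg _) (norm_nonneg _)]
    exact mul_le_mul h1 h2 (S.root_nonneg k (norm_nonneg _))
      ((S.root_nonneg k (norm_nonneg _)).trans h1)
  one_mem' := ⟨1, Eventually.of_forall fun k => by simp [S.root_one]⟩
  add_mem' := by
    rintro a b ⟨C, hC⟩ ⟨D, hD⟩
    refine ⟨C + D, ?_⟩
    filter_upwards [hC, hD] with k h1 h2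
    exact ((S.root_mono k (norm_nonneg _) (norm_add_le _ _)).trans
      (S.root_add_le k (norm_nonneg _) (norm_nonneg _))).trans (add_le_add h1 h2)
  zero_mem' := ⟨0, Eventually.of_forall fun k => by simp [S.root_zero]⟩
  neg_mem' := by
    rintro a ⟨C, hC⟩
    exact ⟨C, by simpa using hC⟩

variable {S K} in
lemma boundedSeq_exists_tendsto (a : boundedSeq S K) :
    ∃ l, 0 ≤ l ∧ Tendsto (fun k => S.root k ‖a.1 k‖) S.ω (𝓝 l) := by
  obtain ⟨C, hC⟩ := a.2
  exact S.exists_tendsto (fun k => S.root_nonneg k (norm_nonneg _)) hC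

/-- `lim_ω |a_k| ^ (1 / lam k)`. -/
def seqAbs (a : boundedSeq S K) : ℝ := limUnder (S.ω : Filter ℕ) fun k => S.root k ‖a.1 k‖

variable {S K}

lemma tendsto_seqAbs (a : boundedSeq S K) :
    Tendsto (fun k => S.root k ‖a.1 k‖) S.ω (𝓝 (seqAbs S K a)) := by
  obtain ⟨l, -, hl⟩ := boundedSeq_exists_tendsto a
  exact tendsto_nhds_limUnder ⟨l, hl⟩

lemma seqAbs_eq {a : boundedSeq S K} {l : ℝ}
    (h : Tendsto (fun k => S.root k ‖a.1 k‖) S.ω (𝓝 l)) : seqAbs S K a = l :=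
  tendsto_nhds_unique (tendsto_seqAbs a) h

lemma seqAbs_nonneg (a : boundedSeq S K) : 0 ≤ seqAbs S K a :=
  ge_of_tendsto' (tendsto_seqAbs a) fun k => S.root_nonneg k (norm_nonneg _)

lemma seqAbs_mul (a b : boundedSeq S K) : seqAbs S K (a * b) = seqAbs S K a * seqAbs S K b := by
  apply seqAbs_eq
  refine ((tendsto_seqAbs a).mul (tendsto_seqAbs b)).congr fun k => ?_
  rw [← S.root_mul k (norm_nonneg _) (norm_nonneg _), ← norm_mul]; rfl

lemma seqAbs_zero : seqAbs S K 0 = 0 := by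
  apply seqAbs_eq
  simp [S.root_zero]

lemma seqAbs_one : seqAbs S K 1 = 1 := by
  apply seqAbs_eq
  simp [S.root_one]

lemma seqAbs_neg (a : boundedSeq S K) : seqAbs S K (-a) = seqAbs S K a := by
  apply seqAbs_eq
  simpa using tendsto_seqAbs a

lemma seqAbs_add_le_max (a b : boundedSeq S K) :
    seqAbs S K (a + b) ≤ max (seqAbs S K a) (seqAbs S K b) := by
  have h := S.tendsto_root_two.mul ((tendsto_seqAbs a).max (tendsto_seqAbs b))
  rw [one_mul] at h
  refine le_of_tendsto_of_tendsto' (tendsto_seqAbs (a + b)) h fun k => ?_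
  have h2 : ‖(a + b).1 k‖ ≤ 2 * max ‖a.1 k‖ ‖b.1 k‖ := by
    have h3 : ‖(a + b).1 k‖ ≤ ‖a.1 k‖ + ‖b.1 k‖ := norm_add_le _ _
    linarith [le_max_left ‖a.1 k‖ ‖b.1 k‖, le_max_right ‖a.1 k‖ ‖b.1 k‖]
  refine (S.root_mono k (norm_nonneg _) h2).trans ?_
  rw [S.root_mul k two_pos.le (le_max_of_le_left (norm_nonneg _))]
  refine mul_le_mul_of_nonneg_left ?_ (S.root_nonneg k two_pos.le)
  rcases max_choice ‖a.1 k‖ ‖b.1 k‖ with h | h <;> rw [h]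
  · exact le_max_left _ _
  · exact le_max_right _ _

variable (S K)

/-- The ideal of sequences with `lim_ω |a_k| ^ (1 / lam k) = 0`. -/
def nullIdeal : Ideal (boundedSeq S K) where
  carrier := {a | seqAbs S K a = 0}
  add_mem' := by
    intro a b ha hb
    have h := seqAbs_add_le_max a b
    rw [show seqAbs S K a = 0 from ha, show seqAbs S K b = 0 from hb, max_self] at h
    exact le_antisymm h (seqAbs_nonneg _)
  zero_mem' := seqAbs_zero
  smul_mem' := by
    intro c a ha
    change seqAbs S K (c * a) = 0
    rw [seqAbs_mul, show seqAbs S K a = 0 from ha, mul_zero]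

lemma mem_nullIdeal {a : boundedSeq S K} : a ∈ nullIdeal S K ↔ seqAbs S K a = 0 := Iff.rfl

lemma exists_inv {a : boundedSeq S K} (ha : a ∉ nullIdeal S K) :
    ∃ b : boundedSeq S K, b * a - 1 ∈ nullIdeal S K := by
  have hpos : 0 < seqAbs S K a :=
    lt_of_le_of_ne (seqAbs_nonneg a) fun h => ha h.symm
  have hev : ∀ᶠ k in S.ω, seqAbs S K a / 2 < S.root k ‖a.1 k‖ :=
    (tendsto_seqAbs a).eventually (lt_mem_nhds (half_lt_self hpos))
  refine ⟨⟨fun k => (a.1 k)⁻¹, (seqAbs S K a / 2)⁻¹, ?_⟩, ?_⟩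
  · filter_upwards [hev] with k hk
    rw [norm_inv, S.root_inv k (norm_nonneg _)]
    exact inv_anti₀ (half_pos hpos) hk.le
  · refine seqAbs_eq (tendsto_const_nhds.congr' ?_)
    filter_upwards [hev] with k hk
    have hne : a.1 k ≠ 0 := by
      intro h
      rw [h, norm_zero, S.root_zero] at hk
      linarith
    change 0 = S.root k ‖(a.1 k)⁻¹ * a.1 k - 1‖
    rw [inv_mul_cancel₀ hne, sub_self, norm_zero, S.root_zero]

instance nullIdeal_isMaximal : (nullIdeal S K).IsMaximal := by
  rw [Ideal.isMaximal_iff]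
  refine ⟨fun h => ?_, fun J a hJ haI haJ => ?_⟩
  · rw [mem_nullIdeal, seqAbs_one] at h
    exact one_ne_zero h
  · obtain ⟨b, hb⟩ := exists_inv S K haI
    have := J.sub_mem (J.mul_mem_left b haJ) (hJ hb)
    simpa using this

/-- The asymptotic cone `K_ω` of the valued field `K`: bounded sequences modulo null sequences. -/
def FieldCone : Type _ := boundedSeq S K ⧸ nullIdeal S K

instance : Field (FieldCone S K) := Ideal.Quotient.field (nullIdeal S K)

/-- The class `[a_k]` in `K_ω` of a bounded sequence. -/
def FieldCone.mk : boundedSeq S K →+* FieldCone S K := Ideal.Quotient.mk (nullIdeal S K)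

variable {S K} in
lemma FieldCone.mk_eq_mk {a b : boundedSeq S K} :
    FieldCone.mk S K a = FieldCone.mk S K b ↔ seqAbs S K (a - b) = 0 :=
  Ideal.Quotient.eq

variable {S K} in
lemma FieldCone.mk_surjective : Function.Surjective (FieldCone.mk S K) :=
  Ideal.Quotient.mk_surjective

/-- The absolute value `|[a_k]|_ω = lim_ω |a_k| ^ (1 / lam k)` on `K_ω`. -/
def FieldCone.abs (x : FieldCone S K) : ℝ :=
  Quotient.liftOn' x (seqAbs S K) fun a b h => by
    have h0 : seqAbs S K (a - b) = 0 := FieldCone.mk_eq_mk.1 (Quotient.sound' h)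
    have h0' : seqAbs S K (b - a) = 0 := by rw [← neg_sub, seqAbs_neg, h0]
    have h1 := seqAbs_add_le_max (a - b) b
    have h2 := seqAbs_add_le_max (b - a) a
    rw [sub_add_cancel, h0, max_eq_right (seqAbs_nonneg _)] at h1
    rw [sub_add_cancel, h0', max_eq_right (seqAbs_nonneg _)] at h2
    exact le_antisymm h1 h2

variable {S K} in
lemma FieldCone.abs_mk (a : boundedSeq S K) :
    FieldCone.abs S K (FieldCone.mk S K a) = seqAbs S K a := rfl

lemma FieldCone.abs_add_le_max (x y : FieldCone S K) :
    FieldCone.abs S K (x + y) ≤ max (FieldCone.abs S K x) (FieldCone.abs S K y) := by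
  obtain ⟨a, rfl⟩ := FieldCone.mk_surjective x
  obtain ⟨b, rfl⟩ := FieldCone.mk_surjective y
  rw [← map_add]
  exact seqAbs_add_le_max a b

lemma FieldCone.abs_nonneg (x : FieldCone S K) : 0 ≤ FieldCone.abs S K x := by
  obtain ⟨a, rfl⟩ := FieldCone.mk_surjective x
  exact seqAbs_nonneg a

/-- `|·|_ω` as an absolute value. -/
def FieldCone.absoluteValue : AbsoluteValue (FieldCone S K) ℝ where
  toFun := FieldCone.abs S K
  map_mul' x y := by
    obtain ⟨a, rfl⟩ := FieldCone.mk_surjective x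
    obtain ⟨b, rfl⟩ := FieldCone.mk_surjective y
    rw [← map_mul]
    exact seqAbs_mul a b
  nonneg' := FieldCone.abs_nonneg S K
  eq_zero' x := by
    obtain ⟨a, rfl⟩ := FieldCone.mk_surjective x
    rw [FieldCone.abs_mk, ← map_zero (FieldCone.mk S K), FieldCone.mk_eq_mk, sub_zero]
  add_le' x y := (FieldCone.abs_add_le_max S K x y).trans
    (max_le_add_of_nonneg (FieldCone.abs_nonneg S K x) (FieldCone.abs_nonneg S K y))

instance : NormedField (FieldCone S K) := (FieldCone.absoluteValue S K).toNormedField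

instance : IsUltrametricDist (FieldCone S K) :=
  IsUltrametricDist.isUltrametricDist_of_forall_norm_add_le_max_norm
    (FieldCone.abs_add_le_max S K)

end Field

/-! ### Good norms of volume one on `K ^ n` -/

section Norms

/-- The data entering the definition of the space of good norms on `K ^ n`:
`agg` is the function (the `ℓ²`-norm or the maximum) with respect to which bases are adapted,
`IsGood` singles out the good norms among all functions on `K ^ n`. Only the two values
`archModel` and `ultraModel` below are used. -/
structure NormModel (K : Type*) [NormedField K] (n : ℕ) where
  agg : (Fin n → ℝ) → ℝ
  le_agg : ∀ c : Fin n → ℝ, (∀ i, 0 ≤ c i) → ∀ i, c i ≤ agg c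
  agg_le : ∀ c : Fin n → ℝ, (∀ i, 0 ≤ c i) → agg c ≤ ∑ i, c i
  IsGood : ((Fin n → K) → ℝ) → Prop
  good_comp : ∀ (g : Matrix.SpecialLinearGroup (Fin n) K) (N : (Fin n → K) → ℝ), IsGood N →
    IsGood fun v => N (Matrix.SpecialLinearGroup.toLin' g v)

/-- The basis `e` is adapted to `N`: `N (∑ a_i e_i) = agg (N e_i * |a_i|)`. -/
def IsAdapted {K : Type*} [NormedField K] {n : ℕ} (agg : (Fin n → ℝ) → ℝ)
    (N : (Fin n → K) → ℝ) (e : Module.Basis (Fin n) K (Fin n → K)) : Prop :=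
  ∀ a : Fin n → K, N (∑ i, a i • e i) = agg fun i => N (e i) * ‖a i‖

/-- Euclidean (hermitian) norms on `K ^ n`, `K = ℝ` or `ℂ`: square roots of positive definite
quadratic (hermitian) forms, given by their Gram matrix. -/
def IsEuclideanNorm {K : Type*} [RCLike K] {n : ℕ} (N : (Fin n → K) → ℝ) : Prop :=
  ∃ H : Matrix (Fin n) (Fin n) K, H.IsHermitian ∧
    (∀ v : Fin n → K, v ≠ 0 → 0 < RCLike.re (star v ⬝ᵥ H.mulVec v)) ∧
    ∀ v, N v = √(RCLike.re (star v ⬝ᵥ H.mulVec v))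

/-- Ultrametric norms on `K ^ n`. -/
structure IsUltrametricNorm {K : Type*} [NormedField K] {n : ℕ} (N : (Fin n → K) → ℝ) :
    Prop where
  smul : ∀ (a : K) v, N (a • v) = ‖a‖ * N v
  add_le_max : ∀ v w, N (v + w) ≤ max (N v) (N w)
  eq_zero : ∀ v, N v = 0 → v = 0

lemma isAdapted_comp {K : Type*} [NormedField K] {n : ℕ} {agg : (Fin n → ℝ) → ℝ}
    {N : (Fin n → K) → ℝ} (g : (Fin n → K) ≃ₗ[K] (Fin n → K))
    {e : Module.Basis (Fin n) K (Fin n → K)} :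
    IsAdapted agg (fun v => N (g v)) e ↔ IsAdapted agg N (e.map g) := by
  simp [IsAdapted, map_sum]

/-- The case `K = ℝ` or `ℂ`: good norms are the euclidean (hermitian) norms, and adapted bases are
the orthogonal ones. -/
def archModel (K : Type*) [RCLike K] (n : ℕ) : NormModel K n where
  agg c := √(∑ i, c i ^ 2)
  le_agg c hc i := Real.le_sqrt_of_sq_le
    (Finset.single_le_sum (f := fun i => c i ^ 2) (fun j _ => sq_nonneg (c j)) (Finset.mem_univ i))
  agg_le c hc := by
    refine Real.sqrt_le_iff.2 ⟨Finset.sum_nonneg fun i _ => hc i, ?_⟩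
    exact Finset.sum_sq_le_sq_sum_of_nonneg fun i _ => hc i
  IsGood N := IsEuclideanNorm N
  good_comp := by
    rintro g N ⟨H, hH, hpos, hN⟩
    have key : ∀ v : Fin n → K,
        star v ⬝ᵥ ((g.1.conjTranspose * H * g.1).mulVec v)
          = star (g.1.mulVec v) ⬝ᵥ H.mulVec (g.1.mulVec v) := by
      intro v
      rw [Matrix.star_mulVec, ← Matrix.dotProduct_mulVec, Matrix.mulVec_mulVec,
        Matrix.mulVec_mulVec, Matrix.mul_assoc]
    refine ⟨g.1.conjTranspose * H * g.1, Matrix.isHermitian_conjTranspose_mul_mul _ hH, ?_, ?_⟩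
    · intro v hv
      rw [key]
      refine hpos _ fun h => hv ?_
      exact (LinearEquiv.map_eq_zero_iff (Matrix.SpecialLinearGroup.toLin' g)).1 h
    · intro v
      rw [key]
      exact hN _

/-- The ultrametric case: good norms are the ultrametric norms which have an adapted basis, where
`e` is adapted to `N` if `N (∑ a_i e_i) = max (N e_i * |a_i|)`. -/
def ultraModel (K : Type*) [NormedField K] [IsUltrametricDist K] (n : ℕ) : NormModel K n where
  agg c := ⨆ i, c i
  le_agg c _ i := le_ciSup (Set.finite_range c).bddAbove i
  agg_le c hc := Real.iSup_le
    (fun i => Finset.single_le_sum (fun j _ => hc j) (Finset.mem_univ i))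
    (Finset.sum_nonneg fun i _ => hc i)
  IsGood N := IsUltrametricNorm N ∧ ∃ e, IsAdapted (fun c => ⨆ i, c i) N e
  good_comp := by
    rintro g N ⟨⟨h1, h2, h3⟩, e, he⟩
    refine ⟨⟨fun a v => ?_, fun v w => ?_, fun v hv => ?_⟩,
      e.map (Matrix.SpecialLinearGroup.toLin' g).symm, ?_⟩
    · rw [map_smul, h1]
    · rw [map_add]; exact h2 _ _
    · exact (LinearEquiv.map_eq_zero_iff _).1 (h3 _ hv)
    · rw [isAdapted_comp]
      convert he
      ext1 i
      simp

variable {K : Type*} [NormedField K] {n : ℕ} (M : NormModel K n)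

/-- The determinant of a basis relative to the canonical basis of `K ^ n`. -/
def basisDet (e : Module.Basis (Fin n) K (Fin n → K)) : K := (Pi.basisFun K (Fin n)).det e

/-- `N` has volume one: `∏ N (e_i) = 1` for every adapted basis `e` of determinant one. -/
def HasVolumeOne (N : (Fin n → K) → ℝ) : Prop :=
  ∀ e : Module.Basis (Fin n) K (Fin n → K), basisDet e = 1 → IsAdapted M.agg N e →
    ∏ i, N (e i) = 1

/-- The space `Es(K)` of good norms of volume one on `K ^ n`: the symmetric space, respectively
the Bruhat-Tits building, of `SL_n(K)`. -/
def Es : Type _ := {N : (Fin n → K) → ℝ // M.IsGood N ∧ HasVolumeOne M N}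

instance : CoeFun (Es M) fun _ => (Fin n → K) → ℝ := ⟨fun N => N.1⟩

/-- The action `g • N = N ∘ g⁻¹` of `SL_n(K)` on `Es(K)`. -/
instance : MulAction (Matrix.SpecialLinearGroup (Fin n) K) (Es M) where
  smul g N := ⟨fun v => N (Matrix.SpecialLinearGroup.toLin' g⁻¹ v),
    M.good_comp g⁻¹ N.1 N.2.1, by
      intro e he had
      rw [isAdapted_comp] at had
      have := N.2.2 _ ?_ had
      · simpa using this
      · have h : ((e.map (Matrix.SpecialLinearGroup.toLin' g⁻¹) :
            Module.Basis (Fin n) K (Fin n → K)) : Fin n → Fin n → K)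
            = (Matrix.SpecialLinearGroup.toLin' g⁻¹ : (Fin n → K) →ₗ[K] (Fin n → K)) ∘ e := by
          ext1 i; simp
        rw [basisDet, h, Module.Basis.det_comp, Matrix.SpecialLinearGroup.toLin'_to_linearMap,
          LinearMap.det_toLin', Matrix.SpecialLinearGroup.det_coe, one_mul]
        exact he⟩
  one_smul N := by
    apply Subtype.ext
    funext v
    change N.1 (Matrix.SpecialLinearGroup.toLin' 1⁻¹ v) = N.1 v
    simp
  mul_smul g h N := by
    apply Subtype.ext
    funext v
    change N.1 (Matrix.SpecialLinearGroup.toLin' (g * h)⁻¹ v)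
      = N.1 (Matrix.SpecialLinearGroup.toLin' h⁻¹ (Matrix.SpecialLinearGroup.toLin' g⁻¹ v))
    rw [mul_inv_rev, map_mul]
    rfl

/-- The canonical norm of `K ^ n` (euclidean norm, respectively maximum of the coordinates). -/
def canonicalNorm (v : Fin n → K) : ℝ := M.agg fun i => ‖v i‖

/-- The distance `d(N, N') = sqrt (∑ |log (N'(e_i) / N(e_i))|²)`, where `e` is a basis adapted to
both `N` and `N'` (the set of which the infimum is taken is a singleton). -/
def dist (N N' : (Fin n → K) → ℝ) : ℝ :=
  sInf {r | ∃ e : Module.Basis (Fin n) K (Fin n → K), IsAdapted M.agg N e ∧ IsAdapted M.agg N' e ∧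
    r = √(∑ i, |Real.log (N' (e i) / N (e i))| ^ 2)}

/-- The operator norm on matrices associated with the canonical norm. -/
def opNorm (u : Matrix (Fin n) (Fin n) K) : ℝ :=
  sInf {C | 0 ≤ C ∧ ∀ v, canonicalNorm M (u.mulVec v) ≤ C * canonicalNorm M v}

lemma norm_apply_le (u : Matrix (Fin n) (Fin n) K) (i j : Fin n) : ‖u i j‖ ≤ opNorm M u := by
  refine le_csInf ⟨∑ i, ∑ j, ‖u i j‖, Finset.sum_nonneg fun i _ => Finset.sum_nonneg fun j _ =>
    norm_nonneg _, fun v => ?_⟩ ?_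
  · refine (M.agg_le _ fun i => norm_nonneg (u.mulVec v i)).trans ?_
    rw [Finset.sum_mul]
    refine Finset.sum_le_sum fun i _ => ?_
    rw [Finset.sum_mul]
    change ‖∑ j, u i j * v j‖ ≤ _
    refine (norm_sum_le _ _).trans (Finset.sum_le_sum fun j _ => ?_)
    rw [norm_mul]
    exact mul_le_mul_of_nonneg_left (M.le_agg (fun i => ‖v i‖) (fun i => norm_nonneg _) j)
      (norm_nonneg _)
  · rintro C ⟨hC, h⟩
    have h1 := h (Pi.single j 1)
    have h2 : canonicalNorm M (Pi.single j 1) ≤ 1 := by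
      refine (M.agg_le _ fun i => norm_nonneg ((Pi.single j 1 : Fin n → K) i)).trans ?_
      rw [Finset.sum_eq_single j]
      · simp
      · intro b _ hb
        simp [hb]
      · simp
    have h3 : ‖u i j‖ ≤ canonicalNorm M (u.mulVec (Pi.single j 1)) := by
      have := M.le_agg (fun i => ‖u.mulVec (Pi.single j 1) i‖) (fun i => norm_nonneg _) i
      rw [Matrix.mulVec_single_one] at this ⊢
      exact this
    exact h3.trans (h1.trans (mul_le_of_le_one_right hC h2))

lemma opNorm_le_sum (u : Matrix (Fin n) (Fin n) K) : opNorm M u ≤ ∑ i, ∑ j, ‖u i j‖ := by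
  refine csInf_le ⟨0, fun C hC => hC.1⟩ ⟨Finset.sum_nonneg fun i _ => Finset.sum_nonneg fun j _ =>
    norm_nonneg _, fun v => ?_⟩
  refine (M.agg_le _ fun i => norm_nonneg (u.mulVec v i)).trans ?_
  rw [Finset.sum_mul]
  refine Finset.sum_le_sum fun i _ => ?_
  rw [Finset.sum_mul]
  change ‖∑ j, u i j * v j‖ ≤ _
  refine (norm_sum_le _ _).trans (Finset.sum_le_sum fun j _ => ?_)
  rw [norm_mul]
  exact mul_le_mul_of_nonneg_left (M.le_agg (fun i => ‖v i‖) (fun i => norm_nonneg _) j)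
    (norm_nonneg _)

lemma opNorm_nonneg (u : Matrix (Fin n) (Fin n) K) : 0 ≤ opNorm M u :=
  Real.sInf_nonneg fun _ hC => hC.1

/-- The hyperplane `∑ α_i = 0` of `ℝ ^ n`. -/
abbrev ModelFlatSubmodule (n : ℕ) : Submodule ℝ (EuclideanSpace ℝ (Fin n)) where
  carrier := {α | ∑ i, α i = 0}
  add_mem' := by
    intro a b ha hb
    simp only [Set.mem_ofPred_eq] at ha hb ⊢
    simp [Finset.sum_add_distrib, ha, hb]
  zero_mem' := by simp
  smul_mem' := by
    intro c a ha
    simp only [Set.mem_ofPred_eq] at ha ⊢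
    simp [← Finset.mul_sum, ha]

/-- The model flat `𝔸 = {α ∈ ℝ ^ n | ∑ α_i = 0}`, with the euclidean metric of `ℝ ^ n`. -/
abbrev Flat (n : ℕ) : Type := ModelFlatSubmodule n

/-- The marked maximal flats (marked apartments) of `Es(K)`: the maps `f_e : 𝔸 → Es(K)`, for `e` a
basis of determinant one, such that `N = f_e(α)` is adapted to `e` and `N(e_i) = exp (-α_i)`. -/
def markedFlats : Set (Flat n → Es M) :=
  {f | ∃ e : Module.Basis (Fin n) K (Fin n → K), basisDet e = 1 ∧
    ∀ α, IsAdapted M.agg (f α) e ∧ ∀ i, f α (e i) = Real.exp (-α.1 i)}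

end Norms

/-! ### Affine buildings of type `A_{n-1}` -/

section Building

variable {n : ℕ}

/-- The affine Weyl group of `SL_n(F)` acting on `𝔸`: permutations of the coordinates composed with
translations by vectors of `𝔸` with coordinates in `log |Fˣ|`. -/
def affineWeyl (F : Type*) [NormedField F] (n : ℕ) : Set (Flat n → Flat n) :=
  {w | ∃ (σ : Equiv.Perm (Fin n)) (c : Fin n → Fˣ),
    ∀ α i, (w α).1 i = α.1 (σ i) + Real.log ‖(c i : F)‖}

/-- The closed Weyl chamber of `𝔸` with vertex `a` and direction `σ`. -/
def weylChamber (a : Flat n) (σ : Equiv.Perm (Fin n)) : Set (Flat n) :=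
  {α | ∀ i j, i ≤ j → (α - a).1 (σ j) ≤ (α - a).1 (σ i)}

/-- Closed half-spaces of `𝔸` bounded by a hyperplane parallel to a wall of the Weyl group. -/
def IsHalfFlat (H : Set (Flat n)) : Prop :=
  ∃ (i j : Fin n) (c : ℝ), i ≠ j ∧ H = {α | c ≤ α.1 i - α.1 j}

/-- `X` with the system `A` of marked apartments `𝔸 → X` is an affine building (not necessarily
discrete) modelled on `(𝔸, W)`. -/
structure IsAffineBuilding (W : Set (Flat n → Flat n)) {X : Type*} (A : Set (Flat n → X)) :
    Prop where
  injective : ∀ f ∈ A, Function.Injective f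
  /-- (A1) invariance under precomposition by `W` -/
  comp_mem : ∀ f ∈ A, ∀ w ∈ W, f ∘ w ∈ A
  /-- (A2) compatibility of apartments -/
  closed_convex : ∀ f ∈ A, ∀ f' ∈ A,
    IsClosed (f ⁻¹' Set.range f') ∧ Convex ℝ (f ⁻¹' Set.range f')
  compatible : ∀ f ∈ A, ∀ f' ∈ A, ∃ w ∈ W, ∀ α ∈ f ⁻¹' Set.range f', f α = f' (w α)
  /-- (A3) any two points lie in a common apartment -/
  common_apartment : ∀ x y : X, ∃ f ∈ A, x ∈ Set.range f ∧ y ∈ Set.range f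
  /-- (A4) any two Weyl chambers contain subchambers lying in a common apartment -/
  common_subchambers : ∀ f ∈ A, ∀ f' ∈ A, ∀ a σ a' σ',
    ∃ b ∈ weylChamber a σ, ∃ b' ∈ weylChamber a' σ', ∃ f'' ∈ A,
      f '' weylChamber b σ ⊆ Set.range f'' ∧ f' '' weylChamber b' σ' ⊆ Set.range f''
  /-- (A5) three apartments meeting pairwise in half-apartments have a common point -/
  tripod : ∀ f ∈ A, ∀ f' ∈ A, ∀ f'' ∈ A, IsHalfFlat (f ⁻¹' Set.range f') →
    IsHalfFlat (f ⁻¹' Set.range f'') → IsHalfFlat (f' ⁻¹' Set.range f'') →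
    (Set.range f ∩ Set.range f' ∩ Set.range f'').Nonempty

/-- An isomorphism from `(X, A)` to `(Y, B)`: a bijection exchanging the systems of marked
apartments. -/
def IsBuildingIso {X Y : Type*} (A : Set (Flat n → X)) (B : Set (Flat n → Y)) (φ : X → Y) : Prop :=
  Function.Bijective φ ∧ ∀ f : Flat n → X, f ∈ A ↔ φ ∘ f ∈ B

end Building

/-! ### Asymptotic cones of `Es(K)` and of `SL_n(K)` -/

section Cone

variable {K : Type*} [NormedField K] {n : ℕ} (M : NormModel K n) (S : Scale)

/-- The sequence `x` in `Es(K)` is `ω`-bounded: `d(o, x_k) / lam k` is `ω`-bounded, `o` being the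
canonical norm. -/
def IsBoundedSeq (x : ℕ → Es M) : Prop :=
  ∃ C : ℝ, ∀ᶠ k in S.ω, dist M (canonicalNorm M) (x k) / S.lam k ≤ C

/-- The asymptotic cone of `Es(K)` with respect to `ω`, the constant sequence of base points `o`
and the scalars `lam`: `ω`-bounded sequences modulo `lim_ω d(x_k, y_k) / lam k = 0`. -/
def Cone : Type _ :=
  Quot fun x y : {x : ℕ → Es M // IsBoundedSeq M S x} =>
    Tendsto (fun k => dist M (x.1 k) (y.1 k) / S.lam k) S.ω (𝓝 0)

/-- The class `[x_k]` in the cone. -/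
def Cone.mk (x : {x : ℕ → Es M // IsBoundedSeq M S x}) : Cone M S := Quot.mk _ x

/-- The marked apartments of the cone: the ultralimits `α ↦ [f_k (lam k • α)]` of `ω`-bounded
sequences of marked flats `f_k` of `Es(K)`. -/
def coneApartments : Set (Flat n → Cone M S) :=
  {F | ∃ f : ℕ → Flat n → Es M, (∀ k, f k ∈ markedFlats M) ∧ IsBoundedSeq M S (fun k => f k 0) ∧
    ∀ α, ∃ h : IsBoundedSeq M S (fun k => f k (S.lam k • α)), F α = Cone.mk M S ⟨_, h⟩}

lemma isBounded_iff (u : ℕ → Matrix (Fin n) (Fin n) K) :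
    (∃ C : ℝ, ∀ᶠ k in S.ω, S.root k (opNorm M (u k)) ≤ C) ↔
      ∀ i j, (fun k => u k i j) ∈ boundedSeq S K := by
  constructor
  · rintro ⟨C, hC⟩ i j
    exact ⟨C, hC.mono fun k hk => (S.root_mono k (norm_nonneg _) (norm_apply_le M _ i j)).trans hk⟩
  · intro h
    choose C hC using h
    refine ⟨∑ i, ∑ j, C i j, ?_⟩
    have h : ∀ᶠ k in S.ω, ∀ i j, S.root k ‖u k i j‖ ≤ C i j :=
      eventually_all.2 fun i => eventually_all.2 fun j => hC i j
    filter_upwards [h] with k hk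
    refine (S.root_mono k (opNorm_nonneg M _) (opNorm_le_sum M _)).trans ?_
    refine (S.root_sum_le k _ _ fun i => Finset.sum_nonneg fun j _ => norm_nonneg _).trans ?_
    refine Finset.sum_le_sum fun i _ => ?_
    exact (S.root_sum_le k _ _ fun j => norm_nonneg _).trans (Finset.sum_le_sum fun j _ => hk i j)

lemma tendsto_zero_iff (u : ℕ → Matrix (Fin n) (Fin n) K) :
    Tendsto (fun k => S.root k (opNorm M (u k))) S.ω (𝓝 0) ↔
      ∀ i j, Tendsto (fun k => S.root k ‖u k i j‖) S.ω (𝓝 0) := by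
  constructor
  · intro h i j
    exact squeeze_zero (fun k => S.root_nonneg k (norm_nonneg _))
      (fun k => S.root_mono k (norm_nonneg _) (norm_apply_le M _ i j)) h
  · intro h
    have h2 : Tendsto (fun k => ∑ i, ∑ j, S.root k ‖u k i j‖) S.ω (𝓝 0) := by
      have := tendsto_finsetSum Finset.univ fun i _ =>
        tendsto_finsetSum Finset.univ fun j _ => h i j
      simpa using this
    refine squeeze_zero (fun k => S.root_nonneg k (opNorm_nonneg M _)) (fun k => ?_) h2
    refine (S.root_mono k (opNorm_nonneg M _) (opNorm_le_sum M _)).trans ?_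
    refine (S.root_sum_le k _ _ fun i => Finset.sum_nonneg fun j _ => norm_nonneg _).trans ?_
    exact Finset.sum_le_sum fun i _ => S.root_sum_le k _ _ fun j => norm_nonneg _

/-- Bounded sequences of matrices of determinant one, seen as a matrix of sequences. -/
def seqMatrix (g : ℕ → Matrix.SpecialLinearGroup (Fin n) K)
    (h : ∀ i j, (fun k => (g k).1 i j) ∈ boundedSeq S K) :
    Matrix.SpecialLinearGroup (Fin n) (boundedSeq S K) :=
  ⟨Matrix.of fun i j => ⟨fun k => (g k).1 i j, h i j⟩, by
    apply Subtype.ext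
    funext k
    let ev : boundedSeq S K →+* K := (Pi.evalRingHom (fun _ : ℕ => K) k).comp (boundedSeq S K).subtype
    change ev _ = 1
    rw [RingHom.map_det]
    exact (g k).2⟩

/-- The group of sequences `(g_k)` in `SL_n(K)` such that `N(g_k) ^ (1 / lam k)` is `ω`-bounded,
where `N` is the operator norm. -/
def boundedSL : Subgroup (ℕ → Matrix.SpecialLinearGroup (Fin n) K) where
  carrier := {g | ∃ C : ℝ, ∀ᶠ k in S.ω, S.root k (opNorm M (g k).1) ≤ C}
  mul_mem' := by
    intro g h hg hh
    have hg' := (isBounded_iff M S fun k => (g k).1).1 hg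
    have hh' := (isBounded_iff M S fun k => (h k).1).1 hh
    refine (isBounded_iff M S fun k => (g k * h k).1).2 fun i j => ?_
    convert ((seqMatrix S g hg').1 * (seqMatrix S h hh').1) i j |>.2 using 1
    funext k
    simp [seqMatrix, Matrix.mul_apply]
  one_mem' := by
    refine (isBounded_iff M S fun _ => 1).2 fun i j => ?_
    convert ((1 : Matrix (Fin n) (Fin n) (boundedSeq S K)) i j).2 using 1
    funext k
    by_cases hij : i = j <;> simp [Matrix.one_apply, hij]
  inv_mem' := by
    intro g hg
    have hg' := (isBounded_iff M S fun k => (g k).1).1 hg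
    refine (isBounded_iff M S fun k => (g k)⁻¹.1).2 fun i j => ?_
    convert ((seqMatrix S g hg').1.adjugate i j).2 using 1
    funext k
    let ev : boundedSeq S K →+* K := (Pi.evalRingHom (fun _ : ℕ => K) k).comp (boundedSeq S K).subtype
    change (g k)⁻¹.1 i j = ev _
    rw [show ev ((seqMatrix S g hg').1.adjugate i j) = ev.mapMatrix (seqMatrix S g hg').1.adjugate i j
      from rfl, RingHom.map_adjugate]
    exact congrFun (congrFun (Matrix.SpecialLinearGroup.coe_inv (g k)) i) j

/-- `(g_k) ↦ ([(g_k)_{ij}])_{ij}`, from bounded sequences in `SL_n(K)` to `SL_n(K_ω)`. -/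
def psiSeq : boundedSL M S →* Matrix.SpecialLinearGroup (Fin n) (FieldCone S K) where
  toFun g := Matrix.SpecialLinearGroup.map (FieldCone.mk S K)
    (seqMatrix S g.1 ((isBounded_iff M S fun k => (g.1 k).1).1 g.2))
  map_one' := by
    rw [← map_one (Matrix.SpecialLinearGroup.map (n := Fin n) (FieldCone.mk S K))]
    congr 1
    ext i j k
    by_cases hij : i = j <;> simp [seqMatrix, Matrix.one_apply, hij]
  map_mul' g h := by
    rw [← map_mul]
    congr 1
    ext i j k
    change ((g.1 k).1 * (h.1 k).1) i j = ((((seqMatrix S g.1 _).1 * (seqMatrix S h.1 _).1) i j :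
      boundedSeq S K) : ℕ → K) k
    simp [seqMatrix, Matrix.mul_apply]

lemma psiSeq_eq_iff (g h : boundedSL M S) : psiSeq M S g = psiSeq M S h ↔
    Tendsto (fun k => S.root k (opNorm M ((g.1 k).1 - (h.1 k).1))) S.ω (𝓝 0) := by
  rw [tendsto_zero_iff M S fun k => (g.1 k).1 - (h.1 k).1, Matrix.SpecialLinearGroup.ext_iff]
  refine forall_congr' fun i => forall_congr' fun j => ?_
  refine FieldCone.mk_eq_mk.trans ⟨fun h0 => ?_, fun h0 => seqAbs_eq h0⟩
  rw [← h0]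
  exact tendsto_seqAbs _

/-- Two bounded sequences in `SL_n(K)` are identified if `lim_ω N(g_k - h_k) ^ (1 / lam k) = 0`. -/
def slCon : Con (boundedSL M S) where
  r g h := Tendsto (fun k => S.root k (opNorm M ((g.1 k).1 - (h.1 k).1))) S.ω (𝓝 0)
  iseqv := by
    refine ⟨fun g => ?_, fun {g h} e => ?_, fun {g h l} e e' => ?_⟩ <;>
      simp only [← psiSeq_eq_iff] at *
    · exact e.symm
    · exact e.trans e'
  mul' := by
    intro g g' h h' e e'
    rw [← psiSeq_eq_iff] at *
    rw [map_mul, map_mul, e, e']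

/-- The asymptotic cone `SL_n(K)_ω` of `SL_n(K)`. -/
abbrev SLCone : Type _ := (slCon M S).Quotient

/-- The class `[g_k]` in `SL_n(K)_ω`. -/
def SLCone.mk : boundedSL M S →* SLCone M S := (slCon M S).mk'

/-- The homomorphism `ψ : SL_n(K)_ω → SL_n(K_ω)`, sending `[g_k]` to the matrix with coefficients
`[(g_k)_{ij}]`. -/
def psi : SLCone M S →* Matrix.SpecialLinearGroup (Fin n) (FieldCone S K) :=
  (slCon M S).lift (psiSeq M S) fun {g h} e => (psiSeq_eq_iff M S g h).2 e

/-- The Bruhat-Tits building of `SL_n(K_ω)`. -/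
abbrev EsCone (S : Scale) (K : Type*) [NormedField K] (n : ℕ) : Type _ :=
  Es (ultraModel (FieldCone S K) n)

/-- `φ` is the map `[N_k] ↦ lim_ω N_k ^ (1 / lam k)` from the asymptotic cone of `Es(K)` to the
building of `SL_n(K_ω)`: its value at `[N_k]`, evaluated at the vector of `K_ω ^ n` with
coordinates `[a_k^i]`, is `lim_ω N_k(a_k^1, …, a_k^n) ^ (1 / lam k)`. -/
def IsLimitMap (φ : Cone M S → EsCone S K n) : Prop :=
  ∀ (N : {x : ℕ → Es M // IsBoundedSeq M S x}) (a : Fin n → boundedSeq S K),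
    Tendsto (fun k => S.root k (N.1 k fun i => (a i).1 k)) S.ω
      (𝓝 (φ (Cone.mk M S N) fun i => FieldCone.mk S K (a i)))

/-- `φ` is isometric: `lim_ω d(x_k, y_k) / lam k = d(φ [x_k], φ [y_k])`. -/
def IsIsometric (φ : Cone M S → EsCone S K n) : Prop :=
  ∀ x y : {x : ℕ → Es M // IsBoundedSeq M S x},
    Tendsto (fun k => dist M (x.1 k) (y.1 k) / S.lam k) S.ω
      (𝓝 (dist (ultraModel (FieldCone S K) n) (φ (Cone.mk M S x)) (φ (Cone.mk M S y))))

/-- `φ` is `ψ`-equivariant for the action `[g_k] • [N_k] = [g_k • N_k]` of `SL_n(K)_ω` on the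
asymptotic cone. -/
def IsPsiEquivariant (φ : Cone M S → EsCone S K n) : Prop :=
  ∀ (g : boundedSL M S) (x : {x : ℕ → Es M // IsBoundedSeq M S x}),
    ∃ h : IsBoundedSeq M S fun k => g.1 k • x.1 k,
      φ (Cone.mk M S ⟨_, h⟩) = psi M S (SLCone.mk M S g) • φ (Cone.mk M S x)

end Cone

end AsymptoticCone

end

open AsymptoticCone

/-!
The key point is that raising to the power `1 / lam k` turns both the `ℓ²`-norm and the maximum into
the maximum in the limit (`tendsto_root_agg`), so that a bounded sequence of good norms, archimedean
or not, has a limit which is a good ultrametric norm over `K_ω`.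

The euclidean, hermitian and ultrametric norms enter the argument only through the properties
collected in `NormModel.IsRegular`, the main ones being that two good norms have a common adapted
basis, and that the ratios of their values on such a basis are, up to order, independent of it.
In the ultrametric case the common basis is built by induction on the dimension
(`exists_common_isSplitBy`), and independence comes from a dominant term in the Leibniz expansion of
the determinant of a transition matrix (`IsSplitBy.eq_of_perm`). In the archimedean case these facts
are the simultaneous diagonalisation of two hermitian forms and the comparison of Gram matrices
(`archModel_isRegular`).

The limit norm is computed as follows. Common adapted bases of two bounded sequences of norms, once
normalised, form a matrix over the ring of bounded sequences whose determinant is a unit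
(`exists_common_seqBasis`): the determinant cannot degenerate, because the volume is one and the
norms are comparable to the canonical norm. Coordinates in these bases pass to the limit, so the
limit norm exists, has volume one and is adapted to the limit basis (`exists_isLimitNorm`,
`IsLimitNorm.isAdapted`), and distances divided by `lam k` converge to the distance of the limits
(`IsLimitNorm.tendsto_dist`). Hence `φ` is well defined, isometric and injective.

Every matrix of determinant one over `K_ω` lifts to a bounded sequence in `SL_n(K)`
(`psiSeq_surjective`). All marked flats are translates of the standard one under `SL_n`, and `φ` is
equivariant and sends the cone of the standard flat to the standard flat; so `φ` is surjective and
exchanges the marked apartments (`limitMap_isBuildingIso`).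

It remains to see that good ultrametric norms of volume one over any ultrametric field form an
affine building (`isAffineBuilding_ultraModel`); the cone then is one by transport along `φ`.
Norms adapted to two bases are described by inequalities between coordinates, which gives the
compatibility of apartments. Common subchambers come from the Bruhat decomposition
(`exists_bruhat`). For three apartments meeting pairwise in half-apartments, the essential case is
that of two opposite half-apartments, where the transition matrices are elementary up to units and
the product of their off-diagonal entries is bounded by one (`tripod_of_eq_on_half`).
-/

noncomputable section

namespace AsymptoticCone

/-! ### Regular models of norms -/

section Regular

variable {K : Type*} [NormedField K] {n : ℕ}

lemma basisDet_ne_zero (e : Module.Basis (Fin n) K (Fin n → K)) : basisDet e ≠ 0 :=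
  ((Pi.basisFun K (Fin n)).isUnit_det e).ne_zero

lemma basisDet_unitsSMul (e : Module.Basis (Fin n) K (Fin n → K)) (c : Fin n → Kˣ) :
    basisDet (e.unitsSMul c) = (∏ i, (c i : K)) * basisDet e := by
  have h : (e.unitsSMul c : Fin n → Fin n → K) = fun i => (c i : K) • e i := by
    ext1 i
    rw [Module.Basis.unitsSMul_apply]
    rfl
  rw [basisDet, h, AlternatingMap.map_smul_univ, smul_eq_mul, basisDet]

lemma basisDet_reindex (e : Module.Basis (Fin n) K (Fin n → K)) (σ : Equiv.Perm (Fin n)) :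
    basisDet (e.reindex σ.symm) = (Equiv.Perm.sign σ : ℤ) * basisDet e := by
  have h : (e.reindex σ.symm : Fin n → Fin n → K) = e ∘ σ := by
    ext1 i; simp
  rw [basisDet, h, AlternatingMap.map_perm, basisDet]
  rcases Int.units_eq_one_or (Equiv.Perm.sign σ) with h | h <;> simp [h]

lemma norm_sign (σ : Equiv.Perm (Fin n)) : ‖((Equiv.Perm.sign σ : ℤ) : K)‖ = 1 := by
  rcases Int.units_eq_one_or (Equiv.Perm.sign σ) with h | h <;> simp [h]

lemma norm_basisDet_reindex (e : Module.Basis (Fin n) K (Fin n → K)) (σ : Equiv.Perm (Fin n)) :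
    ‖basisDet (e.reindex σ)‖ = ‖basisDet e‖ := by
  have := basisDet_reindex e σ.symm
  rw [Equiv.symm_symm] at this
  rw [this, norm_mul, norm_sign, one_mul]

/-- Any basis can be rescaled to determinant one; if its determinant has absolute value one, scalars
of absolute value one suffice. -/
lemma exists_units_det_one (e : Module.Basis (Fin n) K (Fin n → K)) :
    ∃ c : Fin n → Kˣ, basisDet (e.unitsSMul c) = 1 ∧
      (‖basisDet e‖ = 1 → ∀ i, ‖(c i : K)‖ = 1) := by
  rcases n with _ | n
  · refine ⟨1, ?_, fun _ i => i.elim0⟩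
    simp [basisDet]
  · refine ⟨Function.update 1 0 (Units.mk0 _ (basisDet_ne_zero e))⁻¹, ?_, fun h i => ?_⟩
    · have h : ∏ i, ((Function.update 1 0 (Units.mk0 _ (basisDet_ne_zero e))⁻¹ :
          Fin (n + 1) → Kˣ) i : K) = (basisDet e)⁻¹ := by
        rw [Fin.prod_univ_succ]
        simp
      rw [basisDet_unitsSMul, h, inv_mul_cancel₀ (basisDet_ne_zero e)]
    · by_cases hi : i = 0
      · subst hi
        simp [h]
      · simp [hi]

lemma isAdapted_iff_repr {agg : (Fin n → ℝ) → ℝ} {N : (Fin n → K) → ℝ}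
    {e : Module.Basis (Fin n) K (Fin n → K)} :
    IsAdapted agg N e ↔ ∀ v, N v = agg fun i => N (e i) * ‖e.repr v i‖ := by
  constructor
  · intro h v
    rw [← h, e.sum_repr]
  · intro h a
    rw [h]
    congr 1
    ext1 i
    simp [Finsupp.single_apply]

/-- The properties of a space of good norms on `K ^ n` which are common to the archimedean and the
ultrametric models: good norms are homogeneous and positive, prescribing positive values on a basis
defines a good norm, any two good norms have a common adapted basis, adapted bases compute a volume,
and the ratios of two norms along a common adapted basis do not depend on the basis. -/
structure NormModel.IsRegular (M : NormModel K n) : Prop where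
  mono : ∀ c d : Fin n → ℝ, (∀ i, 0 ≤ c i) → (∀ i, c i ≤ d i) → M.agg c ≤ M.agg d
  smul : ∀ (t : ℝ) (c : Fin n → ℝ), 0 ≤ t → M.agg (fun i => t * c i) = t * M.agg c
  good_smul : ∀ N, M.IsGood N → ∀ (a : K) v, N (a • v) = ‖a‖ * N v
  good_pos : ∀ N, M.IsGood N → ∀ v, v ≠ 0 → 0 < N v
  good_of_basis : ∀ (e : Module.Basis (Fin n) K (Fin n → K)) (c : Fin n → ℝ), (∀ i, 0 < c i) →
    M.IsGood fun v => M.agg fun i => c i * ‖e.repr v i‖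
  common_basis : ∀ N N', M.IsGood N → M.IsGood N' →
    ∃ e, IsAdapted M.agg N e ∧ IsAdapted M.agg N' e
  volume : ∀ N, M.IsGood N → ∀ e e', IsAdapted M.agg N e → IsAdapted M.agg N e' →
    ‖basisDet e'‖ * ∏ i, N (e i) = ‖basisDet e‖ * ∏ i, N (e' i)
  ratio_perm : ∀ N N', M.IsGood N → M.IsGood N' → ∀ e e', IsAdapted M.agg N e →
    IsAdapted M.agg N e' → IsAdapted M.agg N' e → IsAdapted M.agg N' e' →
    ∃ σ : Equiv.Perm (Fin n), ∀ j, N' (e' j) / N (e' j) = N' (e (σ j)) / N (e (σ j))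

variable {M : NormModel K n}

lemma agg_single (M : NormModel K n) (i : Fin n) {c : ℝ} (hc : 0 ≤ c) :
    M.agg (Pi.single i c) = c := by
  have h0 : ∀ j, 0 ≤ (Pi.single i c : Fin n → ℝ) j := fun j => by
    by_cases h : j = i
    · subst h; simpa
    · simp [h]
  refine le_antisymm ?_ ?_
  · simpa using M.agg_le _ h0
  · simpa using M.le_agg _ h0 i

lemma isGood_nonneg (hM : M.IsRegular) {N : (Fin n → K) → ℝ} (hN : M.IsGood N) (v : Fin n → K) :
    0 ≤ N v := by
  by_cases hv : v = 0
  · have := hM.good_smul N hN 0 v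
    rw [zero_smul, norm_zero, zero_mul] at this
    rw [hv, this]
  · exact (hM.good_pos N hN v hv).le

lemma isGood_basis_pos (hM : M.IsRegular) {N : (Fin n → K) → ℝ} (hN : M.IsGood N)
    (e : Module.Basis (Fin n) K (Fin n → K)) (i : Fin n) : 0 < N (e i) :=
  hM.good_pos N hN _ (e.ne_zero i)

/-- Prescribing positive values on a basis defines a good norm adapted to this basis. -/
lemma exists_good_of_basis (hM : M.IsRegular) (e : Module.Basis (Fin n) K (Fin n → K))
    (c : Fin n → ℝ) (hc : ∀ i, 0 < c i) :
    ∃ N, M.IsGood N ∧ IsAdapted M.agg N e ∧ ∀ i, N (e i) = c i := by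
  have h : ∀ i, (M.agg fun j => c j * ‖e.repr (e i) j‖) = c i := by
    intro i
    convert agg_single M i (hc i).le using 2
    ext1 j
    by_cases hij : j = i
    · subst hij; simp
    · simp [hij]
  refine ⟨_, hM.good_of_basis e c hc, ?_, h⟩
  rw [isAdapted_iff_repr]
  intro v
  simp only [h]

lemma isAdapted_unitsSMul (hM : M.IsRegular) {N : (Fin n → K) → ℝ} (hN : M.IsGood N)
    {e : Module.Basis (Fin n) K (Fin n → K)} (he : IsAdapted M.agg N e) (c : Fin n → Kˣ) :
    IsAdapted M.agg N (e.unitsSMul c) := by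
  intro a
  have := he fun i => a i * (c i : K)
  simp only [Module.Basis.unitsSMul_apply, Units.smul_def, smul_smul] at this ⊢
  rw [this]
  congr 1
  ext1 i
  rw [hM.good_smul N hN, norm_mul]
  ring

lemma exists_common_det_one (hM : M.IsRegular) {N N' : (Fin n → K) → ℝ} (hN : M.IsGood N)
    (hN' : M.IsGood N') :
    ∃ e, basisDet e = 1 ∧ IsAdapted M.agg N e ∧ IsAdapted M.agg N' e := by
  obtain ⟨e, he, he'⟩ := hM.common_basis N N' hN hN'
  obtain ⟨c, hc, -⟩ := exists_units_det_one e
  exact ⟨_, hc, isAdapted_unitsSMul hM hN he c, isAdapted_unitsSMul hM hN' he' c⟩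

/-- The volume can be checked on a single adapted basis. -/
lemma hasVolumeOne_of_adapted (hM : M.IsRegular) {N : (Fin n → K) → ℝ} (hN : M.IsGood N)
    {e : Module.Basis (Fin n) K (Fin n → K)} (he : IsAdapted M.agg N e)
    (h : ∏ i, N (e i) = ‖basisDet e‖) : HasVolumeOne M N := by
  intro e' hdet he'
  have := hM.volume N hN e e' he he'
  rw [hdet, norm_one, one_mul, h] at this
  have h0 := norm_ne_zero_iff.2 (basisDet_ne_zero e)
  exact (mul_right_injective₀ h0 (by simpa using this)).symm

lemma Es.prod_eq (hM : M.IsRegular) (x : Es M) {e : Module.Basis (Fin n) K (Fin n → K)}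
    (he : IsAdapted M.agg x e) : ∏ i, x.1 (e i) = ‖basisDet e‖ := by
  obtain ⟨c, hc, -⟩ := exists_units_det_one e
  have he' := isAdapted_unitsSMul hM x.2.1 he c
  have h1 := x.2.2 _ hc he'
  have h2 := hM.volume x x.2.1 _ _ he he'
  rw [h1, hc] at h2
  simpa using h2

/-- Two norms adapted to the same basis are compared by their values on this basis. -/
lemma le_mul_of_adapted (hM : M.IsRegular) {N N' : (Fin n → K) → ℝ} (hN' : M.IsGood N')
    {e : Module.Basis (Fin n) K (Fin n → K)}
    (he : IsAdapted M.agg N e) (he' : IsAdapted M.agg N' e) {t : ℝ} (ht : 0 ≤ t)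
    (h : ∀ i, N' (e i) ≤ t * N (e i)) (v : Fin n → K) : N' v ≤ t * N v := by
  rw [isAdapted_iff_repr] at he he'
  rw [he v, he' v, ← hM.smul t _ ht]
  refine hM.mono _ _ (fun i => mul_nonneg (isGood_nonneg hM hN' _) (norm_nonneg _)) fun i => ?_
  rw [← mul_assoc]
  exact mul_le_mul_of_nonneg_right (h i) (norm_nonneg _)

lemma Es.ext_of_adapted {x y : Es M}
    {e : Module.Basis (Fin n) K (Fin n → K)} (hx : IsAdapted M.agg x e)
    (hy : IsAdapted M.agg y e) (h : ∀ i, x.1 (e i) = y.1 (e i)) : x = y := by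
  rw [isAdapted_iff_repr] at hx hy
  apply Subtype.ext
  funext v
  rw [hx v, hy v]
  simp only [h]

lemma exists_flatPoint (hM : M.IsRegular) (e : Module.Basis (Fin n) K (Fin n → K))
    (he : basisDet e = 1) (α : Flat n) :
    ∃ x : Es M, IsAdapted M.agg x e ∧ ∀ i, x.1 (e i) = Real.exp (-α.1 i) := by
  obtain ⟨N, hN, had, hval⟩ := exists_good_of_basis hM e (fun i => Real.exp (-α.1 i))
    fun i => Real.exp_pos _
  refine ⟨⟨N, hN, hasVolumeOne_of_adapted hM hN had ?_⟩, had, hval⟩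
  simp only [hval]
  rw [← Real.exp_sum, Finset.sum_neg_distrib, show ∑ i, α.1 i = 0 from α.2, he]
  simp

/-- The marked flat `f_e` of a basis `e` of determinant one. -/
def flatMap (hM : M.IsRegular) (e : Module.Basis (Fin n) K (Fin n → K))
    (he : basisDet e = 1) (α : Flat n) : Es M := (exists_flatPoint hM e he α).choose

lemma flatMap_adapted (hM : M.IsRegular) (e : Module.Basis (Fin n) K (Fin n → K))
    (he : basisDet e = 1) (α : Flat n) : IsAdapted M.agg (flatMap hM e he α) e :=
  (exists_flatPoint hM e he α).choose_spec.1

lemma flatMap_apply (hM : M.IsRegular) (e : Module.Basis (Fin n) K (Fin n → K))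
    (he : basisDet e = 1) (α : Flat n) (i : Fin n) :
    (flatMap hM e he α).1 (e i) = Real.exp (-α.1 i) :=
  (exists_flatPoint hM e he α).choose_spec.2 i

lemma flatMap_mem (hM : M.IsRegular) (e : Module.Basis (Fin n) K (Fin n → K))
    (he : basisDet e = 1) : flatMap hM e he ∈ markedFlats M :=
  ⟨e, he, fun α => ⟨flatMap_adapted hM e he α, flatMap_apply hM e he α⟩⟩

/-- The logarithmic coordinates of a norm of volume one in an adapted basis of determinant one. -/
lemma exists_flat_coord (hM : M.IsRegular) (x : Es M) {e : Module.Basis (Fin n) K (Fin n → K)}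
    (hdet : ‖basisDet e‖ = 1) (he : IsAdapted M.agg x e) :
    ∃ α : Flat n, ∀ i, x.1 (e i) = Real.exp (-α.1 i) := by
  have hpos := isGood_basis_pos hM x.2.1 e
  refine ⟨⟨WithLp.toLp 2 fun i => -Real.log (x.1 (e i)), ?_⟩, fun i => ?_⟩
  · change ∑ i, -Real.log (x.1 (e i)) = 0
    rw [Finset.sum_neg_distrib, ← Real.log_prod fun i _ => (hpos i).ne', x.prod_eq hM he, hdet]
    simp
  · simp [Real.exp_log (hpos i)]

/-- The marked flat of `e` consists of the norms adapted to `e`. -/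
lemma mem_range_iff (hM : M.IsRegular) {f : Flat n → Es M}
    {e : Module.Basis (Fin n) K (Fin n → K)} (he : basisDet e = 1)
    (hf : ∀ α, IsAdapted M.agg (f α) e ∧ ∀ i, f α (e i) = Real.exp (-α.1 i)) (x : Es M) :
    x ∈ Set.range f ↔ IsAdapted M.agg x e := by
  constructor
  · rintro ⟨α, rfl⟩
    exact (hf α).1
  · intro h
    obtain ⟨α, hα⟩ := exists_flat_coord hM x (by rw [he, norm_one]) h
    exact ⟨α, Es.ext_of_adapted (hf α).1 h fun i => by rw [(hf α).2, hα]⟩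

lemma markedFlat_injective {f : Flat n → Es M} (hf : f ∈ markedFlats M) :
    Function.Injective f := by
  obtain ⟨e, -, hf⟩ := hf
  intro α β h
  apply Subtype.ext
  ext i
  have h1 := (hf α).2 i
  rw [h, (hf β).2 i] at h1
  simpa using (Real.exp_injective h1).symm

/-- The distance is computed by any common adapted basis: the infimum defining it is taken over a
set with a single element. -/
lemma dist_eq (hM : M.IsRegular) {N N' : (Fin n → K) → ℝ} (hN : M.IsGood N) (hN' : M.IsGood N')
    {e : Module.Basis (Fin n) K (Fin n → K)} (he : IsAdapted M.agg N e)
    (he' : IsAdapted M.agg N' e) :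
    dist M N N' = √(∑ i, |Real.log (N' (e i) / N (e i))| ^ 2) := by
  have : {r | ∃ e : Module.Basis (Fin n) K (Fin n → K), IsAdapted M.agg N e ∧
      IsAdapted M.agg N' e ∧ r = √(∑ i, |Real.log (N' (e i) / N (e i))| ^ 2)}
      = {√(∑ i, |Real.log (N' (e i) / N (e i))| ^ 2)} := by
    ext r
    constructor
    · rintro ⟨e1, h1, h1', rfl⟩
      obtain ⟨σ, hσ⟩ := hM.ratio_perm N N' hN hN' e e1 he h1 he' h1'
      simp only [hσ, Set.mem_singleton_iff]
      congr 1
      exact Equiv.sum_comp σ fun i => |Real.log (N' (e i) / N (e i))| ^ 2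
    · rintro rfl
      exact ⟨e, he, he', rfl⟩
  rw [dist, this, csInf_singleton]

lemma dist_self (hM : M.IsRegular) {N : (Fin n → K) → ℝ} (hN : M.IsGood N) : dist M N N = 0 := by
  obtain ⟨e, he, -⟩ := hM.common_basis N N hN hN
  rw [dist_eq hM hN hN he he]
  simp [div_self (isGood_basis_pos hM hN e _).ne']

/-- Norms at distance `d` are comparable up to the factor `exp d`. -/
lemma le_exp_dist_mul (hM : M.IsRegular) {N N' : (Fin n → K) → ℝ} (hN : M.IsGood N)
    (hN' : M.IsGood N') (v : Fin n → K) :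
    N' v ≤ Real.exp (dist M N N') * N v ∧ N v ≤ Real.exp (dist M N N') * N' v := by
  obtain ⟨e, he, he'⟩ := hM.common_basis N N' hN hN'
  have hle : ∀ i, |Real.log (N' (e i) / N (e i))| ≤ dist M N N' := by
    intro i
    rw [dist_eq hM hN hN' he he']
    refine Real.le_sqrt_of_sq_le ?_
    exact Finset.single_le_sum (f := fun i => |Real.log (N' (e i) / N (e i))| ^ 2)
      (fun j _ => sq_nonneg _) (Finset.mem_univ i)
  have hp := isGood_basis_pos hM hN e
  have hp' := isGood_basis_pos hM hN' e
  constructor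
  · refine le_mul_of_adapted hM hN' he he' (Real.exp_pos _).le (fun i => ?_) v
    rw [← div_le_iff₀ (hp i), ← Real.log_le_iff_le_exp (div_pos (hp' i) (hp i))]
    exact (le_abs_self _).trans (hle i)
  · refine le_mul_of_adapted hM hN he' he (Real.exp_pos _).le (fun i => ?_) v
    rw [← div_le_iff₀ (hp' i), ← Real.log_le_iff_le_exp (div_pos (hp i) (hp' i)),
      ← inv_div, Real.log_inv]
    exact (neg_le_abs _).trans (hle i)

/-- Conversely, norms comparable up to a factor `exp r` are at distance at most `n * r`. -/
lemma dist_le_of_le_exp (hM : M.IsRegular) {N N' : (Fin n → K) → ℝ} (hN : M.IsGood N)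
    (hN' : M.IsGood N') {r : ℝ} (h : ∀ v, N' v ≤ Real.exp r * N v)
    (h' : ∀ v, N v ≤ Real.exp r * N' v) : dist M N N' ≤ n * r := by
  obtain ⟨e, he, he'⟩ := hM.common_basis N N' hN hN'
  have hp := isGood_basis_pos hM hN e
  have hp' := isGood_basis_pos hM hN' e
  have hle : ∀ i, |Real.log (N' (e i) / N (e i))| ≤ r := by
    intro i
    rw [abs_le']
    constructor
    · rw [Real.log_le_iff_le_exp (div_pos (hp' i) (hp i)), div_le_iff₀ (hp i)]
      exact h _
    · rw [← Real.log_inv, inv_div, Real.log_le_iff_le_exp (div_pos (hp i) (hp' i)),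
        div_le_iff₀ (hp' i)]
      exact h' _
  rw [dist_eq hM hN hN' he he']
  refine ((archModel ℝ n).agg_le (fun i => |Real.log (N' (e i) / N (e i))|)
    fun i => abs_nonneg _).trans ?_
  refine (Finset.sum_le_sum fun i _ => hle i).trans ?_
  simp

lemma isGood_canonicalNorm (hM : M.IsRegular) : M.IsGood (canonicalNorm M) := by
  have := hM.good_of_basis (Pi.basisFun K (Fin n)) 1 fun _ => one_pos
  change M.IsGood fun v => M.agg fun i => ‖v i‖
  simpa using this

lemma canonicalNorm_le_sum (M : NormModel K n) (v : Fin n → K) :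
    canonicalNorm M v ≤ ∑ i, ‖v i‖ := M.agg_le _ fun _ => norm_nonneg _

lemma norm_le_canonicalNorm (M : NormModel K n) (v : Fin n → K) (i : Fin n) :
    ‖v i‖ ≤ canonicalNorm M v := M.le_agg (fun i => ‖v i‖) (fun _ => norm_nonneg _) i

end Regular

/-! ### Ultrametric norms: common adapted bases and volume -/

section UltraAbstract

variable {K : Type*} [NormedField K]

/-- Ultrametric norms on an arbitrary vector space. -/
structure IsUltraNorm {V : Type*} [AddCommGroup V] [Module K V] (N : V → ℝ) : Prop where
  smul : ∀ (a : K) v, N (a • v) = ‖a‖ * N v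
  add_le_max : ∀ v w, N (v + w) ≤ max (N v) (N w)
  pos : ∀ v, v ≠ 0 → 0 < N v

/-- The basis `b` splits the ultrametric norm `N`: `N v` dominates every component of `v`. By the
ultrametric inequality this amounts to `N v` being the maximum of the norms of the components. -/
def IsSplitBy {V : Type*} [AddCommGroup V] [Module K V] {ι : Type*} (N : V → ℝ)
    (b : Module.Basis ι K V) : Prop :=
  ∀ v i, N (b i) * ‖b.repr v i‖ ≤ N v

variable {V : Type*} [AddCommGroup V] [Module K V] {N N' : V → ℝ}

namespace IsUltraNorm

lemma zero (h : IsUltraNorm (K := K) N) : N 0 = 0 := by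
  simpa using h.smul 0 0

lemma nonneg (h : IsUltraNorm (K := K) N) (v : V) : 0 ≤ N v := by
  by_cases hv : v = 0
  · rw [hv, h.zero]
  · exact (h.pos v hv).le

lemma sum_le (h : IsUltraNorm (K := K) N) {ι : Type*} (s : Finset ι) (f : ι → V) {r : ℝ}
    (hr : 0 ≤ r) (hf : ∀ i ∈ s, N (f i) ≤ r) : N (∑ i ∈ s, f i) ≤ r := by
  classical
  induction s using Finset.induction_on with
  | empty => simpa [h.zero] using hr
  | insert a s ha ih =>
    rw [Finset.sum_insert ha]
    exact (h.add_le_max _ _).trans (max_le (hf a (by simp)) (ih fun i hi => hf i (by simp [hi])))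

lemma le_of_repr (h : IsUltraNorm (K := K) N) {ι : Type*} [Fintype ι] (b : Module.Basis ι K V)
    (v : V) {r : ℝ} (hr : 0 ≤ r) (hb : ∀ i, N (b i) * ‖b.repr v i‖ ≤ r) : N v ≤ r := by
  rw [← b.sum_repr v]
  refine h.sum_le _ _ hr fun i _ => ?_
  rw [h.smul, mul_comm]
  exact hb i

lemma comp_subtype (h : IsUltraNorm (K := K) N) (W : Submodule K V) :
    IsUltraNorm (K := K) fun w : W => N w where
  smul a v := h.smul a v
  add_le_max v w := h.add_le_max v w
  pos v hv := h.pos v fun h0 => hv (Subtype.ext h0)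

end IsUltraNorm

/-- Let `l` be a linear form whose kernel is a complement of `b i` at least as orthogonal as the
other vectors of a splitting basis `b`. Projecting these vectors to the kernel of `l` along `b i`
gives a splitting basis of the kernel. -/
lemma IsSplitBy.exists_basis_ker (hN : IsUltraNorm (K := K) N) {m : ℕ}
    {b : Module.Basis (Fin (m + 1)) K V}
    (hb : IsSplitBy N b) (l : V →ₗ[K] K) (i : Fin (m + 1)) (hi : l (b i) ≠ 0)
    (h : ∀ k, N (b i) * ‖l (b k)‖ ≤ N (b k) * ‖l (b i)‖) :
    ∃ b' : Module.Basis (Fin m) K (LinearMap.ker l),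
      IsSplitBy (fun w : LinearMap.ker l => N w) b' := by
  let F : LinearMap.ker l →ₗ[K] (Fin m → K) :=
    { toFun := fun w k => b.repr w (i.succAbove k)
      map_add' := fun v w => by ext; simp
      map_smul' := fun a v => by ext; simp }
  let G : (Fin m → K) → V := fun x =>
    ∑ k, x k • (b (i.succAbove k) - (l (b (i.succAbove k)) / l (b i)) • b i)
  have hG : ∀ x, G x ∈ LinearMap.ker l := by
    intro x
    refine Submodule.sum_mem _ fun k _ => Submodule.smul_mem _ _ ?_
    simp [hi]
  have hrepr : ∀ x k, b.repr (G x) (i.succAbove k) = x k := by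
    intro x k
    simp [G, Finsupp.single_apply, Fin.succAbove_ne]
  have hinj : Function.Injective F := by
    rw [injective_iff_map_eq_zero]
    intro w hw
    have hw' : ∀ k, b.repr w (i.succAbove k) = 0 := fun k => congrFun hw k
    have h1 : (w : V) = b.repr w i • b i := by
      conv_lhs => rw [← b.sum_repr w, Fin.sum_univ_succAbove _ i]
      simp [hw']
    have h2 : l w = 0 := w.2
    rw [h1, map_smul, smul_eq_mul, mul_eq_zero, or_iff_left hi] at h2
    apply Subtype.ext
    rw [h1, h2, zero_smul]
    rfl
  let e : LinearMap.ker l ≃ₗ[K] (Fin m → K) :=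
    LinearEquiv.ofBijective F ⟨hinj, fun x => ⟨⟨G x, hG x⟩, funext (hrepr x)⟩⟩
  refine ⟨Module.Basis.ofEquivFun e, fun w k => ?_⟩
  have hek : ((Module.Basis.ofEquivFun e k : LinearMap.ker l) : V) = G (Pi.single k 1) := by
    have : e ⟨G (Pi.single k 1), hG _⟩ = Pi.single k 1 := funext (hrepr _)
    rw [Module.Basis.coe_ofEquivFun]
    change ((e.symm (Pi.single k 1) : LinearMap.ker l) : V) = _
    rw [LinearEquiv.symm_apply_eq e |>.2 this.symm]
  have hle : N (G (Pi.single k 1)) ≤ N (b (i.succAbove k)) := by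
    have : G (Pi.single k 1) = b (i.succAbove k) + (-(l (b (i.succAbove k)) / l (b i))) • b i := by
      simp only [G]
      rw [Finset.sum_eq_single k (fun j _ hj => by simp [hj]) (by simp), Pi.single_eq_same,
        one_smul, neg_smul, sub_eq_add_neg]
    rw [this]
    refine (hN.add_le_max _ _).trans (max_le le_rfl ?_)
    rw [hN.smul, norm_neg, norm_div, div_mul_eq_mul_div,
      div_le_iff₀ (norm_pos_iff.2 hi), mul_comm]
    exact h _
  refine le_trans ?_ (hb w (i.succAbove k))
  rw [Module.Basis.ofEquivFun_repr_apply]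
  change N _ * ‖b.repr w (i.succAbove k)‖ ≤ _
  rw [hek]
  exact mul_le_mul_of_nonneg_right hle (norm_nonneg _)

/-- A splitting basis of a hyperplane orthogonal to `v` together with `v` is a splitting basis. -/
lemma isSplitBy_mkFinCons (hN : IsUltraNorm (K := K) N) {m : ℕ} (l : V →ₗ[K] K) (v : V)
    (hv : l v = 1) (hl : ∀ x, ‖l x‖ * N v ≤ N x) {c : Module.Basis (Fin m) K (LinearMap.ker l)}
    (hc : IsSplitBy (fun w : LinearMap.ker l => N w) c) {e : Module.Basis (Fin (m + 1)) K V}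
    (he : (e : Fin (m + 1) → V) = Fin.cons v ((↑) ∘ c)) : IsSplitBy N e := by
  intro x
  have he0 : e 0 = v := by rw [he]; rfl
  have hes : ∀ k : Fin m, e k.succ = c k := fun k => by rw [he]; rfl
  have hx := e.sum_repr x
  rw [Fin.sum_univ_succ, he0] at hx
  simp only [hes] at hx
  set w : LinearMap.ker l := ∑ k : Fin m, e.repr x k.succ • c k with hw
  have hwx : e.repr x 0 • v + (w : V) = x := by
    have hwV : (w : V) = ∑ k : Fin m, e.repr x k.succ • (c k : V) := by
      simp only [hw, Submodule.coe_sum, Submodule.coe_smul]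
    rw [hwV, hx]
  have hlx : l x = e.repr x 0 := by
    conv_lhs => rw [← hwx, map_add, map_smul, hv, show l w = 0 from w.2]
    rw [smul_eq_mul, mul_one, add_zero]
  have h0 : N v * ‖e.repr x 0‖ ≤ N x := by
    rw [← hlx, mul_comm]
    exact hl x
  have hwN : N w ≤ N x := by
    have : (w : V) = x + (-(e.repr x 0)) • v := by
      rw [neg_smul, ← sub_eq_add_neg, eq_sub_iff_add_eq, add_comm, hwx]
    rw [this]
    refine (hN.add_le_max _ _).trans (max_le le_rfl ?_)
    rw [hN.smul, norm_neg, mul_comm]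
    exact h0
  intro i
  induction i using Fin.cases with
  | zero => rw [he0]; exact h0
  | succ k =>
    refine le_trans ?_ hwN
    have := hc w k
    rw [hw, Module.Basis.repr_sum_self, ← hw] at this
    rw [hes]
    exact this

/-- Two ultrametric norms admitting splitting bases have a common one. The first vector `v` of the
common basis maximises the ratio `N' / N`; a linear form computing the `v`-component in a splitting
basis of `N'` has a kernel which is orthogonal to `v` for both norms. -/
lemma exists_common_isSplitBy (m : ℕ) : ∀ {V : Type*} [AddCommGroup V] [Module K V] {N N' : V → ℝ},
    IsUltraNorm (K := K) N → IsUltraNorm (K := K) N' →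
    ∀ b b' : Module.Basis (Fin m) K V, IsSplitBy N b → IsSplitBy N' b' →
    ∃ e : Module.Basis (Fin m) K V, IsSplitBy N e ∧ IsSplitBy N' e := by
  induction m with
  | zero =>
    intro V _ _ N N' hN hN' b b' hb hb'
    exact ⟨b, hb, fun v i => i.elim0⟩
  | succ m ih =>
    intro V _ _ N N' hN hN' b b' hb hb'
    obtain ⟨i, -, hi⟩ := Finset.exists_max_image Finset.univ (fun i => N' (b i) / N (b i))
      ⟨0, Finset.mem_univ _⟩
    set v := b i with hvdef
    have hv0 : v ≠ 0 := b.ne_zero i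
    have hNv := hN.pos v hv0
    have hNv' := hN'.pos v hv0
    -- the maximum of `N' / N` over a splitting basis of `N` is its maximum over all vectors
    have hratio : ∀ x, N' x * N v ≤ N x * N' v := by
      intro x
      rw [← le_div_iff₀ hNv]
      refine hN'.le_of_repr b x (div_nonneg (mul_nonneg (hN.nonneg _) hNv'.le) hNv.le) fun k => ?_
      have h1 := hi k (Finset.mem_univ _)
      have hk := hN.pos _ (b.ne_zero k)
      rw [div_le_iff₀ hk] at h1
      calc N' (b k) * ‖b.repr x k‖ ≤ N' v / N v * N (b k) * ‖b.repr x k‖ := by gcongr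
        _ = N' v / N v * (N (b k) * ‖b.repr x k‖) := by ring
        _ ≤ N' v / N v * N x := by
          have := hb x k
          gcongr
        _ = N x * N' v / N v := by ring
    obtain ⟨j, -, hj⟩ := Finset.exists_max_image Finset.univ (fun j => N' (b' j) * ‖b'.repr v j‖)
      ⟨0, Finset.mem_univ _⟩
    have hj' : N' v ≤ N' (b' j) * ‖b'.repr v j‖ :=
      hN'.le_of_repr b' v (mul_nonneg (hN'.nonneg _) (norm_nonneg _))
        fun k => hj k (Finset.mem_univ _)
    have hvj : b'.repr v j ≠ 0 := by
      intro h
      rw [h, norm_zero, mul_zero] at hj'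
      linarith
    let l : V →ₗ[K] K := (b'.repr v j)⁻¹ • b'.coord j
    have hlx : ∀ x, l x = (b'.repr v j)⁻¹ * b'.repr x j := fun x => rfl
    have hlv : l v = 1 := by rw [hlx, inv_mul_cancel₀ hvj]
    have hl' : ∀ x, ‖l x‖ * N' v ≤ N' x := by
      intro x
      rw [hlx, norm_mul, norm_inv]
      calc _ ≤ ‖b'.repr v j‖⁻¹ * ‖b'.repr x j‖ * (N' (b' j) * ‖b'.repr v j‖) := by gcongr
        _ = N' (b' j) * ‖b'.repr x j‖ := by
          have := norm_ne_zero_iff.2 hvj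
          field_simp
        _ ≤ N' x := hb' x j
    -- orthogonality for `N'` implies orthogonality for `N` because `v` maximises `N' / N`
    have hl : ∀ x, ‖l x‖ * N v ≤ N x := by
      intro x
      have h1 := hl' x
      have h2 := hratio x
      have h3 : ‖l x‖ * N v * N' v ≤ N x * N' v := by nlinarith
      exact le_of_mul_le_mul_right h3 hNv'
    have hlb' : ∀ k, k ≠ j → l (b' k) = 0 := by
      intro k hk
      rw [hlx, b'.repr_self, Finsupp.single_eq_of_ne hk.symm, mul_zero]
    obtain ⟨c, hc⟩ := hb.exists_basis_ker hN l i (by rw [← hvdef, hlv]; exact one_ne_zero)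
      fun k => by
        rw [← hvdef, hlv, norm_one, mul_one, mul_comm]
        exact hl _
    obtain ⟨c', hc'⟩ := hb'.exists_basis_ker hN' l j
      (by rw [hlx]; simpa using hvj)
      fun k => by
        by_cases hk : k = j
        · rw [hk]
        · rw [hlb' k hk, norm_zero, mul_zero]
          exact mul_nonneg (hN'.nonneg _) (norm_nonneg _)
    obtain ⟨d, hd, hd'⟩ := ih (hN.comp_subtype _) (hN'.comp_subtype _) c c' hc hc'
    have hli : ∀ (a : K), ∀ x ∈ LinearMap.ker l, a • v + x = 0 → a = 0 := by
      intro a x hx h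
      have := congrArg l h
      rw [map_add, map_smul, hlv, LinearMap.mem_ker.1 hx, map_zero] at this
      simpa using this
    have hsp : ∀ z : V, ∃ a : K, z + a • v ∈ LinearMap.ker l := fun z => ⟨-(l z), by simp [hlv]⟩
    have he := Module.Basis.coe_mkFinCons v d hli hsp
    exact ⟨_, isSplitBy_mkFinCons hN l v hlv hl hd he, isSplitBy_mkFinCons hN' l v hlv hl' hd' he⟩

end UltraAbstract

/-! ### The space of good ultrametric norms -/

section UltraModel

variable {K : Type*} [NormedField K] {n : ℕ}

lemma isAdapted_iff_isSplitBy {N : (Fin n → K) → ℝ} (hN : IsUltraNorm (K := K) N)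
    {e : Module.Basis (Fin n) K (Fin n → K)} :
    IsAdapted (fun c => ⨆ i, c i) N e ↔ IsSplitBy N e := by
  rw [isAdapted_iff_repr]
  constructor
  · intro h v i
    rw [h v]
    exact le_ciSup (f := fun i => N (e i) * ‖e.repr v i‖) (Set.finite_range _).bddAbove i
  · intro h v
    have h0 : ∀ i, 0 ≤ N (e i) * ‖e.repr v i‖ := fun i => mul_nonneg (hN.nonneg _) (norm_nonneg _)
    refine le_antisymm (hN.le_of_repr e v (Real.iSup_nonneg h0) fun i => ?_)
      (Real.iSup_le (h v) (hN.nonneg v))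
    exact le_ciSup (f := fun i => N (e i) * ‖e.repr v i‖) (Set.finite_range _).bddAbove i

lemma basisDet_mul_det_toMatrix (e e' : Module.Basis (Fin n) K (Fin n → K)) :
    basisDet e * (e.toMatrix e').det = basisDet e' := by
  rw [basisDet, basisDet, Module.Basis.det_apply, Module.Basis.det_apply, ← Matrix.det_mul,
    Module.Basis.toMatrix_mul_toMatrix]

/-- The determinant of a basis which is triangular with respect to another one. -/
lemma norm_basisDet_of_triangular (e b : Module.Basis (Fin n) K (Fin n → K))
    (τ : Equiv.Perm (Fin n)) (h : ∀ j i, τ j < i → e.repr (b j) i = 0) :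
    ‖basisDet b‖ = ‖basisDet e‖ * ∏ j, ‖e.repr (b j) (τ j)‖ := by
  have htri : (e.toMatrix (b.reindex τ)).BlockTriangular id := by
    intro i j hij
    rw [Module.Basis.toMatrix_apply, Module.Basis.reindex_apply]
    refine h _ _ ?_
    simpa using hij
  rw [← norm_basisDet_reindex b τ, ← basisDet_mul_det_toMatrix e (b.reindex τ),
    Matrix.det_of_isUpperTriangular htri, norm_mul, norm_prod,
    ← Equiv.prod_comp τ fun i => ‖e.toMatrix (b.reindex τ) i i‖]
  simp [Module.Basis.toMatrix_apply]

variable [IsUltrametricDist K]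

/-- Some term in the Leibniz expansion of the determinant of a transition matrix dominates it. -/
lemma exists_perm_basisDet_le (e e' : Module.Basis (Fin n) K (Fin n → K)) :
    ∃ σ : Equiv.Perm (Fin n),
      ‖basisDet e'‖ ≤ ‖basisDet e‖ * ∏ j, ‖e.repr (e' j) (σ j)‖ := by
  have hdet := basisDet_mul_det_toMatrix e e'
  rw [Matrix.det_apply'] at hdet
  obtain ⟨σ, hσ⟩ := IsUltrametricDist.exists_norm_finsetSum_le
    (Finset.univ : Finset (Equiv.Perm (Fin n)))
    (fun σ => ((Equiv.Perm.sign σ : ℤ) : K) * ∏ i, e.toMatrix e' (σ i) i)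
  refine ⟨σ, ?_⟩
  rw [← hdet, norm_mul]
  refine mul_le_mul_of_nonneg_left (hσ.2.trans ?_) (norm_nonneg _)
  rw [norm_mul, norm_sign, one_mul, norm_prod]
  rfl

/-- The ultrametric Hadamard inequality. -/
lemma IsSplitBy.basisDet_mul_le {N : (Fin n → K) → ℝ} (hN : IsUltraNorm (K := K) N)
    {e : Module.Basis (Fin n) K (Fin n → K)} (he : IsSplitBy N e)
    (e' : Module.Basis (Fin n) K (Fin n → K)) :
    ‖basisDet e'‖ * ∏ i, N (e i) ≤ ‖basisDet e‖ * ∏ i, N (e' i) := by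
  obtain ⟨σ, hσ⟩ := exists_perm_basisDet_le e e'
  have h0 : 0 ≤ ∏ i, N (e i) := Finset.prod_nonneg fun i _ => hN.nonneg _
  refine (mul_le_mul_of_nonneg_right hσ h0).trans ?_
  rw [mul_assoc]
  refine mul_le_mul_of_nonneg_left ?_ (norm_nonneg _)
  rw [← Equiv.prod_comp σ fun i => N (e i), ← Finset.prod_mul_distrib]
  refine Finset.prod_le_prod (fun i _ => mul_nonneg (norm_nonneg _) (hN.nonneg _)) fun j _ => ?_
  rw [mul_comm]
  exact he _ _

lemma IsSplitBy.basisDet_mul_eq {N : (Fin n → K) → ℝ} (hN : IsUltraNorm (K := K) N)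
    {e e' : Module.Basis (Fin n) K (Fin n → K)} (he : IsSplitBy N e) (he' : IsSplitBy N e') :
    ‖basisDet e'‖ * ∏ i, N (e i) = ‖basisDet e‖ * ∏ i, N (e' i) :=
  le_antisymm (he.basisDet_mul_le hN e') (he'.basisDet_mul_le hN e)

/-- A dominating term in the determinant of the transition matrix determines the values on `e'` of
every norm split by `e` and `e'` from its values on `e`. -/
lemma IsSplitBy.eq_of_perm {N : (Fin n → K) → ℝ} (hN : IsUltraNorm (K := K) N)
    {e e' : Module.Basis (Fin n) K (Fin n → K)} (he : IsSplitBy N e) (he' : IsSplitBy N e')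
    {σ : Equiv.Perm (Fin n)}
    (hσ : ‖basisDet e'‖ ≤ ‖basisDet e‖ * ∏ j, ‖e.repr (e' j) (σ j)‖) (j : Fin n) :
    e.repr (e' j) (σ j) ≠ 0 ∧ N (e' j) = N (e (σ j)) * ‖e.repr (e' j) (σ j)‖ := by
  have hprod : 0 < ∏ j, ‖e.repr (e' j) (σ j)‖ :=
    pos_of_mul_pos_right ((norm_pos_iff.2 (basisDet_ne_zero e')).trans_le hσ) (norm_nonneg _)
  have hne : ∀ j, e.repr (e' j) (σ j) ≠ 0 := by
    intro j h0
    exact hprod.ne' (Finset.prod_eq_zero (Finset.mem_univ j) (by rw [h0, norm_zero]))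
  refine ⟨hne j, ?_⟩
  -- a strict inequality for one index would contradict the invariance of the volume
  by_contra hlt
  have hpos : ∀ i, 0 < N (e i) := fun i => hN.pos _ (e.ne_zero i)
  have h1 : ∏ j, N (e (σ j)) * ‖e.repr (e' j) (σ j)‖ < ∏ j, N (e' j) := by
    refine Finset.prod_lt_prod (fun i _ => mul_pos (hpos _) (norm_pos_iff.2 (hne i)))
      (fun i _ => he _ _) ⟨j, Finset.mem_univ j, lt_of_le_of_ne (he _ _) (Ne.symm hlt)⟩
  rw [Finset.prod_mul_distrib, Equiv.prod_comp σ fun i => N (e i)] at h1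
  have h2 := he.basisDet_mul_eq hN he'
  have h3 := mul_le_mul_of_nonneg_right hσ (Finset.prod_nonneg fun i _ => (hpos i).le :
    0 ≤ ∏ i, N (e i))
  rw [h2, mul_assoc, mul_comm (∏ j, ‖e.repr (e' j) (σ j)‖)] at h3
  exact h3.not_gt (mul_lt_mul_of_pos_left h1 (norm_pos_iff.2 (basisDet_ne_zero e)))

lemma isUltraNorm_of_isGood {N : (Fin n → K) → ℝ} (h : (ultraModel K n).IsGood N) :
    IsUltraNorm (K := K) N := by
  have h' : IsUltrametricNorm N := h.1
  have h0 : N 0 = 0 := by simpa using h'.smul 0 0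
  refine ⟨h'.smul, h'.add_le_max, fun v hv => ?_⟩
  have hneg : N (-v) = N v := by simpa using h'.smul (-1) v
  have h1 : 0 ≤ N v := by simpa [h0, hneg] using h'.add_le_max v (-v)
  exact lt_of_le_of_ne h1 fun h2 => hv (h'.eq_zero v h2.symm)

lemma ultraModel_isAdapted_iff {N : (Fin n → K) → ℝ} (h : (ultraModel K n).IsGood N)
    {e : Module.Basis (Fin n) K (Fin n → K)} :
    IsAdapted (ultraModel K n).agg N e ↔ IsSplitBy N e :=
  isAdapted_iff_isSplitBy (isUltraNorm_of_isGood h)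

lemma isUltraNorm_iSup (e : Module.Basis (Fin n) K (Fin n → K)) (c : Fin n → ℝ)
    (hc : ∀ i, 0 < c i) : IsUltraNorm (K := K) fun v => ⨆ i, c i * ‖e.repr v i‖ := by
  have h0 : ∀ v i, 0 ≤ c i * ‖e.repr v i‖ := fun v i => mul_nonneg (hc i).le (norm_nonneg _)
  have hle : ∀ v i, c i * ‖e.repr v i‖ ≤ ⨆ i, c i * ‖e.repr v i‖ := fun v i =>
    le_ciSup (f := fun i => c i * ‖e.repr v i‖) (Set.finite_range _).bddAbove i
  refine ⟨fun a v => ?_, fun v w => ?_, fun v hv => ?_⟩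
  · rw [Real.mul_iSup_of_nonneg (norm_nonneg a)]
    congr 1
    ext1 i
    simp only [map_smul, Finsupp.smul_apply, smul_eq_mul, norm_mul]
    ring
  · refine Real.iSup_le (fun i => ?_) (le_max_of_le_left (Real.iSup_nonneg (h0 v)))
    rw [map_add, Finsupp.add_apply]
    rcases le_max_iff.1 (IsUltrametricDist.norm_add_le_max (e.repr v i) (e.repr w i)) with h | h
    · exact le_max_of_le_left ((mul_le_mul_of_nonneg_left h (hc i).le).trans (hle v i))
    · exact le_max_of_le_right ((mul_le_mul_of_nonneg_left h (hc i).le).trans (hle w i))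
  · have : ∃ i, e.repr v i ≠ 0 := by
      by_contra! h
      exact hv (e.repr.map_eq_zero_iff.1 (Finsupp.ext h))
    obtain ⟨i, hi⟩ := this
    exact (mul_pos (hc i) (norm_pos_iff.2 hi)).trans_le (hle v i)

lemma ultraModel_isRegular (K : Type*) [NormedField K] [IsUltrametricDist K] (n : ℕ) :
    (ultraModel K n).IsRegular where
  mono c d hc hcd := Real.iSup_le
    (fun i => (hcd i).trans (le_ciSup (f := d) (Set.finite_range _).bddAbove i))
    (Real.iSup_nonneg fun i => (hc i).trans (hcd i))
  smul t c ht := (Real.mul_iSup_of_nonneg ht c).symm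
  good_smul N hN := (isUltraNorm_of_isGood hN).smul
  good_pos N hN := (isUltraNorm_of_isGood hN).pos
  good_of_basis e c hc := by
    have h := isUltraNorm_iSup e c hc
    refine ⟨⟨h.smul, h.add_le_max, fun v hv => ?_⟩, e, (isAdapted_iff_isSplitBy h).2 fun v i => ?_⟩
    · by_contra h0
      exact (h.pos v h0).ne' hv
    · have hval : (⨆ j, c j * ‖e.repr (e i) j‖) ≤ c i := by
        refine Real.iSup_le (fun j => ?_) (hc i).le
        by_cases hij : j = i
        · subst hij; simp
        · simp [Ne.symm hij, (hc i).le]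
      refine (mul_le_mul_of_nonneg_right hval (norm_nonneg _)).trans ?_
      exact le_ciSup (f := fun i => c i * ‖e.repr v i‖) (Set.finite_range _).bddAbove i
  common_basis N N' hN hN' := by
    obtain ⟨b, hb⟩ := hN.2
    obtain ⟨b', hb'⟩ := hN'.2
    obtain ⟨e, he, he'⟩ := exists_common_isSplitBy n (isUltraNorm_of_isGood hN)
      (isUltraNorm_of_isGood hN') b b' ((ultraModel_isAdapted_iff hN).1 hb)
      ((ultraModel_isAdapted_iff hN').1 hb')
    exact ⟨e, (ultraModel_isAdapted_iff hN).2 he, (ultraModel_isAdapted_iff hN').2 he'⟩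
  volume N hN e e' he he' :=
    ((ultraModel_isAdapted_iff hN).1 he).basisDet_mul_eq (isUltraNorm_of_isGood hN)
      ((ultraModel_isAdapted_iff hN).1 he')
  ratio_perm N N' hN hN' e e' h1 h1' h2 h2' := by
    obtain ⟨σ, hσ⟩ := exists_perm_basisDet_le e e'
    refine ⟨σ, fun j => ?_⟩
    obtain ⟨hne, h⟩ := ((ultraModel_isAdapted_iff hN).1 h1).eq_of_perm (isUltraNorm_of_isGood hN)
      ((ultraModel_isAdapted_iff hN).1 h1') hσ j
    obtain ⟨-, h'⟩ := ((ultraModel_isAdapted_iff hN').1 h2).eq_of_perm (isUltraNorm_of_isGood hN')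
      ((ultraModel_isAdapted_iff hN').1 h2') hσ j
    rw [h, h', mul_div_mul_right _ _ (norm_ne_zero_iff.2 hne)]

end UltraModel

/-! ### Matrices and bases -/

section ColBasis

variable {K : Type*} [NormedField K] {n : ℕ}

/-- The basis of `K ^ n` formed by the columns of an invertible matrix. -/
def colBasis (A : Matrix (Fin n) (Fin n) K) (hA : A.det ≠ 0) :
    Module.Basis (Fin n) K (Fin n → K) :=
  (Pi.basisFun K (Fin n)).map
    (Matrix.toLinearEquiv (Pi.basisFun K (Fin n)) A (isUnit_iff_ne_zero.2 hA))

lemma colBasis_apply (A : Matrix (Fin n) (Fin n) K) (hA : A.det ≠ 0) (i j : Fin n) :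
    colBasis A hA j i = A i j := by
  simp [colBasis, Matrix.toLin_eq_toLin']

lemma basisDet_colBasis (A : Matrix (Fin n) (Fin n) K) (hA : A.det ≠ 0) :
    basisDet (colBasis A hA) = A.det := by
  rw [basisDet, Module.Basis.det_apply]
  congr 1
  ext i j
  rw [Module.Basis.toMatrix_apply, Pi.basisFun_repr, colBasis_apply]

/-- The matrix whose columns are the vectors of a basis. -/
def basisMatrix (e : Module.Basis (Fin n) K (Fin n → K)) : Matrix (Fin n) (Fin n) K :=
  Matrix.of fun i j => e j i

lemma det_basisMatrix (e : Module.Basis (Fin n) K (Fin n → K)) :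
    (basisMatrix e).det = basisDet e := by
  rw [basisDet, Module.Basis.det_apply]
  congr 1

lemma basisMatrix_colBasis (A : Matrix (Fin n) (Fin n) K) (hA : A.det ≠ 0) :
    basisMatrix (colBasis A hA) = A := by
  ext i j
  exact colBasis_apply A hA i j

lemma basisMatrix_mulVec (e : Module.Basis (Fin n) K (Fin n → K)) (a : Fin n → K) :
    (basisMatrix e).mulVec a = ∑ i, a i • e i := by
  ext i
  simp [Matrix.mulVec, dotProduct, basisMatrix, mul_comm]

/-- An invertible matrix has a nonzero generalised diagonal. -/
lemma exists_perm_of_det_ne_zero (P : Matrix (Fin n) (Fin n) K) (hP : P.det ≠ 0) :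
    ∃ σ : Equiv.Perm (Fin n), ∀ j, P (σ j) j ≠ 0 := by
  rw [Matrix.det_apply'] at hP
  obtain ⟨σ, -, hσ⟩ := Finset.exists_ne_zero_of_sum_ne_zero hP
  exact ⟨σ, fun j h => hσ (by
    rw [Finset.prod_eq_zero (f := fun i => P (σ i) i) (Finset.mem_univ j) h, mul_zero])⟩

end ColBasis

/-! ### Euclidean and hermitian norms -/

section Arch

variable {K : Type*} [RCLike K] {n : ℕ}

open Matrix in
/-- The real quadratic form `v ↦ re (v* H v)` of a matrix. -/
def quadForm (H : Matrix (Fin n) (Fin n) K) (v : Fin n → K) : ℝ :=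
  RCLike.re (star v ⬝ᵥ H.mulVec v)

open Matrix in
lemma quadForm_conj (H E : Matrix (Fin n) (Fin n) K) (a : Fin n → K) :
    quadForm (Eᴴ * H * E) a = quadForm H (E.mulVec a) := by
  rw [quadForm, quadForm, star_mulVec, ← dotProduct_mulVec, mulVec_mulVec, mulVec_mulVec,
    Matrix.mul_assoc]

lemma quadForm_diagonal (d : Fin n → ℝ) (a : Fin n → K) :
    quadForm (Matrix.diagonal fun i => (d i : K)) a = ∑ i, d i * ‖a i‖ ^ 2 := by
  rw [quadForm, dotProduct, map_sum]
  refine Finset.sum_congr rfl fun i _ => ?_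
  rw [Matrix.mulVec_diagonal, Pi.star_apply, mul_left_comm, RCLike.star_def, RCLike.conj_mul,
    ← RCLike.ofReal_pow, ← RCLike.ofReal_mul, RCLike.ofReal_re]

/-- Polarisation: a hermitian matrix is determined by its quadratic form. -/
lemma eq_of_quadForm_eq {G G' : Matrix (Fin n) (Fin n) K} (hG : G.IsHermitian)
    (hG' : G'.IsHermitian) (h : ∀ a, quadForm G a = quadForm G' a) : G = G' := by
  have hB := hG.sub hG'
  rw [← sub_eq_zero, ← hB.eigenvalues_eq_zero_iff]
  ext i
  rw [hB.eigenvalues_eq, Matrix.sub_mulVec, dotProduct_sub, map_sub]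
  exact sub_eq_zero.2 (h _)

lemma isHermitian_diagonal_ofReal (d : Fin n → ℝ) :
    (Matrix.diagonal fun i => (d i : K)).IsHermitian :=
  Matrix.isHermitian_diagonal_of_self_adjoint _ (by ext; simp)

open Matrix in
/-- A basis is adapted to a euclidean norm if and only if it is orthogonal. -/
lemma isAdapted_iff_gram {N : (Fin n → K) → ℝ} {H : Matrix (Fin n) (Fin n) K}
    (hH : H.IsHermitian) (hpos : ∀ v, v ≠ 0 → 0 < quadForm H v) (hN : ∀ v, N v = √(quadForm H v))
    (e : Module.Basis (Fin n) K (Fin n → K)) :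
    IsAdapted (archModel K n).agg N e ↔
      (basisMatrix e)ᴴ * H * basisMatrix e = diagonal fun i => ((N (e i) ^ 2 : ℝ) : K) := by
  have h0 : ∀ v, 0 ≤ quadForm H v := fun v => by
    by_cases hv : v = 0
    · simp [hv, quadForm]
    · exact (hpos v hv).le
  have key : IsAdapted (archModel K n).agg N e ↔
      ∀ a, quadForm H ((basisMatrix e).mulVec a) = ∑ i, N (e i) ^ 2 * ‖a i‖ ^ 2 := by
    refine forall_congr' fun a => ?_
    change _ = √(∑ i, (N (e i) * ‖a i‖) ^ 2) ↔ _
    rw [hN, ← basisMatrix_mulVec,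
      Real.sqrt_inj (h0 _) (Finset.sum_nonneg fun i _ => sq_nonneg _)]
    simp only [mul_pow]
  rw [key]
  simp only [← quadForm_conj, ← quadForm_diagonal]
  exact ⟨eq_of_quadForm_eq (isHermitian_conjTranspose_mul_mul _ hH)
    (isHermitian_diagonal_ofReal _), fun h a => by rw [h]⟩

open Matrix in
/-- A hermitian matrix is diagonalised by a unitary change of basis. -/
lemma exists_unitary_diag {A : Matrix (Fin n) (Fin n) K} (hA : A.IsHermitian) :
    ∃ (U : Matrix (Fin n) (Fin n) K) (d : Fin n → ℝ), Uᴴ * U = 1 ∧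
      Uᴴ * A * U = diagonal fun i => (d i : K) := by
  refine ⟨hA.eigenvectorUnitary, hA.eigenvalues, ?_, ?_⟩
  · exact Unitary.coe_star_mul_self hA.eigenvectorUnitary
  · have h := hA.conjStarAlgAut_star_eigenvectorUnitary
    rw [Unitary.conjStarAlgAut_star_apply] at h
    exact h

lemma det_ne_zero_of_conj {E H D : Matrix (Fin n) (Fin n) K} (h : E.conjTranspose * H * E = D)
    (hD : D.det ≠ 0) : E.det ≠ 0 := by
  intro h0
  rw [← h, Matrix.det_mul, h0, mul_zero] at hD
  exact hD rfl

open Matrix in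
/-- Simultaneous diagonalisation of two hermitian forms, the first one being positive definite. -/
lemma exists_simultaneous_diag {H H' : Matrix (Fin n) (Fin n) K} (hH : H.IsHermitian)
    (hpos : ∀ v, v ≠ 0 → 0 < quadForm H v) (hH' : H'.IsHermitian) :
    ∃ (E : Matrix (Fin n) (Fin n) K) (d : Fin n → ℝ), Eᴴ * H * E = 1 ∧
      Eᴴ * H' * E = diagonal fun i => (d i : K) := by
  obtain ⟨U, d, hU, hd⟩ := exists_unitary_diag hH
  have hdpos : ∀ i, 0 < d i := by
    intro i
    have h1 : quadForm (Uᴴ * H * U) (Pi.single i 1) = d i := by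
      rw [hd, quadForm_diagonal, Finset.sum_eq_single i]
      · simp
      · intro j _ hj
        simp [hj]
      · simp
    rw [← h1, quadForm_conj]
    refine hpos _ fun h0 => ?_
    have h2 : (Uᴴ * U).mulVec (Pi.single i 1) = 0 := by
      rw [← mulVec_mulVec, h0, mulVec_zero]
    rw [hU, one_mulVec] at h2
    simpa using congrFun h2 i
  -- after normalising `H` to the identity by `F`, a unitary `V` diagonalises `Fᴴ * H' * F`
  set F : Matrix (Fin n) (Fin n) K := U * diagonal fun i => (((√(d i))⁻¹ : ℝ) : K) with hF
  have hFH : Fᴴ * H * F = 1 := by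
    have : Fᴴ * H * F = (diagonal fun i => (((√(d i))⁻¹ : ℝ) : K))ᴴ * (Uᴴ * H * U) *
        diagonal fun i => (((√(d i))⁻¹ : ℝ) : K) := by
      rw [hF, conjTranspose_mul]
      simp only [Matrix.mul_assoc]
    rw [this, hd, (isHermitian_diagonal_ofReal _).eq, diagonal_mul_diagonal, diagonal_mul_diagonal,
      ← diagonal_one]
    congr 1
    ext1 i
    rw [← RCLike.ofReal_mul, ← RCLike.ofReal_mul]
    have h2 := Real.mul_self_sqrt (hdpos i).le
    rw [show (√(d i))⁻¹ * d i * (√(d i))⁻¹ = 1 by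
      rw [inv_mul_eq_div, ← div_eq_mul_inv, div_div, h2, div_self (hdpos i).ne']]
    simp
  obtain ⟨V, d', hV, hd'⟩ := exists_unitary_diag (isHermitian_conjTranspose_mul_mul F hH')
  refine ⟨F * V, d', ?_, ?_⟩
  · rw [conjTranspose_mul, show Vᴴ * Fᴴ * H * (F * V) = Vᴴ * (Fᴴ * H * F) * V by
      simp only [Matrix.mul_assoc], hFH, Matrix.mul_one, hV]
  · rw [conjTranspose_mul, show Vᴴ * Fᴴ * H' * (F * V) = Vᴴ * (Fᴴ * H' * F) * V by
      simp only [Matrix.mul_assoc], hd']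

lemma isAdapted_of_gram_diagonal {N : (Fin n → K) → ℝ} {H : Matrix (Fin n) (Fin n) K}
    (hH : H.IsHermitian) (hpos : ∀ v, v ≠ 0 → 0 < quadForm H v) (hN : ∀ v, N v = √(quadForm H v))
    {e : Module.Basis (Fin n) K (Fin n → K)} {d : Fin n → ℝ}
    (h : (basisMatrix e).conjTranspose * H * basisMatrix e = Matrix.diagonal fun i => (d i : K)) :
    IsAdapted (archModel K n).agg N e := by
  rw [isAdapted_iff_gram hH hpos hN, h]
  congr 1
  ext1 i
  have h1 : quadForm H (e i) = d i := by
    have h2 := quadForm_conj H (basisMatrix e) (Pi.single i 1)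
    rw [h, quadForm_diagonal, Finset.sum_eq_single i] at h2
    · rw [Matrix.mulVec_single_one] at h2
      refine Eq.symm (?_ : d i = quadForm H ((basisMatrix e).col i))
      simpa using h2
    · intro j _ hj
      simp [hj]
    · simp
  rw [hN, Real.sq_sqrt (hpos _ (e.ne_zero i)).le, h1]

lemma archModel_volume {N : (Fin n → K) → ℝ} (h : (archModel K n).IsGood N)
    {e e' : Module.Basis (Fin n) K (Fin n → K)} (he : IsAdapted (archModel K n).agg N e)
    (he' : IsAdapted (archModel K n).agg N e') :
    ‖basisDet e'‖ * ∏ i, N (e i) = ‖basisDet e‖ * ∏ i, N (e' i) := by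
  obtain ⟨H, hH, hpos, hN⟩ := h
  -- the square of the product of the lengths of an orthogonal basis is its Gram determinant
  have key : ∀ e : Module.Basis (Fin n) K (Fin n → K), IsAdapted (archModel K n).agg N e →
      (∏ i, N (e i)) ^ 2 = ‖basisDet e‖ ^ 2 * ‖H.det‖ := by
    intro e he
    have h1 := congrArg (fun A => ‖Matrix.det A‖) ((isAdapted_iff_gram hH hpos hN e).1 he)
    simp only [Matrix.det_mul, Matrix.det_conjTranspose, norm_mul, norm_star, det_basisMatrix,
      Matrix.det_diagonal, norm_prod, RCLike.norm_ofReal, abs_pow, sq_abs] at h1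
    rw [← Finset.prod_pow, ← h1]
    ring
  have h0 : ∀ e : Module.Basis (Fin n) K (Fin n → K), 0 ≤ ∏ i, N (e i) := fun e =>
    Finset.prod_nonneg fun i _ => by rw [hN]; exact Real.sqrt_nonneg _
  refine (pow_left_inj₀ (mul_nonneg (norm_nonneg _) (h0 _)) (mul_nonneg (norm_nonneg _) (h0 _))
    two_ne_zero).1 ?_
  rw [mul_pow, mul_pow, key e he, key e' he']
  ring

open Matrix in
/-- The ratios of two norms on a common orthogonal basis do not depend on the basis, up to order.
Let `P` be the transition matrix between two such bases. For either norm, the Gram matrices `G` and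
`D` on these bases are diagonal and satisfy `Pᴴ * G = D * P⁻¹`; comparing the relations obtained
from the two norms at a nonzero entry of `P` gives the equality of the ratios. -/
lemma archModel_ratio_perm {N N' : (Fin n → K) → ℝ} (h : (archModel K n).IsGood N)
    (h' : (archModel K n).IsGood N') {e e' : Module.Basis (Fin n) K (Fin n → K)}
    (he : IsAdapted (archModel K n).agg N e) (he' : IsAdapted (archModel K n).agg N e')
    (hf : IsAdapted (archModel K n).agg N' e) (hf' : IsAdapted (archModel K n).agg N' e') :
    ∃ σ : Equiv.Perm (Fin n), ∀ j, N' (e' j) / N (e' j) = N' (e (σ j)) / N (e (σ j)) := by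
  obtain ⟨H, hH, hpos, hN⟩ := h
  obtain ⟨H', hH', hpos', hN'⟩ := h'
  set E := basisMatrix e
  set E' := basisMatrix e'
  have hE : IsUnit E.det := by
    rw [det_basisMatrix]; exact isUnit_iff_ne_zero.2 (basisDet_ne_zero e)
  have hE' : IsUnit E'.det := by
    rw [det_basisMatrix]; exact isUnit_iff_ne_zero.2 (basisDet_ne_zero e')
  obtain ⟨Q, hEQ⟩ : ∃ Q, E' * Q = E := ⟨_, mul_nonsing_inv_cancel_left _ _ hE'⟩
  obtain ⟨P, hEP⟩ : ∃ P, E * P = E' := ⟨_, mul_nonsing_inv_cancel_left _ _ hE⟩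
  have hPdet : P.det ≠ 0 := by
    intro h0
    rw [← hEP, det_mul, h0, mul_zero] at hE'
    exact hE'.ne_zero rfl
  obtain ⟨σ, hσ⟩ := exists_perm_of_det_ne_zero P hPdet
  refine ⟨σ, fun j => ?_⟩
  -- both Gram matrices transform by the same transition matrix
  have key : ∀ (N : (Fin n → K) → ℝ) (H : Matrix (Fin n) (Fin n) K), H.IsHermitian →
      (∀ v, v ≠ 0 → 0 < quadForm H v) → (∀ v, N v = √(quadForm H v)) →
      IsAdapted (archModel K n).agg N e → IsAdapted (archModel K n).agg N e' →
      star (P (σ j) j) * ((N (e (σ j)) ^ 2 : ℝ) : K) = ((N (e' j) ^ 2 : ℝ) : K) * Q j (σ j) := by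
    intro N H hH hpos hN he he'
    have h1 := (isAdapted_iff_gram hH hpos hN e).1 he
    have h2 := (isAdapted_iff_gram hH hpos hN e').1 he'
    have h3 : Pᴴ * (Eᴴ * H * E) = (E'ᴴ * H * E') * Q := by
      rw [Matrix.mul_assoc (E'ᴴ * H), hEQ, ← hEP, conjTranspose_mul]
      simp only [Matrix.mul_assoc]
    change Pᴴ * ((basisMatrix e)ᴴ * H * basisMatrix e) =
      ((basisMatrix e')ᴴ * H * basisMatrix e') * Q at h3
    rw [h1, h2] at h3
    have h4 := congrFun (congrFun h3 j) (σ j)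
    rwa [mul_diagonal, diagonal_mul, conjTranspose_apply] at h4
  have k1 := key N H hH hpos hN he he'
  have k2 := key N' H' hH' hpos' hN' hf hf'
  have p1 : ∀ v, v ≠ 0 → 0 < N v := fun v hv => by rw [hN]; exact Real.sqrt_pos.2 (hpos v hv)
  have p2 : ∀ v, v ≠ 0 → 0 < N' v := fun v hv => by rw [hN']; exact Real.sqrt_pos.2 (hpos' v hv)
  have a1 := p1 _ (e.ne_zero (σ j))
  have a2 := p1 _ (e'.ne_zero j)
  have b1 := p2 _ (e.ne_zero (σ j))
  have b2 := p2 _ (e'.ne_zero j)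
  have hx : 0 < ‖P (σ j) j‖ := norm_pos_iff.2 (hσ j)
  have l1 := congrArg norm k1
  have l2 := congrArg norm k2
  simp only [norm_mul, norm_star, RCLike.norm_ofReal, abs_pow, sq_abs] at l1 l2
  rw [div_eq_div_iff a2.ne' a1.ne']
  refine (pow_left_inj₀ (by positivity) (by positivity) two_ne_zero).1 ?_
  have hy : ‖Q j (σ j)‖ ≠ 0 := by
    intro h0
    rw [h0, mul_zero] at l1
    exact (by positivity : ‖P (σ j) j‖ * N (e (σ j)) ^ 2 ≠ 0) l1
  refine mul_right_cancel₀ (mul_ne_zero hx.ne' hy) ?_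
  linear_combination ‖P (σ j) j‖ * N (e (σ j)) ^ 2 * (-l2) + ‖P (σ j) j‖ * N' (e (σ j)) ^ 2 * l1

lemma archModel_good_of_basis (e : Module.Basis (Fin n) K (Fin n → K)) (c : Fin n → ℝ)
    (hc : ∀ i, 0 < c i) :
    (archModel K n).IsGood fun v => (archModel K n).agg fun i => c i * ‖e.repr v i‖ := by
  set Q : Matrix (Fin n) (Fin n) K := e.toMatrix (Pi.basisFun K (Fin n)) with hQ
  have hQv : ∀ v i, Q.mulVec v i = e.repr v i := by
    intro v i
    have h := congrFun (Module.Basis.toMatrix_mulVec_repr (Pi.basisFun K (Fin n)) e v) i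
    rw [← h]
    rfl
  have hq : ∀ v, quadForm (Q.conjTranspose * (Matrix.diagonal fun i => ((c i ^ 2 : ℝ) : K)) * Q) v
      = ∑ i, (c i * ‖e.repr v i‖) ^ 2 := by
    intro v
    rw [quadForm_conj, quadForm_diagonal]
    simp only [hQv, mul_pow]
  refine ⟨_, Matrix.isHermitian_conjTranspose_mul_mul Q (isHermitian_diagonal_ofReal
    fun i => c i ^ 2), fun v hv => ?_, fun v => ?_⟩
  · refine lt_of_lt_of_eq ?_ (hq v).symm
    have : ∃ i, e.repr v i ≠ 0 := by
      by_contra! h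
      exact hv (e.repr.map_eq_zero_iff.1 (Finsupp.ext h))
    obtain ⟨i, hi⟩ := this
    exact Finset.sum_pos' (fun i _ => sq_nonneg _)
      ⟨i, Finset.mem_univ i, pow_pos (mul_pos (hc i) (norm_pos_iff.2 hi)) 2⟩
  · exact congrArg Real.sqrt (hq v).symm

lemma archModel_isRegular (K : Type*) [RCLike K] (n : ℕ) : (archModel K n).IsRegular where
  mono c d hc hcd := Real.sqrt_le_sqrt
    (Finset.sum_le_sum fun i _ => pow_le_pow_left₀ (hc i) (hcd i) 2)
  smul t c ht := by
    change √(∑ i, (t * c i) ^ 2) = t * √(∑ i, c i ^ 2)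
    simp only [mul_pow]
    rw [← Finset.mul_sum, Real.sqrt_mul (sq_nonneg t), Real.sqrt_sq ht]
  good_smul := by
    rintro N ⟨H, hH, hpos, hN⟩ a v
    rw [hN, hN, Matrix.mulVec_smul, star_smul, smul_dotProduct, dotProduct_smul, smul_smul,
      RCLike.star_def, RCLike.conj_mul, smul_eq_mul, ← RCLike.ofReal_pow, RCLike.re_ofReal_mul,
      Real.sqrt_mul (sq_nonneg _), Real.sqrt_sq (norm_nonneg _)]
  good_pos := by
    rintro N ⟨H, hH, hpos, hN⟩ v hv
    rw [hN]
    exact Real.sqrt_pos.2 (hpos v hv)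
  good_of_basis := archModel_good_of_basis
  common_basis := by
    rintro N N' ⟨H, hH, hpos, hN⟩ ⟨H', hH', hpos', hN'⟩
    obtain ⟨E, d, h1, h2⟩ := exists_simultaneous_diag hH hpos hH'
    have hE : E.det ≠ 0 := det_ne_zero_of_conj h1 (by simp)
    refine ⟨colBasis E hE, isAdapted_of_gram_diagonal hH hpos hN (d := 1) ?_,
      isAdapted_of_gram_diagonal hH' hpos' hN' (d := d) ?_⟩
    · rw [basisMatrix_colBasis, h1]
      simp
    · rw [basisMatrix_colBasis, h2]
  volume _ h _ _ := archModel_volume h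
  ratio_perm _ _ h h' _ _ := archModel_ratio_perm h h'

end Arch

/-! ### Splitting bases of a given ultrametric norm -/

section Split

variable {K : Type*} [NormedField K] {n : ℕ}

lemma IsSplitBy.unitsSMul {N : (Fin n → K) → ℝ} (hN : IsUltraNorm (K := K) N)
    {e : Module.Basis (Fin n) K (Fin n → K)} (he : IsSplitBy N e) (c : Fin n → Kˣ) :
    IsSplitBy N (e.unitsSMul c) := by
  intro v i
  refine le_trans (le_of_eq ?_) (he v i)
  rw [Module.Basis.unitsSMul_apply, Module.Basis.repr_unitsSMul, Units.smul_def, Units.smul_def,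
    hN.smul, norm_smul, Units.val_inv_eq_inv_val, norm_inv]
  have : ‖(c i : K)‖ ≠ 0 := norm_ne_zero_iff.2 (c i).ne_zero
  field_simp

lemma IsSplitBy.reindex {N : (Fin n → K) → ℝ} {e : Module.Basis (Fin n) K (Fin n → K)}
    (he : IsSplitBy N e) (σ : Equiv.Perm (Fin n)) : IsSplitBy N (e.reindex σ) := by
  intro v i
  simpa using he v (σ.symm i)

variable [IsUltrametricDist K]

/-- A norm split by `e` is split by `e'` as soon as the splitting inequality holds on `e`. -/
lemma IsSplitBy.of_apply {N : (Fin n → K) → ℝ} (hN : IsUltraNorm (K := K) N)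
    {e e' : Module.Basis (Fin n) K (Fin n → K)} (he : IsSplitBy N e)
    (h : ∀ i j, N (e' j) * ‖e'.repr (e i) j‖ ≤ N (e i)) : IsSplitBy N e' := by
  intro v j
  have h1 : e'.repr v j = ∑ i, e.repr v i * e'.repr (e i) j := by
    conv_lhs => rw [← e.sum_repr v, map_sum, Finsupp.finsetSum_apply]
    simp only [map_smul, Finsupp.smul_apply, smul_eq_mul]
  have hpos := hN.pos _ (e'.ne_zero j)
  rw [mul_comm, ← le_div_iff₀ hpos, h1]
  refine IsUltrametricDist.norm_sum_le_of_forall_le_of_nonneg (div_nonneg (hN.nonneg v) hpos.le)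
    fun i _ => ?_
  rw [le_div_iff₀ hpos, norm_mul]
  calc ‖e.repr v i‖ * ‖e'.repr (e i) j‖ * N (e' j)
      = N (e' j) * ‖e'.repr (e i) j‖ * ‖e.repr v i‖ := by ring
    _ ≤ N (e i) * ‖e.repr v i‖ := mul_le_mul_of_nonneg_right (h i j) (norm_nonneg _)
    _ ≤ N v := he v i

/-- The equality case of the ultrametric Hadamard inequality: a basis whose vectors have a product
of norms as small as its determinant allows is a splitting basis. -/
lemma IsSplitBy.of_prod_le {N : (Fin n → K) → ℝ} (hN : (ultraModel K n).IsGood N)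
    {e e' : Module.Basis (Fin n) K (Fin n → K)} (he : IsSplitBy N e)
    (h : ‖basisDet e‖ * ∏ i, N (e' i) ≤ ‖basisDet e'‖ * ∏ i, N (e i)) : IsSplitBy N e' := by
  have hM := ultraModel_isRegular K n
  have hu := isUltraNorm_of_isGood hN
  obtain ⟨N', hN', had', hval⟩ := exists_good_of_basis hM e' (fun i => N (e' i))
    fun i => hu.pos _ (e'.ne_zero i)
  have hu' := isUltraNorm_of_isGood hN'
  have hs' := (ultraModel_isAdapted_iff hN').1 had'
  -- `N'` is the largest ultrametric norm with the values of `N` on `e'`; both have the same volume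
  have hle : ∀ v, N v ≤ N' v := fun v => hu.le_of_repr e' v (hu'.nonneg v) fun i => by
    rw [← hval]
    exact hs' v i
  obtain ⟨d, hd, hd'⟩ := hM.common_basis N N' hN hN'
  have hv := hM.volume N hN e d ((ultraModel_isAdapted_iff hN).2 he) hd
  have hv' := hM.volume N' hN' e' d had' hd'
  simp only [hval] at hv'
  have hdet := norm_pos_iff.2 (basisDet_ne_zero e)
  have hdet' := norm_pos_iff.2 (basisDet_ne_zero e')
  have hdetd := norm_pos_iff.2 (basisDet_ne_zero d)
  have hprod : ∏ i, N' (d i) ≤ ∏ i, N (d i) := by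
    have h1 := mul_le_mul_of_nonneg_left h hdetd.le
    have h2 : ‖basisDet e‖ * ‖basisDet e'‖ * ∏ i, N' (d i)
        ≤ ‖basisDet e‖ * ‖basisDet e'‖ * ∏ i, N (d i) := by
      linear_combination h1 - ‖basisDet e‖ * hv' + ‖basisDet e'‖ * hv
    exact le_of_mul_le_mul_left h2 (mul_pos hdet hdet')
  have heq : ∀ i, N' (d i) ≤ 1 * N (d i) := by
    intro i
    rw [one_mul]
    by_contra! hlt
    refine hprod.not_gt (Finset.prod_lt_prod (fun j _ => hu.pos _ (d.ne_zero j))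
      (fun j _ => hle _) ⟨i, Finset.mem_univ i, hlt⟩)
  have hge : ∀ v, N' v ≤ N v := fun v => by
    simpa using le_mul_of_adapted hM hN' hd hd' one_pos.le heq v
  have : N = N' := funext fun v => le_antisymm (hle v) (hge v)
  rw [this]
  exact hs'

variable {f : Flat n → Es (ultraModel K n)} {e e' : Module.Basis (Fin n) K (Fin n → K)}

/-- `f` is the marked apartment of the basis `e` of determinant one. -/
structure IsFlatOf (f : Flat n → Es (ultraModel K n))
    (e : Module.Basis (Fin n) K (Fin n → K)) : Prop where
  det : basisDet e = 1
  adapted : ∀ α, IsAdapted (ultraModel K n).agg (f α) e ∧ ∀ i, f α (e i) = Real.exp (-α.1 i)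

lemma Es.isUltraNorm (x : Es (ultraModel K n)) : IsUltraNorm (K := K) x.1 :=
  isUltraNorm_of_isGood x.2.1

namespace IsFlatOf

lemma mem (h : IsFlatOf f e) : f ∈ markedFlats (ultraModel K n) := ⟨e, h.det, h.adapted⟩

lemma split (h : IsFlatOf f e) (α : Flat n) : IsSplitBy (f α).1 e :=
  (ultraModel_isAdapted_iff (f α).2.1).1 (h.adapted α).1

lemma apply (h : IsFlatOf f e) (α : Flat n) (i : Fin n) : (f α).1 (e i) = Real.exp (-α.1 i) :=
  (h.adapted α).2 i

lemma mem_range (h : IsFlatOf f e) (x : Es (ultraModel K n)) :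
    x ∈ Set.range f ↔ IsSplitBy x.1 e := by
  rw [← ultraModel_isAdapted_iff x.2.1]
  exact mem_range_iff (ultraModel_isRegular K n) h.det h.adapted x

lemma prod_apply (h : IsFlatOf f e) (α : Flat n) : ∏ i, (f α).1 (e i) = 1 := by
  rw [Es.prod_eq (ultraModel_isRegular K n) _ (h.adapted α).1, h.det, norm_one]

end IsFlatOf

lemma exists_isFlatOf {f : Flat n → Es (ultraModel K n)} (hf : f ∈ markedFlats (ultraModel K n)) :
    ∃ e, IsFlatOf f e := by
  obtain ⟨e, h1, h2⟩ := hf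
  exact ⟨e, h1, h2⟩

/-- The norms split by a basis of arbitrary determinant lie in a common marked apartment. -/
lemma exists_flat_of_basis (e : Module.Basis (Fin n) K (Fin n → K)) :
    ∃ f ∈ markedFlats (ultraModel K n), ∀ x : Es (ultraModel K n), IsSplitBy x.1 e →
      x ∈ Set.range f := by
  obtain ⟨c, hc, -⟩ := exists_units_det_one e
  have hM := ultraModel_isRegular K n
  refine ⟨_, flatMap_mem hM _ hc, fun x hx => ?_⟩
  have h : IsFlatOf (flatMap hM _ hc) (e.unitsSMul c) :=
    ⟨hc, fun α => ⟨flatMap_adapted hM _ hc α, flatMap_apply hM _ hc α⟩⟩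
  exact (h.mem_range x).2 (hx.unitsSMul x.isUltraNorm c)

end Split

/-! ### The affine Weyl group -/

section Weyl

variable {K : Type*} [NormedField K] {n : ℕ}

/-- The vector of `𝔸` with given coordinates. -/
def flatOf (u : Fin n → ℝ) (hu : ∑ i, u i = 0) : Flat n := ⟨WithLp.toLp 2 u, hu⟩

lemma flatOf_apply (u : Fin n → ℝ) (hu : ∑ i, u i = 0) (i : Fin n) : (flatOf u hu).1 i = u i := rfl

lemma exists_affineWeyl (σ : Equiv.Perm (Fin n)) (c : Fin n → Kˣ)
    (hc : ∑ i, Real.log ‖(c i : K)‖ = 0) :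
    ∃ w ∈ affineWeyl K n, ∀ (α : Flat n) i, (w α).1 i = α.1 (σ i) + Real.log ‖(c i : K)‖ := by
  have h : ∀ α : Flat n, ∑ i, (α.1 (σ i) + Real.log ‖(c i : K)‖) = 0 := by
    intro α
    rw [Finset.sum_add_distrib, hc, add_zero, Equiv.sum_comp σ fun i => α.1 i]
    exact α.2
  exact ⟨fun α => flatOf _ (h α), ⟨σ, c, fun α i => rfl⟩, fun α i => rfl⟩

lemma sum_log_eq_zero {w : Flat n → Flat n} {σ : Equiv.Perm (Fin n)} {c : Fin n → Kˣ}
    (hw : ∀ (α : Flat n) i, (w α).1 i = α.1 (σ i) + Real.log ‖(c i : K)‖) :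
    ∑ i, Real.log ‖(c i : K)‖ = 0 := by
  have h : ∑ i, (w 0).1 i = 0 := (w 0).2
  simpa [hw] using h

lemma affineWeyl_surjective {w : Flat n → Flat n} (hw : w ∈ affineWeyl K n) :
    Function.Surjective w := by
  obtain ⟨σ, c, hw⟩ := hw
  intro β
  have h0 := sum_log_eq_zero hw
  have h : ∑ i, (β.1 (σ.symm i) - Real.log ‖(c (σ.symm i) : K)‖) = 0 := by
    rw [Equiv.sum_comp σ.symm fun i => β.1 i - Real.log ‖(c i : K)‖, Finset.sum_sub_distrib, h0,
      sub_zero]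
    exact β.2
  refine ⟨flatOf _ h, ?_⟩
  apply Subtype.ext
  ext i
  rw [hw, flatOf_apply]
  simp

/-- A half-space `α k - α i ≤ const` of `𝔸`, in exponential form, is closed and convex. The constant
is infinite, and the half-space is everything, when `t = 0`. -/
lemma isClosed_convex_exp_le (i k : Fin n) {t s : ℝ} (ht : 0 ≤ t) (hs : 0 < s) :
    IsClosed {α : Flat n | t * Real.exp (-α.1 i) ≤ s * Real.exp (-α.1 k)} ∧
      Convex ℝ {α : Flat n | t * Real.exp (-α.1 i) ≤ s * Real.exp (-α.1 k)} := by
  rcases ht.eq_or_lt with rfl | ht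
  · have : {α : Flat n | 0 * Real.exp (-α.1 i) ≤ s * Real.exp (-α.1 k)} = Set.univ :=
      Set.eq_univ_of_forall fun α => by
        change 0 * Real.exp (-α.1 i) ≤ s * Real.exp (-α.1 k)
        rw [zero_mul]
        positivity
    rw [this]
    exact ⟨isClosed_univ, convex_univ⟩
  · let l : Flat n →ₗ[ℝ] ℝ :=
      { toFun := fun α => α.1 i - α.1 k
        map_add' := fun α β => by simp; ring
        map_smul' := fun r α => by simp; ring }
    have : {α : Flat n | t * Real.exp (-α.1 i) ≤ s * Real.exp (-α.1 k)}
        = {α | Real.log t - Real.log s ≤ l α} := by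
      ext α
      change t * Real.exp (-α.1 i) ≤ s * Real.exp (-α.1 k) ↔
        Real.log t - Real.log s ≤ α.1 i - α.1 k
      rw [← Real.log_le_log_iff (by positivity) (by positivity),
        Real.log_mul ht.ne' (Real.exp_pos _).ne', Real.log_mul hs.ne' (Real.exp_pos _).ne',
        Real.log_exp, Real.log_exp]
      constructor <;> intro h <;> linarith
    rw [this]
    exact ⟨isClosed_le continuous_const l.continuous_of_finiteDimensional,
      convex_halfSpace_ge l.isLinear _⟩

/-- Two roots which are not opposite are simultaneously positive somewhere. -/
lemma exists_flat_root_pos {i j a b : Fin n} (hij : i ≠ j) (hab : a ≠ b) (h : ¬ (a = j ∧ b = i)) :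
    ∃ v : Flat n, 1 ≤ v.1 i - v.1 j ∧ 1 ≤ v.1 a - v.1 b := by
  let u : Fin n → ℝ := Pi.single i 1 - Pi.single j 1 + (Pi.single a 1 - Pi.single b 1)
  have hu : ∑ k, u k = 0 := by
    simp [u, Finset.sum_add_distrib, Finset.sum_sub_distrib]
  refine ⟨flatOf u hu, ?_⟩
  simp only [flatOf_apply, u, Pi.add_apply, Pi.sub_apply, Pi.single_apply]
  constructor <;> split_ifs <;> first | (norm_num; done) | (exfalso; grind)

/-- A vector of `𝔸` with a prescribed value of a root. -/
lemma exists_flat_root_eq {a b : Fin n} (hab : a ≠ b) (t : ℝ) :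
    ∃ v : Flat n, v.1 a - v.1 b = t := by
  let u : Fin n → ℝ := Pi.single a (t / 2) - Pi.single b (t / 2)
  have hu : ∑ k, u k = 0 := by
    simp [u, Finset.sum_sub_distrib]
  refine ⟨flatOf u hu, ?_⟩
  simp [flatOf_apply, u, hab, hab.symm]

/-- A dominant vector: its coordinates decrease by at least one along `σ`. -/
lemma exists_flat_dominant (σ : Equiv.Perm (Fin n)) :
    ∃ ρ : Flat n, ∀ i j, i < j → 1 ≤ ρ.1 (σ i) - ρ.1 (σ j) := by
  let u : Fin n → ℝ := fun k => ∑ j : Fin n, ((j : ℝ) - ((σ.symm k : Fin n) : ℝ))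
  have hu : ∑ k, u k = 0 := by
    have h1 : ∑ k, u k = ∑ k : Fin n, ∑ j : Fin n, ((j : ℝ) - (k : ℝ)) :=
      Equiv.sum_comp σ.symm fun k : Fin n => ∑ j : Fin n, ((j : ℝ) - (k : ℝ))
    rw [h1]
    simp only [Finset.sum_sub_distrib]
    rw [Finset.sum_comm, sub_self]
  refine ⟨flatOf u hu, fun i j hij => ?_⟩
  simp only [flatOf_apply, u, Equiv.symm_apply_apply, Finset.sum_sub_distrib, Finset.sum_const,
    Finset.card_univ, Fintype.card_fin, nsmul_eq_mul]
  have h1 : (1 : ℝ) ≤ n := by exact_mod_cast Nat.one_le_iff_ne_zero.2 (by rintro rfl; exact i.elim0)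
  have h2 : (i : ℝ) + 1 ≤ j := by exact_mod_cast hij
  nlinarith

end Weyl

/-! ### The axioms of affine buildings for ultrametric norms -/

section Axioms

variable {K : Type*} [NormedField K] [IsUltrametricDist K] {n : ℕ}

/-- Precomposing `f_e` with `w` amounts to permuting and rescaling the basis `e`. -/
lemma markedFlats_comp_mem {f : Flat n → Es (ultraModel K n)}
    (hf : f ∈ markedFlats (ultraModel K n)) {w : Flat n → Flat n} (hw : w ∈ affineWeyl K n) :
    f ∘ w ∈ markedFlats (ultraModel K n) := by
  obtain ⟨e, he⟩ := exists_isFlatOf hf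
  obtain ⟨σ, c, hw⟩ := hw
  set e₁ := (e.unitsSMul c).reindex σ with he₁
  have hdet : ‖basisDet e₁‖ = 1 := by
    have h := sum_log_eq_zero hw
    rw [← Real.log_prod fun i _ => norm_ne_zero_iff.2 (c i).ne_zero] at h
    rw [he₁, norm_basisDet_reindex, basisDet_unitsSMul, he.det, mul_one, norm_prod,
      ← Real.exp_log (Finset.prod_pos fun i _ => norm_pos_iff.2 (c i).ne_zero), h, Real.exp_zero]
  obtain ⟨d, hd, hd1⟩ := exists_units_det_one e₁
  refine ⟨e₁.unitsSMul d, hd, fun α => ⟨?_, fun i => ?_⟩⟩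
  · refine (ultraModel_isAdapted_iff (f (w α)).2.1).2 ?_
    exact (((he.split _).unitsSMul (Es.isUltraNorm _) c).reindex σ).unitsSMul (Es.isUltraNorm _) d
  · have hu := (f (w α)).isUltraNorm
    change (f (w α)).1 _ = _
    rw [Module.Basis.unitsSMul_apply, Units.smul_def, hu.smul, hd1 hdet i, one_mul, he₁,
      Module.Basis.reindex_apply, Module.Basis.unitsSMul_apply, Units.smul_def, hu.smul,
      he.apply, hw, neg_add, Real.exp_add, Real.exp_neg (Real.log _),
      Real.exp_log (norm_pos_iff.2 (c _).ne_zero), Equiv.apply_symm_apply]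
    have : ‖(c (σ.symm i) : K)‖ ≠ 0 := norm_ne_zero_iff.2 (c _).ne_zero
    field_simp

/-- The intersection of two apartments is closed and convex, because it is described by finitely
many inequalities between coordinates: the norm `f α` takes on each vector of `e'` the value of its
component along `σ`, and is split by `e'`. -/
lemma markedFlats_isClosed_convex {f f' : Flat n → Es (ultraModel K n)}
    (hf : f ∈ markedFlats (ultraModel K n)) (hf' : f' ∈ markedFlats (ultraModel K n)) :
    IsClosed (f ⁻¹' Set.range f') ∧ Convex ℝ (f ⁻¹' Set.range f') := by
  obtain ⟨e, he⟩ := exists_isFlatOf hf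
  obtain ⟨e', he'⟩ := exists_isFlatOf hf'
  obtain ⟨σ, hσ⟩ := exists_perm_basisDet_le e e'
  have hne : ∀ j, 0 < ‖e.repr (e' j) (σ j)‖ := by
    have hprod : 0 < ∏ j, ‖e.repr (e' j) (σ j)‖ :=
      pos_of_mul_pos_right ((norm_pos_iff.2 (basisDet_ne_zero e')).trans_le hσ) (norm_nonneg _)
    intro j
    refine (norm_nonneg _).lt_of_ne fun h0 => ?_
    exact hprod.ne' (Finset.prod_eq_zero (Finset.mem_univ j) h0.symm)
  have hset : f ⁻¹' Set.range f' =
      (⋂ i, ⋂ j, {α : Flat n | ‖e.repr (e' j) i‖ * Real.exp (-α.1 i)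
        ≤ ‖e.repr (e' j) (σ j)‖ * Real.exp (-α.1 (σ j))}) ∩
      ⋂ i, ⋂ j, {α : Flat n | (‖e.repr (e' j) (σ j)‖ * ‖e'.repr (e i) j‖) * Real.exp (-α.1 (σ j))
        ≤ 1 * Real.exp (-α.1 i)} := by
    ext α
    rw [Set.mem_preimage, he'.mem_range]
    have hs := he.split α
    have hu := (f α).isUltraNorm
    simp only [Set.mem_inter_iff, Set.mem_iInter, Set.mem_ofPred_eq]
    constructor
    · intro h
      have hval : ∀ j, (f α).1 (e' j) = ‖e.repr (e' j) (σ j)‖ * Real.exp (-α.1 (σ j)) := by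
        intro j
        rw [(hs.eq_of_perm hu h hσ j).2, he.apply, mul_comm]
      refine ⟨fun i j => ?_, fun i j => ?_⟩
      · rw [← hval, ← he.apply, mul_comm]
        exact hs _ _
      · rw [one_mul, ← he.apply α i, mul_right_comm, ← hval]
        exact h _ _
    · rintro ⟨h1, h2⟩
      refine hs.of_apply hu fun i j => ?_
      have hval : (f α).1 (e' j) ≤ ‖e.repr (e' j) (σ j)‖ * Real.exp (-α.1 (σ j)) := by
        refine hu.le_of_repr e _ (by positivity) fun i => ?_
        rw [he.apply, mul_comm]
        exact h1 i j
      refine (mul_le_mul_of_nonneg_right hval (norm_nonneg _)).trans ?_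
      rw [mul_right_comm, he.apply, ← one_mul (Real.exp (-α.1 i))]
      exact h2 i j
  have key1 := fun i j => isClosed_convex_exp_le (n := n) i (σ j) (norm_nonneg (e.repr (e' j) i))
    (hne j)
  have key2 := fun i j => isClosed_convex_exp_le (n := n) (σ j) i
    (mul_nonneg (norm_nonneg (e.repr (e' j) (σ j))) (norm_nonneg (e'.repr (e i) j))) one_pos
  rw [hset]
  exact ⟨(isClosed_iInter fun i => isClosed_iInter fun j => (key1 i j).1).inter
      (isClosed_iInter fun i => isClosed_iInter fun j => (key2 i j).1),
    (convex_iInter fun i => convex_iInter fun j => (key1 i j).2).inter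
      (convex_iInter fun i => convex_iInter fun j => (key2 i j).2)⟩

/-- A dominant term in the determinant of the transition matrix gives the
element of the affine Weyl group relating two apartments along their intersection. -/
lemma markedFlats_compatible {f f' : Flat n → Es (ultraModel K n)}
    (hf : f ∈ markedFlats (ultraModel K n)) (hf' : f' ∈ markedFlats (ultraModel K n)) :
    ∃ w ∈ affineWeyl K n, ∀ α ∈ f ⁻¹' Set.range f', f α = f' (w α) := by
  obtain ⟨e, he⟩ := exists_isFlatOf hf
  obtain ⟨e', he'⟩ := exists_isFlatOf hf'
  obtain ⟨σ, hσ⟩ := exists_perm_basisDet_le e e'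
  by_cases hemp : (f ⁻¹' Set.range f').Nonempty
  · have key : ∀ α β, f α = f' β → ∀ j, e.repr (e' j) (σ j) ≠ 0 ∧
        β.1 j = α.1 (σ j) - Real.log ‖e.repr (e' j) (σ j)‖ := by
      intro α β h j
      have hs' := he'.split β
      rw [← h] at hs'
      obtain ⟨h0, h1⟩ := (he.split α).eq_of_perm (f α).isUltraNorm hs' hσ j
      refine ⟨h0, ?_⟩
      have h2 := he'.apply β j
      rw [← h, h1, he.apply] at h2
      have h3 := congrArg Real.log h2
      rw [Real.log_mul (Real.exp_pos _).ne' (norm_ne_zero_iff.2 h0), Real.log_exp,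
        Real.log_exp] at h3
      linarith
    obtain ⟨α₀, β₀, hβ₀⟩ := hemp
    have hk := key α₀ β₀ hβ₀.symm
    obtain ⟨w, hw, hwα⟩ := exists_affineWeyl (K := K) σ
      (fun j => (Units.mk0 _ (hk j).1)⁻¹) (by
        have h1 : ∑ j, β₀.1 j = 0 := β₀.2
        have h2 : ∑ j, α₀.1 (σ j) = 0 := by
          rw [Equiv.sum_comp σ fun i => α₀.1 i]
          exact α₀.2
        simp only [fun j => (hk j).2, Finset.sum_sub_distrib, h2] at h1
        simpa using h1)
    refine ⟨w, hw, ?_⟩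
    rintro α ⟨β, hβ⟩
    rw [← hβ]
    congr 1
    apply Subtype.ext
    ext j
    rw [hwα, (key α β hβ.symm j).2]
    simp [sub_eq_add_neg]
  · obtain ⟨w, hw, -⟩ := exists_affineWeyl (K := K) (1 : Equiv.Perm (Fin n)) (fun _ => 1) (by simp)
    exact ⟨w, hw, fun α hα => absurd ⟨α, hα⟩ hemp⟩

/-- Bruhat decomposition: two complete flags, given by two ordered bases, admit a common adapted
basis. The vector `b j` is chosen in the coset `e j + ⟨e i, i < j⟩` with leading index with
respect to `e'` as small as possible; these leading indices are then distinct. -/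
lemma exists_bruhat {F V : Type*} [Field F] [AddCommGroup V] [Module F V]
    (e e' : Module.Basis (Fin n) F V) :
    ∃ (b : Fin n → V) (τ : Equiv.Perm (Fin n)),
      (∀ j, e.repr (b j) j = 1 ∧ ∀ i, j < i → e.repr (b j) i = 0) ∧
      ∀ j, e'.repr (b j) (τ j) ≠ 0 ∧ ∀ i, τ j < i → e'.repr (b j) i = 0 := by
  classical
  have hlead : ∀ v : V, v ≠ 0 → ∃ d, e'.repr v d ≠ 0 ∧ ∀ i, d < i → e'.repr v i = 0 := by
    intro v hv
    have hne : (e'.repr v).support.Nonempty := by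
      rw [Finsupp.support_nonempty_iff]
      exact fun h => hv (e'.repr.map_eq_zero_iff.1 h)
    refine ⟨(e'.repr v).support.max' hne, ?_, fun i hi => ?_⟩
    · exact Finsupp.mem_support_iff.1 (Finset.max'_mem _ hne)
    · by_contra h0
      exact (Finset.le_max' _ i (Finsupp.mem_support_iff.2 h0)).not_gt hi
  have hmin : ∀ j, ∃ d, ∃ v, (e.repr v j = 1 ∧ ∀ i, j < i → e.repr v i = 0) ∧
      (e'.repr v d ≠ 0 ∧ ∀ i, d < i → e'.repr v i = 0) ∧
      ∀ v', (e.repr v' j = 1 ∧ ∀ i, j < i → e.repr v' i = 0) → ∃ i, d ≤ i ∧ e'.repr v' i ≠ 0 := by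
    intro j
    let P : Fin n → Prop := fun d => ∃ v, (e.repr v j = 1 ∧ ∀ i, j < i → e.repr v i = 0) ∧
      e'.repr v d ≠ 0 ∧ ∀ i, d < i → e'.repr v i = 0
    have hP : ∃ d, P d := by
      obtain ⟨d, hd⟩ := hlead (e j) (e.ne_zero j)
      refine ⟨d, e j, ⟨by simp, fun i hi => ?_⟩, hd⟩
      rw [e.repr_self, Finsupp.single_eq_of_ne hi.ne']
    obtain ⟨d, hd, hmin⟩ := WellFounded.has_min (wellFounded_lt (α := Fin n)) {d | P d} hP
    obtain ⟨v, hv, hvd⟩ := hd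
    refine ⟨d, v, hv, hvd, fun v' hv' => ?_⟩
    have hv0 : v' ≠ 0 := by
      rintro rfl
      simp at hv'
    obtain ⟨d', hd'⟩ := hlead v' hv0
    exact ⟨d', not_lt.1 (hmin d' ⟨v', hv', hd'⟩), hd'.1⟩
  choose τ b hb hτ hbmin using hmin
  have hlt : ∀ i j, i < j → τ i ≠ τ j := by
    intro i j hij h
    obtain ⟨k, hk, hk0⟩ := hbmin j
      (b j - (e'.repr (b j) (τ j) / e'.repr (b i) (τ j)) • b i)
      ⟨by simp [(hb j).1, (hb i).2 j hij],
        fun k hk => by simp [(hb j).2 k hk, (hb i).2 k (hij.trans hk)]⟩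
    apply hk0
    rcases hk.eq_or_lt with rfl | hk
    · have := (hτ i).1
      rw [h] at this
      simp [this]
    · simp [(hτ j).2 k hk, (hτ i).2 k (h ▸ hk)]
  have hinj : Function.Injective τ := by
    intro i j h
    rcases lt_trichotomy i j with h1 | h1 | h1
    · exact absurd h (hlt i j h1)
    · exact h1
    · exact absurd h.symm (hlt j i h1)
  exact ⟨b, Equiv.ofBijective τ (Finite.injective_iff_bijective.1 hinj), hb, hτ⟩

/-- Deep enough in a Weyl chamber of the apartment of `e`, the norms are split by any basis which
is triangular with respect to `e` ordered along the chamber. -/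
lemma exists_subchamber {f : Flat n → Es (ultraModel K n)}
    {e : Module.Basis (Fin n) K (Fin n → K)} (hf : IsFlatOf f e) (a : Flat n)
    (σ τ : Equiv.Perm (Fin n)) (b : Module.Basis (Fin n) K (Fin n → K))
    (hb : ∀ j, (e.reindex σ.symm).repr (b j) (τ j) ≠ 0 ∧
      ∀ i, τ j < i → (e.reindex σ.symm).repr (b j) i = 0) :
    ∃ β ∈ weylChamber a σ, ∀ α ∈ weylChamber β σ, IsSplitBy (f α).1 b := by
  set E := e.reindex σ.symm with hE
  obtain ⟨ρ, hρ⟩ := exists_flat_dominant σ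
  -- moving the apex by `R • ρ` makes the leading component of each `b j` dominate the other ones
  obtain ⟨R, hR⟩ : ∃ R : ℝ, 0 ≤ R ∧ ∀ i j,
      Real.log ‖E.repr (b j) i‖ - Real.log ‖E.repr (b j) (τ j)‖
        - (a.1 (σ i) - a.1 (σ (τ j))) ≤ R := by
    obtain ⟨R, hR⟩ := (Set.finite_range fun p : Fin n × Fin n =>
      Real.log ‖E.repr (b p.2) p.1‖ - Real.log ‖E.repr (b p.2) (τ p.2)‖
        - (a.1 (σ p.1) - a.1 (σ (τ p.2)))).bddAbove
    exact ⟨max 0 R, le_max_left _ _, fun i j =>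
      (hR (Set.mem_range_self (i, j))).trans (le_max_right _ _)⟩
  refine ⟨a + R • ρ, ?_, fun α hα => ?_⟩
  · intro i j hij
    rcases hij.eq_or_lt with rfl | hij
    · exact le_rfl
    · have := mul_le_mul_of_nonneg_left (hρ i j hij) hR.1
      simp only [add_sub_cancel_left, Submodule.coe_smul, PiLp.smul_apply, smul_eq_mul]
      linarith [hR.1]
  · have hu := (f α).isUltraNorm
    have hEval : ∀ i, (f α).1 (E i) = Real.exp (-α.1 (σ i)) := by
      intro i
      rw [hE, Module.Basis.reindex_apply, Equiv.symm_symm, hf.apply]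
    have hgap : ∀ i j, i < j → a.1 (σ i) - a.1 (σ j) + R ≤ α.1 (σ i) - α.1 (σ j) := by
      intro i j hij
      have h1 := hα i j hij.le
      have h2 := mul_le_mul_of_nonneg_left (hρ i j hij) hR.1
      simp only [Submodule.coe_sub, Submodule.coe_add, Submodule.coe_smul, PiLp.sub_apply,
        PiLp.add_apply, PiLp.smul_apply, smul_eq_mul] at h1
      linarith
    have hle : ∀ j, (f α).1 (b j) ≤ ‖E.repr (b j) (τ j)‖ * (f α).1 (E (τ j)) := by
      intro j
      refine hu.le_of_repr E _ (mul_nonneg (norm_nonneg _) (hu.nonneg _)) fun i => ?_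
      rcases lt_trichotomy (τ j) i with h | h | h
      · rw [(hb j).2 i h, norm_zero, mul_zero]
        exact mul_nonneg (norm_nonneg _) (hu.nonneg _)
      · rw [h, mul_comm]
      · by_cases h0 : E.repr (b j) i = 0
        · rw [h0, norm_zero, mul_zero]
          exact mul_nonneg (norm_nonneg _) (hu.nonneg _)
        · have p1 := norm_pos_iff.2 h0
          have p2 := norm_pos_iff.2 (hb j).1
          rw [hEval, hEval, ← Real.log_le_log_iff (by positivity) (by positivity),
            Real.log_mul (Real.exp_pos _).ne' p1.ne', Real.log_mul p2.ne' (Real.exp_pos _).ne',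
            Real.log_exp, Real.log_exp]
          linarith [hR.2 i j, hgap i (τ j) h]
    have hsE : IsSplitBy (f α).1 E := (hf.split α).reindex σ.symm
    refine hsE.of_prod_le (f α).2.1 ?_
    rw [norm_basisDet_of_triangular E b τ fun j i h => (hb j).2 i h, mul_assoc]
    refine mul_le_mul_of_nonneg_left ?_ (norm_nonneg _)
    rw [← Equiv.prod_comp τ fun i => (f α).1 (E i), ← Finset.prod_mul_distrib]
    exact Finset.prod_le_prod (fun i _ => hu.nonneg _) fun j _ => hle j

/-- Two Weyl chambers contain subchambers of a common apartment, by the Bruhat decomposition of the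
pair of flags which they define. -/
lemma markedFlats_common_subchambers {f f' : Flat n → Es (ultraModel K n)}
    (hf : f ∈ markedFlats (ultraModel K n)) (hf' : f' ∈ markedFlats (ultraModel K n))
    (a : Flat n) (σ : Equiv.Perm (Fin n)) (a' : Flat n) (σ' : Equiv.Perm (Fin n)) :
    ∃ b ∈ weylChamber a σ, ∃ b' ∈ weylChamber a' σ', ∃ f'' ∈ markedFlats (ultraModel K n),
      f '' weylChamber b σ ⊆ Set.range f'' ∧ f' '' weylChamber b' σ' ⊆ Set.range f'' := by
  obtain ⟨e, he⟩ := exists_isFlatOf hf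
  obtain ⟨e', he'⟩ := exists_isFlatOf hf'
  obtain ⟨b, τ, hb, hb'⟩ := exists_bruhat (e.reindex σ.symm) (e'.reindex σ'.symm)
  have hunit : IsUnit ((e.reindex σ.symm).det b) := by
    have htri : ((e.reindex σ.symm).toMatrix b).BlockTriangular id := fun i j hij =>
      (hb j).2 i hij
    rw [Module.Basis.det_apply, Matrix.det_of_isUpperTriangular htri]
    simp only [Module.Basis.toMatrix_apply, fun j => (hb j).1, Finset.prod_const_one, isUnit_one]
  obtain ⟨hli, hsp⟩ := (e.reindex σ.symm).is_basis_iff_det.2 hunit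
  have hB : ⇑(Module.Basis.mk hli hsp.ge) = b := Module.Basis.coe_mk _ _
  set B := Module.Basis.mk hli hsp.ge
  obtain ⟨β, hβ, h⟩ := exists_subchamber he a σ 1 B fun j => by
    rw [hB]
    exact ⟨by simpa using ne_of_eq_of_ne (hb j).1 one_ne_zero, (hb j).2⟩
  obtain ⟨β', hβ', h'⟩ := exists_subchamber he' a' σ' τ B fun j => by
    rw [hB]
    exact hb' j
  obtain ⟨f'', hf'', hmem⟩ := exists_flat_of_basis B
  refine ⟨β, hβ, β', hβ', f'', hf'', ?_, ?_⟩
  · rintro _ ⟨α, hα, rfl⟩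
    exact hmem _ (h α hα)
  · rintro _ ⟨α, hα, rfl⟩
    exact hmem _ (h' α hα)

/-- If two marked apartments agree on a half-apartment `c ≤ α a - α b`, the transition matrix is,
up to units, an elementary matrix with entry `(a, b)`. -/
lemma repr_of_eq_on_half {f f' : Flat n → Es (ultraModel K n)}
    {e e' : Module.Basis (Fin n) K (Fin n → K)} (he : IsFlatOf f e) (he' : IsFlatOf f' e')
    {a b : Fin n} (hab : a ≠ b) {c : ℝ} (h : ∀ α : Flat n, c ≤ α.1 a - α.1 b → f α = f' α) :
    (∀ j, ‖e.repr (e' j) j‖ = 1) ∧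
      ∀ i j, i ≠ j → ¬ (i = a ∧ j = b) → e.repr (e' j) i = 0 := by
  have hle : ∀ (α : Flat n), c ≤ α.1 a - α.1 b → ∀ i j,
      ‖e.repr (e' j) i‖ ≤ Real.exp (α.1 i - α.1 j) := by
    intro α hα i j
    have h1 := he.split α (e' j) i
    rw [he.apply, h α hα, he'.apply] at h1
    have h2 : Real.exp (-α.1 j) = Real.exp (-α.1 i) * Real.exp (α.1 i - α.1 j) := by
      rw [← Real.exp_add]
      congr 1
      ring
    rw [h2] at h1
    exact le_of_mul_le_mul_left h1 (Real.exp_pos _)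
  have hzero : ∀ i j, i ≠ j → ¬ (i = a ∧ j = b) → e.repr (e' j) i = 0 := by
    intro i j hij hne
    obtain ⟨v, hv1, hv2⟩ := exists_flat_root_pos (i := j) (j := i) (a := a) (b := b) hij.symm hab
      fun h => hne ⟨h.1.symm, h.2.symm⟩
    -- along the ray `t • v` of the half-apartment, the bound `exp (-t)` tends to zero
    have hb : ∀ t : ℝ, max 0 c ≤ t → ‖e.repr (e' j) i‖ ≤ Real.exp (-t) := by
      intro t ht
      have ht0 : 0 ≤ t := (le_max_left _ _).trans ht
      refine (hle (t • v) ?_ i j).trans (Real.exp_le_exp.2 ?_)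
      · have h1 := mul_le_mul_of_nonneg_left hv2 ht0
        simp only [Submodule.coe_smul, PiLp.smul_apply, smul_eq_mul]
        linarith [(le_max_right 0 c).trans ht]
      · have h1 := mul_le_mul_of_nonneg_left hv1 ht0
        simp only [Submodule.coe_smul, PiLp.smul_apply, smul_eq_mul]
        linarith
    have hlim : Tendsto (fun t : ℝ => Real.exp (-t)) atTop (𝓝 0) :=
      Real.tendsto_exp_atBot.comp tendsto_neg_atTop_atBot
    have h0 : ‖e.repr (e' j) i‖ ≤ 0 :=
      ge_of_tendsto hlim ((eventually_ge_atTop (max 0 c)).mono hb)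
    simpa using h0
  refine ⟨fun j => ?_, hzero⟩
  obtain ⟨σ, hσ⟩ := exists_perm_basisDet_le e e'
  obtain ⟨α, hα⟩ := exists_flat_root_eq hab c
  have hs' := he'.split α
  rw [← h α hα.ge] at hs'
  have hk := (he.split α).eq_of_perm (f α).isUltraNorm hs' hσ
  have hσ1 : ∀ k, k ≠ b → σ k = k := by
    intro k hkb
    by_contra hne
    exact (hk k).1 (hzero _ _ hne fun h => hkb h.2)
  have hσ2 : ∀ k, σ k = k := by
    intro k
    by_cases hkb : k = b
    · by_contra hne
      have h1 : σ (σ k) = σ k := hσ1 _ (by rw [← hkb]; exact hne)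
      exact hne (σ.injective h1)
    · exact hσ1 k hkb
  have h1 := (hk j).2
  rw [hσ2 j, he.apply, h α hα.ge, he'.apply] at h1
  have h2 := (Real.exp_pos (-α.1 j)).ne'
  field_simp at h1
  exact h1.symm

/-- If `e'` has determinant one and the entries of the transition matrix are bounded by the
exponentials of the roots at `α`, then `f α` is split by `e'`. -/
lemma split_of_norm_le_exp {f : Flat n → Es (ultraModel K n)}
    {e e' : Module.Basis (Fin n) K (Fin n → K)} (he : IsFlatOf f e) (hdet : basisDet e' = 1)
    {α : Flat n} (h : ∀ i j, ‖e.repr (e' j) i‖ ≤ Real.exp (α.1 i - α.1 j)) :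
    IsSplitBy (f α).1 e' := by
  refine (he.split α).of_prod_le (f α).2.1 ?_
  rw [he.det, hdet]
  refine mul_le_mul_of_nonneg_left ?_ (norm_nonneg _)
  refine Finset.prod_le_prod (fun j _ => (f α).isUltraNorm.nonneg _) fun j _ => ?_
  refine (f α).isUltraNorm.le_of_repr e _ ((f α).isUltraNorm.nonneg _) fun i => ?_
  rw [he.apply, he.apply]
  calc Real.exp (-α.1 i) * ‖e.repr (e' j) i‖
      ≤ Real.exp (-α.1 i) * Real.exp (α.1 i - α.1 j) := by
        exact mul_le_mul_of_nonneg_left (h i j) (Real.exp_pos _).le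
    _ = Real.exp (-α.1 j) := by
      rw [← Real.exp_add]
      congr 1
      ring

/-- Three apartments meeting pairwise have a common point if `f'` and `f''` agree with `f` on
opposite half-apartments. With `p` and `q` the off-diagonal entries of the two transition matrices, a common point of `f'` and
`f''` forces `|p q| ≤ 1`, and then `f` meets both at a point determined by `|p|` and `|q|`. -/
lemma tripod_of_eq_on_half {f f' f'' : Flat n → Es (ultraModel K n)}
    (hf : f ∈ markedFlats (ultraModel K n)) (hf' : f' ∈ markedFlats (ultraModel K n))
    (hf'' : f'' ∈ markedFlats (ultraModel K n)) {a b : Fin n} (hab : a ≠ b) {c c' : ℝ}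
    (h' : ∀ α : Flat n, c ≤ α.1 a - α.1 b → f α = f' α)
    (h'' : ∀ α : Flat n, c' ≤ α.1 b - α.1 a → f α = f'' α) {x : Es (ultraModel K n)}
    (hx' : x ∈ Set.range f') (hx'' : x ∈ Set.range f'') :
    (Set.range f ∩ Set.range f' ∩ Set.range f'').Nonempty := by
  obtain ⟨e, he⟩ := exists_isFlatOf hf
  obtain ⟨e', he'⟩ := exists_isFlatOf hf'
  obtain ⟨e'', he''⟩ := exists_isFlatOf hf''
  obtain ⟨hp1, hp0⟩ := repr_of_eq_on_half he he' hab h'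
  obtain ⟨hq1, hq0⟩ := repr_of_eq_on_half he he'' hab.symm h''
  set p := e.repr (e' b) a with hp
  set q := e.repr (e'' a) b with hq
  have hpne : ∀ j, e.repr (e' j) j ≠ 0 := fun j h0 => by simpa [h0] using hp1 j
  have hexp' : ∀ j, j ≠ b → e j = (e.repr (e' j) j)⁻¹ • e' j := by
    intro j hj
    have : e' j = e.repr (e' j) j • e j := by
      conv_lhs => rw [← e.sum_repr (e' j)]
      refine Finset.sum_eq_single j (fun i _ hij => ?_) (by simp)
      rw [hp0 i j hij fun h => hj h.2, zero_smul]
    conv_rhs => rw [this]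
    rw [e.repr.map_smul, Finsupp.smul_apply, e.repr_self, Finsupp.single_eq_same, smul_eq_mul,
      mul_one, smul_smul, inv_mul_cancel₀ (hpne j), one_smul]
  have hexpb : e b = (e.repr (e' b) b)⁻¹ • (e' b - p • e a) := by
    have : e' b = e.repr (e' b) b • e b + p • e a := by
      conv_lhs => rw [← e.sum_repr (e' b)]
      refine Finset.sum_eq_add b a hab.symm (fun i _ hi => ?_) (by simp) (by simp)
      rw [hp0 i b hi.1 fun h => hi.2 h.1, zero_smul]
    rw [← eq_sub_of_add_eq this.symm, smul_smul, inv_mul_cancel₀ (hpne b), one_smul]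
  have hexp'' : ∀ j, j ≠ a → e'' j = e.repr (e'' j) j • e j := by
    intro j hj
    conv_lhs => rw [← e.sum_repr (e'' j)]
    refine Finset.sum_eq_single j (fun i _ hij => ?_) (by simp)
    rw [hq0 i j hij fun h => hj h.2, zero_smul]
  have hexpa : e'' a = e.repr (e'' a) a • e a + q • e b := by
    conv_lhs => rw [← e.sum_repr (e'' a)]
    refine Finset.sum_eq_add a b hab (fun i _ hi => ?_) (by simp) (by simp)
    rw [hq0 i a hi.1 fun h => hi.2 h.1, zero_smul]
  -- the diagonal entries of the transition matrix from `e'` to `e''`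
  have hrj : ∀ j, j ≠ a ∧ j ≠ b → ‖e'.repr (e'' j) j‖ = 1 := by
    rintro j ⟨hja, hjb⟩
    rw [hexp'' j hja, hexp' j hjb]
    simp [hp1 j, hq1 j]
  have hrb : ‖e'.repr (e'' b) b‖ = 1 := by
    rw [hexp'' b hab.symm, hexpb, hexp' a hab]
    simp [hab.symm, hp1 b, hq1 b]
  have hra : e'.repr (e'' a) a = e.repr (e'' a) a * (e.repr (e' a) a)⁻¹
      - q * p * ((e.repr (e' b) b)⁻¹ * (e.repr (e' a) a)⁻¹) := by
    conv_lhs => rw [hexpa, hexpb, hexp' a hab]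
    simp [hab]
    ring
  have hprod : ∏ j, ‖e'.repr (e'' j) j‖ ≤ 1 := by
    obtain ⟨β, rfl⟩ := hx'
    obtain ⟨γ, hγ⟩ := hx''
    have h1 : ∏ j, ‖e'.repr (e'' j) j‖ * (f' β).1 (e' j) ≤ ∏ j, (f' β).1 (e'' j) := by
      refine Finset.prod_le_prod (fun j _ => mul_nonneg (norm_nonneg _)
        ((f' β).isUltraNorm.nonneg _)) fun j _ => ?_
      rw [mul_comm]
      exact he'.split β _ _
    rw [Finset.prod_mul_distrib, he'.prod_apply, ← hγ, he''.prod_apply, mul_one] at h1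
    exact h1
  rw [Finset.prod_eq_mul a b hab (fun j _ hj => hrj j hj) (by simp) (by simp), hrb,
    mul_one] at hprod
  -- the entry at `(a, a)` is a unit minus a unit times `p * q`
  have hpq : ‖p‖ * ‖q‖ ≤ 1 := by
    by_contra! hgt
    have h1 : ‖e.repr (e'' a) a * (e.repr (e' a) a)⁻¹‖ = 1 := by simp [hp1 a, hq1 a]
    have h2 : ‖q * p * ((e.repr (e' b) b)⁻¹ * (e.repr (e' a) a)⁻¹)‖ = ‖p‖ * ‖q‖ := by
      simp [hp1 a, hp1 b, mul_comm]
    have h3 := IsUltrametricDist.norm_add_le_max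
      (e.repr (e'' a) a * (e.repr (e' a) a)⁻¹) (-e'.repr (e'' a) a)
    rw [norm_neg, ← sub_eq_add_neg, h1, hra, sub_sub_cancel, h2, ← hra] at h3
    exact (h3.trans (max_le le_rfl hprod)).not_gt hgt
  obtain ⟨t, ht1, ht2⟩ : ∃ t : ℝ, ‖p‖ ≤ Real.exp t ∧ ‖q‖ ≤ Real.exp (-t) := by
    by_cases hp : p = 0
    · by_cases hq : q = 0
      · exact ⟨0, by simp [hp], by simp [hq]⟩
      · refine ⟨-Real.log ‖q‖, by simp [hp, (Real.exp_pos _).le], ?_⟩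
        rw [neg_neg, Real.exp_log (norm_pos_iff.2 hq)]
    · have h0 := norm_pos_iff.2 hp
      refine ⟨Real.log ‖p‖, (Real.exp_log h0).ge, ?_⟩
      rw [Real.exp_neg, Real.exp_log h0, ← one_div, le_div_iff₀ h0, mul_comm]
      exact hpq
  obtain ⟨α, hα⟩ := exists_flat_root_eq hab t
  refine ⟨f α, ⟨⟨α, rfl⟩, ?_⟩, ?_⟩
  · rw [he'.mem_range]
    refine split_of_norm_le_exp he he'.det fun i j => ?_
    by_cases hij : i = j
    · rw [hij, hp1, sub_self, Real.exp_zero]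
    · by_cases hc : i = a ∧ j = b
      · rw [hc.1, hc.2, hα]
        exact ht1
      · rw [hp0 i j hij hc, norm_zero]
        exact (Real.exp_pos _).le
  · rw [he''.mem_range]
    refine split_of_norm_le_exp he he''.det fun i j => ?_
    by_cases hij : i = j
    · rw [hij, hq1, sub_self, Real.exp_zero]
    · by_cases hc : i = b ∧ j = a
      · rw [hc.1, hc.2, ← neg_sub, hα]
        exact ht2
      · rw [hq0 i j hij hc, norm_zero]
        exact (Real.exp_pos _).le

/-- Three apartments meeting pairwise in half-apartments have a common point. Two half-apartments of
`f` which are not opposite meet already; otherwise `f'` and `f''` are precomposed with elements of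
the affine Weyl group so as to agree with `f` there. -/
lemma markedFlats_tripod {f f' f'' : Flat n → Es (ultraModel K n)}
    (hf : f ∈ markedFlats (ultraModel K n)) (hf' : f' ∈ markedFlats (ultraModel K n))
    (hf'' : f'' ∈ markedFlats (ultraModel K n)) (h1 : IsHalfFlat (f ⁻¹' Set.range f'))
    (h2 : IsHalfFlat (f ⁻¹' Set.range f'')) (h3 : IsHalfFlat (f' ⁻¹' Set.range f'')) :
    (Set.range f ∩ Set.range f' ∩ Set.range f'').Nonempty := by
  obtain ⟨a, b, c, hab, h1⟩ := h1
  obtain ⟨a', b', c', hab', h2⟩ := h2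
  obtain ⟨k, l, d, hkl, h3⟩ := h3
  by_cases hopp : a' = b ∧ b' = a
  · obtain ⟨rfl, rfl⟩ := hopp
    obtain ⟨w, hw, hwf⟩ := markedFlats_compatible hf hf'
    obtain ⟨w', hw', hwf'⟩ := markedFlats_compatible hf hf''
    have hr : Set.range (f' ∘ w) = Set.range f' := (affineWeyl_surjective hw).range_comp f'
    have hr' : Set.range (f'' ∘ w') = Set.range f'' := (affineWeyl_surjective hw').range_comp f''
    obtain ⟨γ, hγ⟩ := exists_flat_root_eq hkl d
    have hmem : γ ∈ f' ⁻¹' Set.range f'' := by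
      rw [h3]
      exact hγ.ge
    rw [← hr, ← hr']
    refine tripod_of_eq_on_half hf (markedFlats_comp_mem hf' hw) (markedFlats_comp_mem hf'' hw')
      hab (c := c) (c' := c') (fun α hα => hwf α ?_) (fun α hα => hwf' α ?_) (x := f' γ) ?_ ?_
    · rw [h1]
      exact hα
    · rw [h2]
      exact hα
    · rw [hr]
      exact ⟨γ, rfl⟩
    · rw [hr']
      exact hmem
  · obtain ⟨v, hv1, hv2⟩ := exists_flat_root_pos (i := a) (j := b) hab hab' hopp
    have h0 : 0 ≤ max 0 (max c c') := le_max_left _ _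
    have hc : c ≤ max 0 (max c c') := (le_max_left _ _).trans (le_max_right _ _)
    have hc' : c' ≤ max 0 (max c c') := (le_max_right _ _).trans (le_max_right _ _)
    refine ⟨f (max 0 (max c c') • v), ⟨⟨_, rfl⟩, ?_⟩, ?_⟩
    · have : max 0 (max c c') • v ∈ f ⁻¹' Set.range f' := by
        rw [h1]
        have := mul_le_mul_of_nonneg_left hv1 h0
        change c ≤ max 0 (max c c') * v.1 a - max 0 (max c c') * v.1 b
        linarith
      exact this
    · have : max 0 (max c c') • v ∈ f ⁻¹' Set.range f'' := by
        rw [h2]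
        have := mul_le_mul_of_nonneg_left hv2 h0
        change c' ≤ max 0 (max c c') * v.1 a' - max 0 (max c c') * v.1 b'
        linarith
      exact this

/-- The space of good ultrametric norms of volume one is an affine building. -/
theorem isAffineBuilding_ultraModel (K : Type*) [NormedField K] [IsUltrametricDist K] (n : ℕ) :
    IsAffineBuilding (affineWeyl K n) (markedFlats (ultraModel K n)) where
  injective _ hf := markedFlat_injective hf
  comp_mem _ hf _ hw := markedFlats_comp_mem hf hw
  closed_convex _ hf _ hf' := markedFlats_isClosed_convex hf hf'
  compatible _ hf _ hf' := markedFlats_compatible hf hf'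
  common_apartment x y := by
    have hM := ultraModel_isRegular K n
    obtain ⟨e, he, hx, hy⟩ := exists_common_det_one hM x.2.1 y.2.1
    have h : IsFlatOf (flatMap hM e he) e :=
      ⟨he, fun α => ⟨flatMap_adapted hM e he α, flatMap_apply hM e he α⟩⟩
    exact ⟨_, h.mem, (mem_range_iff hM he h.adapted x).2 hx,
      (mem_range_iff hM he h.adapted y).2 hy⟩
  common_subchambers _ hf _ hf' a σ a' σ' := markedFlats_common_subchambers hf hf' a σ a' σ'
  tripod _ hf _ hf' _ hf'' h1 h2 h3 := markedFlats_tripod hf hf' hf'' h1 h2 h3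

/-- The axioms of affine buildings are invariant under isomorphism. -/
lemma IsAffineBuilding.of_iso {W : Set (Flat n → Flat n)} {X Y : Type*} {A : Set (Flat n → X)}
    {B : Set (Flat n → Y)} {φ : X → Y} (hφ : IsBuildingIso A B φ) (hB : IsAffineBuilding W B) :
    IsAffineBuilding W A := by
  obtain ⟨⟨hinj, hsurj⟩, hA⟩ := hφ
  have hpre : ∀ f f' : Flat n → X, (φ ∘ f) ⁻¹' Set.range (φ ∘ f') = f ⁻¹' Set.range f' := by
    intro f f'
    ext α
    simp only [Set.mem_preimage, Set.mem_range, Function.comp_apply, hinj.eq_iff]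
  have hlift : ∀ g ∈ B, ∃ f ∈ A, φ ∘ f = g := by
    intro g hg
    have h : φ ∘ (fun α => Function.surjInv hsurj (g α)) = g :=
      funext fun α => Function.surjInv_eq hsurj (g α)
    exact ⟨_, (hA _).2 (by rw [h]; exact hg), h⟩
  have hrange : ∀ (f : Flat n → X) x, φ x ∈ Set.range (φ ∘ f) ↔ x ∈ Set.range f := by
    intro f x
    simp only [Set.mem_range, Function.comp_apply, hinj.eq_iff]
  refine ⟨fun f hf => ?_, fun f hf w hw => ?_, fun f hf f' hf' => ?_, fun f hf f' hf' => ?_,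
    fun x y => ?_, fun f hf f' hf' a σ a' σ' => ?_, fun f hf f' hf' f'' hf'' h1 h2 h3 => ?_⟩
  · exact (hB.injective _ ((hA f).1 hf)).of_comp
  · exact (hA _).2 (hB.comp_mem _ ((hA f).1 hf) w hw)
  · rw [← hpre]
    exact hB.closed_convex _ ((hA f).1 hf) _ ((hA f').1 hf')
  · obtain ⟨w, hw, h⟩ := hB.compatible _ ((hA f).1 hf) _ ((hA f').1 hf')
    rw [hpre] at h
    exact ⟨w, hw, fun α hα => hinj (h α hα)⟩
  · obtain ⟨g, hg, hx, hy⟩ := hB.common_apartment (φ x) (φ y)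
    obtain ⟨f, hf, rfl⟩ := hlift g hg
    exact ⟨f, hf, (hrange f x).1 hx, (hrange f y).1 hy⟩
  · obtain ⟨b, hb, b', hb', g, hg, h1, h2⟩ :=
      hB.common_subchambers _ ((hA f).1 hf) _ ((hA f').1 hf') a σ a' σ'
    obtain ⟨f'', hf'', rfl⟩ := hlift g hg
    refine ⟨b, hb, b', hb', f'', hf'', ?_, ?_⟩
    · rintro _ ⟨α, hα, rfl⟩
      exact (hrange f'' _).1 (h1 ⟨α, hα, rfl⟩)
    · rintro _ ⟨α, hα, rfl⟩
      exact (hrange f'' _).1 (h2 ⟨α, hα, rfl⟩)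
  · rw [← hpre] at h1 h2 h3
    obtain ⟨y, ⟨⟨α, hα⟩, h4⟩, h5⟩ := hB.tripod _ ((hA f).1 hf) _ ((hA f').1 hf') _
      ((hA f'').1 hf'') h1 h2 h3
    obtain rfl := hα
    exact ⟨f α, ⟨⟨α, rfl⟩, (hrange f' _).1 h4⟩, (hrange f'' _).1 h5⟩

end Axioms

/-! ### Limits of roots along the ultrafilter -/

section Roots

variable (S : Scale)

lemma Scale.root_exp (k : ℕ) (x : ℝ) : S.root k (Real.exp x) = Real.exp (x / S.lam k) := by
  rw [Scale.root, ← Real.exp_mul, div_eq_mul_inv]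

lemma Scale.root_exp_mul_lam (k : ℕ) (x : ℝ) : S.root k (Real.exp (x * S.lam k)) = Real.exp x := by
  rw [S.root_exp, mul_div_cancel_right₀ _ (S.lam_pos k).ne']

lemma Scale.log_root (k : ℕ) {x : ℝ} (hx : 0 < x) :
    Real.log (S.root k x) = Real.log x / S.lam k := by
  rw [Scale.root, Real.log_rpow hx, div_eq_inv_mul]

lemma Scale.root_div (k : ℕ) {x y : ℝ} (hx : 0 ≤ x) (hy : 0 ≤ y) :
    S.root k (x / y) = S.root k x / S.root k y := Real.div_rpow hx hy _

lemma Scale.root_prod (k : ℕ) {ι : Type*} (s : Finset ι) (f : ι → ℝ) (hf : ∀ i ∈ s, 0 ≤ f i) :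
    S.root k (∏ i ∈ s, f i) = ∏ i ∈ s, S.root k (f i) :=
  (Real.finsetProd_rpow s f hf _).symm

lemma Scale.le_exp_of_root_le {k : ℕ} {x D : ℝ} (h : S.root k x ≤ Real.exp D) :
    x ≤ Real.exp (D * S.lam k) := by
  by_contra! hlt
  have := Real.rpow_lt_rpow (Real.exp_pos _).le hlt (inv_pos.2 (S.lam_pos k))
  change S.root k _ < S.root k _ at this
  rw [S.root_exp_mul_lam] at this
  exact this.not_ge h

lemma Scale.tendsto_root_const {c : ℝ} (hc : 0 < c) :
    Tendsto (fun k => S.root k c) S.ω (𝓝 1) := by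
  have h : Tendsto (fun k => (S.lam k)⁻¹) S.ω (𝓝 0) :=
    (tendsto_inv_atTop_zero.comp S.tendsto_lam).mono_left
      (S.le_cofinite.trans Nat.cofinite_eq_atTop.le)
  have := (Real.continuous_const_rpow (a := c) hc.ne').tendsto 0 |>.comp h
  simpa [Scale.root, Function.comp_def] using this

lemma tendsto_iSup_fin {α : Type*} {l : Filter α} {n : ℕ} {c : α → Fin n → ℝ} {r : Fin n → ℝ}
    (h : ∀ i, Tendsto (fun k => c k i) l (𝓝 (r i))) :
    Tendsto (fun k => ⨆ i, c k i) l (𝓝 (⨆ i, r i)) := by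
  rcases n with _ | n
  · simpa using tendsto_const_nhds
  · have := Filter.Tendsto.finset_sup'_nhds_apply (s := Finset.univ)
      (Finset.univ_nonempty (α := Fin (n + 1))) (f := fun i k => c k i) fun i _ => h i
    simpa only [Finset.sup'_univ_eq_ciSup] using this

/-- In the limit, the aggregating function (the `ℓ²`-norm or the maximum) becomes the maximum:
this is why a limit of euclidean norms is ultrametric. -/
lemma tendsto_root_agg {K : Type*} [NormedField K] {n : ℕ} {M : NormModel K n} (hM : M.IsRegular)
    {c : ℕ → Fin n → ℝ} (hc : ∀ k i, 0 ≤ c k i) {r : Fin n → ℝ}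
    (h : ∀ i, Tendsto (fun k => S.root k (c k i)) S.ω (𝓝 (r i))) :
    Tendsto (fun k => S.root k (M.agg (c k))) S.ω (𝓝 (⨆ i, r i)) := by
  rcases n with _ | n
  · have h0 : ∀ d : Fin 0 → ℝ, M.agg d = 0 := by
      intro d
      have := hM.smul 0 d le_rfl
      rw [zero_mul] at this
      rw [← this]
      congr 1
      exact Subsingleton.elim _ _
    simp [h0, S.root_zero]
  · have h1 := tendsto_iSup_fin h
    have h2 := (S.tendsto_root_const (c := ((n + 1 : ℕ) : ℝ)) (by positivity)).mul h1
    rw [one_mul] at h2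
    refine tendsto_of_tendsto_of_tendsto_of_le_of_le h1 h2 (fun k => ?_) (fun k => ?_)
    · exact ciSup_le fun i => S.root_mono k (hc k i) (M.le_agg _ (hc k) i)
    · obtain ⟨i, -, hi⟩ := Finset.exists_max_image Finset.univ (c k) ⟨0, Finset.mem_univ _⟩
      have h3 : M.agg (c k) ≤ ((n + 1 : ℕ) : ℝ) * c k i := by
        refine (M.agg_le _ (hc k)).trans ((Finset.sum_le_sum fun j hj => hi j hj).trans ?_)
        simp
      have h4 : 0 ≤ M.agg (c k) := (hc k 0).trans (M.le_agg _ (hc k) 0)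
      refine (S.root_mono k h4 h3).trans ?_
      rw [S.root_mul k (by positivity) (hc k i)]
      refine mul_le_mul_of_nonneg_left ?_ (S.root_nonneg k (by positivity))
      exact le_ciSup (f := fun i => S.root k (c k i)) (Set.finite_range _).bddAbove i

end Roots

/-! ### Bounded sequences of vectors and of matrices -/

section BoundedSeq

variable (S : Scale) (K : Type*) [NormedField K]

/-- Evaluation of a bounded sequence at the index `k`. -/
def evalSeq (k : ℕ) : boundedSeq S K →+* K :=
  (Pi.evalRingHom (fun _ : ℕ => K) k).comp (boundedSeq S K).subtype

variable {S K}

lemma evalSeq_apply (k : ℕ) (a : boundedSeq S K) : evalSeq S K k a = a.1 k := rfl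

lemma tendsto_norm_mk (a : boundedSeq S K) :
    Tendsto (fun k => S.root k ‖a.1 k‖) S.ω (𝓝 ‖FieldCone.mk S K a‖) := tendsto_seqAbs a

lemma mem_boundedSeq_of_eventuallyEq {f : ℕ → K} {b : boundedSeq S K}
    (h : ∀ᶠ k in S.ω, f k = b.1 k) : f ∈ boundedSeq S K := by
  obtain ⟨C, hC⟩ := b.2
  refine ⟨C, ?_⟩
  filter_upwards [h, hC] with k h1 h2
  rw [h1]
  exact h2

lemma mk_eq_of_eventuallyEq {a b : boundedSeq S K} (h : ∀ᶠ k in S.ω, a.1 k = b.1 k) :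
    FieldCone.mk S K a = FieldCone.mk S K b := by
  rw [FieldCone.mk_eq_mk]
  refine seqAbs_eq (tendsto_const_nhds.congr' ?_)
  filter_upwards [h] with k hk
  change 0 = S.root k ‖a.1 k - b.1 k‖
  rw [hk, sub_self, norm_zero, S.root_zero]

/-- The inverse of a bounded sequence bounded away from zero. -/
lemma inv_mem_boundedSeq {a : ℕ → K} {c : ℝ} (hc : 0 < c)
    (h : ∀ᶠ k in S.ω, c ≤ S.root k ‖a k‖) : (fun k => (a k)⁻¹) ∈ boundedSeq S K := by
  refine ⟨c⁻¹, h.mono fun k hk => ?_⟩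
  rw [norm_inv, S.root_inv k (norm_nonneg _)]
  exact inv_anti₀ hc hk

lemma isUnit_boundedSeq {a : boundedSeq S K} (h0 : ∀ k, a.1 k ≠ 0) {c : ℝ} (hc : 0 < c)
    (h : ∀ᶠ k in S.ω, c ≤ S.root k ‖a.1 k‖) : IsUnit a := by
  refine IsUnit.of_mul_eq_one ⟨_, inv_mem_boundedSeq hc h⟩ ?_
  apply Subtype.ext
  funext k
  exact mul_inv_cancel₀ (h0 k)

variable {n : ℕ}

lemma det_map_ne_zero {R F : Type*} [CommRing R] [Field F] (f : R →+* F)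
    {A : Matrix (Fin n) (Fin n) R} (hA : IsUnit A.det) : (A.map f).det ≠ 0 := by
  have h := (hA.map f).ne_zero
  rw [RingHom.map_det] at h
  exact h

/-- The bases of `K ^ n` formed, for each index `k`, by the columns of an invertible matrix of
bounded sequences. -/
def seqBasis (A : Matrix (Fin n) (Fin n) (boundedSeq S K)) (hA : IsUnit A.det) (k : ℕ) :
    Module.Basis (Fin n) K (Fin n → K) :=
  colBasis (A.map (evalSeq S K k)) (det_map_ne_zero _ hA)

/-- The basis of `K_ω ^ n` formed by the columns of an invertible matrix of bounded sequences. -/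
def limBasis (A : Matrix (Fin n) (Fin n) (boundedSeq S K)) (hA : IsUnit A.det) :
    Module.Basis (Fin n) (FieldCone S K) (Fin n → FieldCone S K) :=
  colBasis (A.map (FieldCone.mk S K)) (det_map_ne_zero _ hA)

variable (A : Matrix (Fin n) (Fin n) (boundedSeq S K)) (hA : IsUnit A.det)

lemma seqBasis_apply (k : ℕ) (i j : Fin n) : seqBasis A hA k j i = (A i j).1 k :=
  colBasis_apply _ _ i j

lemma limBasis_apply (i j : Fin n) : limBasis A hA j i = FieldCone.mk S K (A i j) :=
  colBasis_apply _ _ i j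

lemma basisDet_seqBasis (k : ℕ) : basisDet (seqBasis A hA k) = A.det.1 k := by
  rw [seqBasis, basisDet_colBasis, ← evalSeq_apply, RingHom.map_det]
  rfl

lemma basisDet_limBasis : basisDet (limBasis A hA) = FieldCone.mk S K A.det := by
  rw [limBasis, basisDet_colBasis, RingHom.map_det]
  rfl

/-- The coordinates of a bounded sequence of vectors in an invertible matrix of bounded sequences are
bounded, and their classes are the coordinates of the limit. -/
lemma exists_coord (a : Fin n → boundedSeq S K) :
    ∃ t : Fin n → boundedSeq S K,
      (∀ k j, (seqBasis A hA k).repr (fun i => (a i).1 k) j = (t j).1 k) ∧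
      ∀ j, (limBasis A hA).repr (fun i => FieldCone.mk S K (a i)) j = FieldCone.mk S K (t j) := by
  have ht : A.mulVec (A⁻¹.mulVec a) = a := by
    rw [Matrix.mulVec_mulVec, Matrix.mul_nonsing_inv _ hA, Matrix.one_mulVec]
  set t := A⁻¹.mulVec a
  refine ⟨t, fun k j => ?_, fun j => ?_⟩
  · have h : (fun i => (a i).1 k) = ∑ j, (t j).1 k • seqBasis A hA k j := by
      funext i
      rw [Finset.sum_apply, ← ht]
      simp only [Pi.smul_apply, smul_eq_mul, seqBasis_apply, Matrix.mulVec, dotProduct,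
        ← evalSeq_apply, map_sum, map_mul]
      exact Finset.sum_congr rfl fun j _ => mul_comm _ _
    rw [h, Module.Basis.repr_sum_self]
  · have h : (fun i => FieldCone.mk S K (a i)) =
        ∑ j, FieldCone.mk S K (t j) • limBasis A hA j := by
      funext i
      rw [Finset.sum_apply, ← ht]
      simp only [Pi.smul_apply, smul_eq_mul, limBasis_apply, Matrix.mulVec, dotProduct,
        map_sum, map_mul]
      exact Finset.sum_congr rfl fun j _ => mul_comm _ _
    rw [h, Module.Basis.repr_sum_self]

end BoundedSeq

/-! ### The limit norm -/

section LimitNorm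

variable {K : Type*} [NormedField K] {n : ℕ} {M : NormModel K n} {S : Scale}

/-- A sequence of norms is bounded if and only if it is comparable to the canonical norm, up to
factors `exp (C * lam k)`. -/
lemma isBoundedSeq_iff (hM : M.IsRegular) (x : ℕ → Es M) :
    IsBoundedSeq M S x ↔ ∃ C : ℝ, ∀ᶠ k in S.ω, ∀ v,
      (x k).1 v ≤ Real.exp (C * S.lam k) * canonicalNorm M v ∧
      canonicalNorm M v ≤ Real.exp (C * S.lam k) * (x k).1 v := by
  have h0 := isGood_canonicalNorm hM
  constructor
  · rintro ⟨C, hC⟩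
    refine ⟨C, hC.mono fun k hk v => ?_⟩
    rw [div_le_iff₀ (S.lam_pos k)] at hk
    have h := le_exp_dist_mul hM h0 (x k).2.1 v
    exact ⟨h.1.trans (mul_le_mul_of_nonneg_right (Real.exp_le_exp.2 hk) (isGood_nonneg hM h0 v)),
      h.2.trans (mul_le_mul_of_nonneg_right (Real.exp_le_exp.2 hk)
        (isGood_nonneg hM (x k).2.1 v))⟩
  · rintro ⟨C, hC⟩
    refine ⟨n * C, hC.mono fun k hk => ?_⟩
    rw [div_le_iff₀ (S.lam_pos k), mul_assoc]
    exact dist_le_of_le_exp hM h0 (x k).2.1 (fun v => (hk v).1) fun v => (hk v).2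

/-- Along a bounded sequence of norms, the limit of the values at a bounded sequence of vectors
exists, and it is positive if the class of the vectors is nonzero. -/
lemma exists_tendsto_root (hM : M.IsRegular) {x : ℕ → Es M} (hx : IsBoundedSeq M S x)
    (a : Fin n → boundedSeq S K) :
    ∃ l, 0 ≤ l ∧ Tendsto (fun k => S.root k ((x k).1 fun i => (a i).1 k)) S.ω (𝓝 l) ∧
      ∀ i, FieldCone.mk S K (a i) ≠ 0 → 0 < l := by
  obtain ⟨C, hC⟩ := (isBoundedSeq_iff hM x).1 hx
  have hnn : ∀ k v, 0 ≤ (x k).1 v := fun k => isGood_nonneg hM (x k).2.1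
  have hsum : Tendsto (fun k => Real.exp C * ∑ i, S.root k ‖(a i).1 k‖) S.ω
      (𝓝 (Real.exp C * ∑ i, ‖FieldCone.mk S K (a i)‖)) :=
    (tendsto_finsetSum _ fun i _ => tendsto_norm_mk (a i)).const_mul _
  have hle : ∀ᶠ k in S.ω, S.root k ((x k).1 fun i => (a i).1 k) ≤
      Real.exp C * ∑ i, S.root k ‖(a i).1 k‖ := by
    filter_upwards [hC] with k hk
    refine (S.root_mono k (hnn _ _) (hk _).1).trans ?_
    rw [S.root_mul k (Real.exp_pos _).le (isGood_nonneg hM (isGood_canonicalNorm hM) _),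
      S.root_exp_mul_lam]
    refine mul_le_mul_of_nonneg_left ?_ (Real.exp_pos _).le
    refine (S.root_mono k (isGood_nonneg hM (isGood_canonicalNorm hM) _)
      (canonicalNorm_le_sum M _)).trans ?_
    exact S.root_sum_le k _ _ fun i => norm_nonneg _
  have hbd : ∀ᶠ k in S.ω, S.root k ((x k).1 fun i => (a i).1 k) ≤
      Real.exp C * ∑ i, ‖FieldCone.mk S K (a i)‖ + 1 := by
    filter_upwards [hle, hsum.eventually (gt_mem_nhds (lt_add_one _))] with k h1 h2
    exact h1.trans h2.le
  obtain ⟨l, hl0, hl⟩ := S.exists_tendsto (fun k => S.root_nonneg k (hnn _ _)) hbd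
  refine ⟨l, hl0, hl, fun i hi => ?_⟩
  have hge : ‖FieldCone.mk S K (a i)‖ ≤ Real.exp C * l := by
    refine le_of_tendsto_of_tendsto (tendsto_norm_mk (a i)) (hl.const_mul (Real.exp C)) ?_
    filter_upwards [hC] with k hk
    rw [← S.root_exp_mul_lam k C, ← S.root_mul k (Real.exp_pos _).le (hnn _ _)]
    exact S.root_mono k (norm_nonneg _) ((norm_le_canonicalNorm M (fun i => (a i).1 k) i).trans
      (hk _).2)
  exact pos_of_mul_pos_right ((norm_pos_iff.2 hi).trans_le hge) (Real.exp_pos _).le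

/-- Rescaling a basis so that every vector has maximal coordinate of absolute value one. -/
lemma exists_normalized (e : Module.Basis (Fin n) K (Fin n → K)) :
    ∃ c : Fin n → Kˣ, ∀ j, (∀ i, ‖e.unitsSMul c j i‖ ≤ 1) ∧ ∃ i, ‖e.unitsSMul c j i‖ = 1 := by
  have h : ∀ j, ∃ u : Kˣ, (∀ i, ‖(u : K) * e j i‖ ≤ 1) ∧ ∃ i, ‖(u : K) * e j i‖ = 1 := by
    intro j
    obtain ⟨i, -, hi⟩ := Finset.exists_max_image Finset.univ (fun i => ‖e j i‖)
      ⟨j, Finset.mem_univ _⟩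
    have h0 : e j i ≠ 0 := by
      intro h0
      refine e.ne_zero j (funext fun i' => ?_)
      have := hi i' (Finset.mem_univ _)
      rw [h0, norm_zero] at this
      simpa using this
    have h1 := norm_pos_iff.2 h0
    refine ⟨(Units.mk0 _ h0)⁻¹, fun i' => ?_, i, ?_⟩
    · rw [Units.val_inv_eq_inv_val, Units.val_mk0, norm_mul, norm_inv, inv_mul_le_iff₀ h1, mul_one]
      exact hi i' (Finset.mem_univ _)
    · rw [Units.val_inv_eq_inv_val, Units.val_mk0, inv_mul_cancel₀ h0, norm_one]
  choose c hc using h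
  refine ⟨c, fun j => ?_⟩
  have : ∀ i, e.unitsSMul c j i = (c j : K) * e j i := fun i => by
    rw [Module.Basis.unitsSMul_apply]
    rfl
  simpa only [this] using hc j

/-- Two bounded sequences of norms are adapted to a common sequence of bases which is bounded with
bounded inverse. After normalising the vectors of common adapted bases, the determinant is bounded
below because the norms have volume one and are comparable to the canonical norm. -/
lemma exists_common_seqBasis (hM : M.IsRegular) {x y : ℕ → Es M} (hx : IsBoundedSeq M S x) :
    ∃ (A : Matrix (Fin n) (Fin n) (boundedSeq S K)) (hA : IsUnit A.det),
      ∀ k, IsAdapted M.agg (x k) (seqBasis A hA k) ∧ IsAdapted M.agg (y k) (seqBasis A hA k) := by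
  have h : ∀ k, ∃ e : Module.Basis (Fin n) K (Fin n → K), (IsAdapted M.agg (x k) e ∧
      IsAdapted M.agg (y k) e) ∧ ∀ j, (∀ i, ‖e j i‖ ≤ 1) ∧ ∃ i, ‖e j i‖ = 1 := by
    intro k
    obtain ⟨e, he, he'⟩ := hM.common_basis _ _ (x k).2.1 (y k).2.1
    obtain ⟨c, hc⟩ := exists_normalized e
    exact ⟨_, ⟨isAdapted_unitsSMul hM (x k).2.1 he c, isAdapted_unitsSMul hM (y k).2.1 he' c⟩, hc⟩
  choose e he hnorm using h
  let A : Matrix (Fin n) (Fin n) (boundedSeq S K) := Matrix.of fun i j =>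
    ⟨fun k => e k j i, 1, Eventually.of_forall fun k =>
      (S.root_mono k (norm_nonneg _) ((hnorm k j).1 i)).trans (S.root_one k).le⟩
  have hAe : ∀ k, A.map (evalSeq S K k) = basisMatrix (e k) := fun k => rfl
  have hdet : ∀ k, A.det.1 k = basisDet (e k) := by
    intro k
    rw [← evalSeq_apply, RingHom.map_det, ← det_basisMatrix, ← hAe]
    rfl
  obtain ⟨C, hC⟩ := (isBoundedSeq_iff hM x).1 hx
  have hA : IsUnit A.det := by
    refine isUnit_boundedSeq (fun k => by rw [hdet]; exact basisDet_ne_zero _)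
      (c := ∏ _j : Fin n, Real.exp (-C)) (Finset.prod_pos fun _ _ => Real.exp_pos _) ?_
    filter_upwards [hC] with k hk
    rw [hdet, ← Es.prod_eq hM (x k) (he k).1,
      S.root_prod k _ _ fun i _ => isGood_nonneg hM (x k).2.1 _]
    refine Finset.prod_le_prod (fun _ _ => (Real.exp_pos _).le) fun j _ => ?_
    obtain ⟨i, hi⟩ := (hnorm k j).2
    have h1 : 1 ≤ Real.exp (C * S.lam k) * (x k).1 (e k j) := by
      rw [← hi]
      exact (norm_le_canonicalNorm M _ i).trans (hk _).2
    have h2 := S.root_mono k zero_le_one h1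
    rw [S.root_one, S.root_mul k (Real.exp_pos _).le (isGood_nonneg hM (x k).2.1 _),
      S.root_exp_mul_lam] at h2
    rw [Real.exp_neg, inv_le_iff_one_le_mul₀' (Real.exp_pos _)]
    exact h2
  refine ⟨A, hA, fun k => ?_⟩
  have : seqBasis A hA k = e k := by
    refine Module.Basis.eq_of_apply_eq fun j => ?_
    funext i
    rw [seqBasis_apply]
    rfl
  rw [this]
  exact he k

/-- `P` is the limit `lim_ω x_k ^ (1 / lam k)` of a sequence of norms. -/
def IsLimitNorm (x : ℕ → Es M) (P : EsCone S K n) : Prop :=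
  ∀ a : Fin n → boundedSeq S K, Tendsto (fun k => S.root k ((x k).1 fun i => (a i).1 k)) S.ω
    (𝓝 (P.1 fun i => FieldCone.mk S K (a i)))

lemma IsLimitNorm.eq {x : ℕ → Es M} {P Q : EsCone S K n} (hP : IsLimitNorm x P)
    (hQ : IsLimitNorm x Q) : P = Q := by
  apply Subtype.ext
  funext v
  choose a ha using fun i => FieldCone.mk_surjective (v i)
  obtain rfl : (fun i => FieldCone.mk S K (a i)) = v := funext ha
  exact tendsto_nhds_unique (hP a) (hQ a)

lemma IsLimitNorm.tendsto_basis {x : ℕ → Es M} {P : EsCone S K n} (hP : IsLimitNorm x P)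
    (A : Matrix (Fin n) (Fin n) (boundedSeq S K)) (hA : IsUnit A.det) (j : Fin n) :
    Tendsto (fun k => S.root k ((x k).1 (seqBasis A hA k j))) S.ω (𝓝 (P.1 (limBasis A hA j))) := by
  have h1 : limBasis A hA j = fun i => FieldCone.mk S K (A i j) :=
    funext fun i => limBasis_apply A hA i j
  have h2 : ∀ k, seqBasis A hA k j = fun i => (A i j).1 k :=
    fun k => funext fun i => seqBasis_apply A hA k i j
  simp only [h1, h2]
  exact hP fun i => A i j

lemma tendsto_root_of_adapted (hM : M.IsRegular) {x : ℕ → Es M}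
    {A : Matrix (Fin n) (Fin n) (boundedSeq S K)} {hA : IsUnit A.det}
    (hx : ∀ k, IsAdapted M.agg (x k) (seqBasis A hA k)) {r : Fin n → ℝ}
    (hr : ∀ j, Tendsto (fun k => S.root k ((x k).1 (seqBasis A hA k j))) S.ω (𝓝 (r j)))
    (a : Fin n → boundedSeq S K) :
    Tendsto (fun k => S.root k ((x k).1 fun i => (a i).1 k)) S.ω
      (𝓝 (⨆ j, r j * ‖(limBasis A hA).repr (fun i => FieldCone.mk S K (a i)) j‖)) := by
  obtain ⟨t, ht, ht'⟩ := exists_coord A hA a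
  have hnn : ∀ k v, 0 ≤ (x k).1 v := fun k => isGood_nonneg hM (x k).2.1
  simp only [ht', fun k => isAdapted_iff_repr.1 (hx k) fun i => (a i).1 k, ht]
  refine tendsto_root_agg S hM (fun k i => mul_nonneg (hnn _ _) (norm_nonneg _)) fun j => ?_
  simp only [fun k => S.root_mul k (hnn k (seqBasis A hA k j)) (norm_nonneg ((t j).1 k))]
  exact (hr j).mul (tendsto_norm_mk (t j))

/-- The limit of a bounded sequence of good norms of volume one exists and is a good ultrametric
norm of volume one. -/
lemma exists_isLimitNorm (hM : M.IsRegular) {x : ℕ → Es M} (hx : IsBoundedSeq M S x) :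
    ∃ P : EsCone S K n, IsLimitNorm x P := by
  obtain ⟨A, hA, had⟩ := exists_common_seqBasis hM (y := x) hx
  have hex : ∀ j, ∃ r, 0 < r ∧
      Tendsto (fun k => S.root k ((x k).1 (seqBasis A hA k j))) S.ω (𝓝 r) := by
    intro j
    obtain ⟨r, -, hr, hpos⟩ := exists_tendsto_root hM hx fun i => A i j
    have h2 : ∀ k, seqBasis A hA k j = fun i => (A i j).1 k :=
      fun k => funext fun i => seqBasis_apply A hA k i j
    have h3 : ∃ i, FieldCone.mk S K (A i j) ≠ 0 := by
      by_contra! h0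
      exact (limBasis A hA).ne_zero j (funext fun i => (limBasis_apply A hA i j).trans (h0 i))
    obtain ⟨i, hi⟩ := h3
    exact ⟨r, hpos i hi, by simpa only [h2] using hr⟩
  choose r hr0 hr using hex
  have hMω := ultraModel_isRegular (FieldCone S K) n
  obtain ⟨N, hN, hadN, hval⟩ := exists_good_of_basis hMω (limBasis A hA) r hr0
  -- the volume passes to the limit, as do the determinants of the bases
  have hvol : ∏ j, N (limBasis A hA j) = ‖basisDet (limBasis A hA)‖ := by
    simp only [hval]
    have h1 : Tendsto (fun k => ∏ j, S.root k ((x k).1 (seqBasis A hA k j))) S.ω (𝓝 (∏ j, r j)) :=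
      tendsto_finsetProd _ fun j _ => hr j
    rw [basisDet_limBasis]
    refine tendsto_nhds_unique h1 ((tendsto_norm_mk A.det).congr fun k => ?_)
    rw [← S.root_prod k _ _ fun i _ => isGood_nonneg hM (x k).2.1 _,
      Es.prod_eq hM (x k) (had k).1, basisDet_seqBasis]
  refine ⟨⟨N, hN, hasVolumeOne_of_adapted hMω hN hadN hvol⟩, fun a => ?_⟩
  change Tendsto _ _ (𝓝 (N _))
  rw [isAdapted_iff_repr.1 hadN]
  simp only [hval]
  exact tendsto_root_of_adapted hM (fun k => (had k).1) hr a

/-- The limit norm is adapted to the limit of bases adapted to the terms of the sequence. -/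
lemma IsLimitNorm.isAdapted (hM : M.IsRegular) {x : ℕ → Es M} {P : EsCone S K n}
    (hP : IsLimitNorm x P) {A : Matrix (Fin n) (Fin n) (boundedSeq S K)} {hA : IsUnit A.det}
    (hx : ∀ k, IsAdapted M.agg (x k) (seqBasis A hA k)) :
    IsAdapted (ultraModel (FieldCone S K) n).agg P (limBasis A hA) := by
  rw [isAdapted_iff_repr]
  intro v
  choose a ha using fun i => FieldCone.mk_surjective (v i)
  obtain rfl : (fun i => FieldCone.mk S K (a i)) = v := funext ha
  exact tendsto_nhds_unique (hP a) (tendsto_root_of_adapted hM hx (hP.tendsto_basis A hA) a)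

/-- Passing to the limit norm is isometric: both distances are read off in a common sequence of
adapted bases. -/
lemma IsLimitNorm.tendsto_dist (hM : M.IsRegular) {x y : ℕ → Es M} (hx : IsBoundedSeq M S x)
    {P Q : EsCone S K n} (hP : IsLimitNorm x P) (hQ : IsLimitNorm y Q) :
    Tendsto (fun k => dist M (x k) (y k) / S.lam k) S.ω
      (𝓝 (dist (ultraModel (FieldCone S K) n) P Q)) := by
  obtain ⟨A, hA, had⟩ := exists_common_seqBasis hM (y := y) hx
  have hMω := ultraModel_isRegular (FieldCone S K) n
  have hadP := hP.isAdapted hM fun k => (had k).1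
  have hadQ := hQ.isAdapted hM fun k => (had k).2
  have h1 : ∀ k, dist M (x k) (y k) / S.lam k = √(∑ j, |Real.log
      (S.root k ((y k).1 (seqBasis A hA k j)) / S.root k ((x k).1 (seqBasis A hA k j)))| ^ 2) := by
    intro k
    have px := isGood_basis_pos hM (x k).2.1 (seqBasis A hA k)
    have py := isGood_basis_pos hM (y k).2.1 (seqBasis A hA k)
    rw [dist_eq hM (x k).2.1 (y k).2.1 (had k).1 (had k).2, div_eq_iff (S.lam_pos k).ne']
    nth_rewrite 1 [← Real.sqrt_sq (S.lam_pos k).le]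
    rw [← Real.sqrt_mul (Finset.sum_nonneg fun _ _ => sq_nonneg _), Finset.sum_mul]
    congr 1
    refine Finset.sum_congr rfl fun j _ => ?_
    rw [← S.root_div k (py j).le (px j).le, S.log_root k (div_pos (py j) (px j)), sq_abs, sq_abs,
      div_pow, div_mul_cancel₀ _ (pow_ne_zero 2 (S.lam_pos k).ne')]
  rw [dist_eq hMω P.2.1 Q.2.1 hadP hadQ]
  simp only [h1]
  have pP := isGood_basis_pos hMω P.2.1 (limBasis A hA)
  have pQ := isGood_basis_pos hMω Q.2.1 (limBasis A hA)
  refine (Real.continuous_sqrt.tendsto _).comp (tendsto_finsetSum _ fun j _ => ?_)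
  refine (Tendsto.abs (Tendsto.log ((hQ.tendsto_basis A hA j).div (hP.tendsto_basis A hA j)
    (pP j).ne') (div_pos (pQ j) (pP j)).ne')).pow 2

/-- Sequences of norms at distance negligible with respect to `lam k` have the same limits. -/
lemma IsLimitNorm.congr (hM : M.IsRegular) {x y : ℕ → Es M}
    (h : Tendsto (fun k => dist M (x k) (y k) / S.lam k) S.ω (𝓝 0)) {P : EsCone S K n}
    (hP : IsLimitNorm x P) : IsLimitNorm y P := by
  intro a
  have h1 : Tendsto (fun k => Real.exp (dist M (x k) (y k) / S.lam k)) S.ω (𝓝 1) := by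
    have := (Real.continuous_exp.tendsto 0).comp h
    rwa [Real.exp_zero] at this
  have h2 := h1.mul (hP a)
  have h3 := (h1.inv₀ one_ne_zero).mul (hP a)
  rw [inv_one, one_mul] at h3
  rw [one_mul] at h2
  have hx := fun k => isGood_nonneg hM (x k).2.1 fun i => (a i).1 k
  have hy := fun k => isGood_nonneg hM (y k).2.1 fun i => (a i).1 k
  have hle := fun k => le_exp_dist_mul hM (x k).2.1 (y k).2.1 fun i => (a i).1 k
  refine tendsto_of_tendsto_of_tendsto_of_le_of_le h3 h2 (fun k => ?_) (fun k => ?_)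
  · have := S.root_mono k (hx k) (hle k).2
    rw [S.root_mul k (Real.exp_pos _).le (hy k), S.root_exp] at this
    exact (inv_mul_le_iff₀ (Real.exp_pos _)).2 this
  · have := S.root_mono k (hy k) (hle k).1
    rwa [S.root_mul k (Real.exp_pos _).le (hx k), S.root_exp] at this

/-- The map `[x_k] ↦ lim_ω x_k ^ (1 / lam k)` from the asymptotic cone to the building. -/
def limitMap (hM : M.IsRegular) : Cone M S → EsCone S K n :=
  Quot.lift (fun x => (exists_isLimitNorm hM x.2).choose) fun x y h =>
    ((exists_isLimitNorm hM x.2).choose_spec.congr hM h).eq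
      (exists_isLimitNorm hM y.2).choose_spec

lemma limitMap_spec (hM : M.IsRegular) (x : {x : ℕ → Es M // IsBoundedSeq M S x}) :
    IsLimitNorm x.1 (limitMap hM (Cone.mk M S x)) := (exists_isLimitNorm hM x.2).choose_spec

lemma limitMap_eq (hM : M.IsRegular) (x : {x : ℕ → Es M // IsBoundedSeq M S x})
    {P : EsCone S K n} (hP : IsLimitNorm x.1 P) : limitMap hM (Cone.mk M S x) = P :=
  (limitMap_spec hM x).eq hP

lemma limitMap_isometric (hM : M.IsRegular) : IsIsometric M S (limitMap hM) :=
  fun x y => (limitMap_spec hM x).tendsto_dist hM x.2 (limitMap_spec hM y)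

lemma limitMap_injective (hM : M.IsRegular) : Function.Injective (limitMap (S := S) hM) := by
  intro p q h
  obtain ⟨x, rfl⟩ := Quot.exists_rep p
  obtain ⟨y, rfl⟩ := Quot.exists_rep q
  have h1 := limitMap_isometric hM x y
  change limitMap hM (Cone.mk M S x) = limitMap hM (Cone.mk M S y) at h
  rw [h, dist_self (ultraModel_isRegular _ _) (limitMap hM (Cone.mk M S y)).2.1] at h1
  exact Quot.sound h1

end LimitNorm

/-! ### The action of `SL_n` on norms and marked apartments -/

section Action

variable {K : Type*} [NormedField K] {n : ℕ} {M : NormModel K n}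

lemma Es.smul_apply (g : Matrix.SpecialLinearGroup (Fin n) K) (x : Es M) (v : Fin n → K) :
    (g • x).1 v = x.1 (g⁻¹.1.mulVec v) := rfl

/-- The image of a basis under a matrix of determinant one. -/
def slBasis (g : Matrix.SpecialLinearGroup (Fin n) K) (e : Module.Basis (Fin n) K (Fin n → K)) :
    Module.Basis (Fin n) K (Fin n → K) := e.map (Matrix.SpecialLinearGroup.toLin' g)

lemma slBasis_apply (g : Matrix.SpecialLinearGroup (Fin n) K)
    (e : Module.Basis (Fin n) K (Fin n → K)) (j : Fin n) :
    slBasis g e j = g.1.mulVec (e j) := by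
  rw [slBasis, Module.Basis.map_apply]
  rfl

lemma inv_mulVec_mulVec (g : Matrix.SpecialLinearGroup (Fin n) K) (v : Fin n → K) :
    g⁻¹.1.mulVec (g.1.mulVec v) = v := by
  have h : g⁻¹.1 * g.1 = 1 := congrArg Subtype.val (inv_mul_cancel g)
  rw [Matrix.mulVec_mulVec, h, Matrix.one_mulVec]

lemma basisDet_slBasis (g : Matrix.SpecialLinearGroup (Fin n) K)
    (e : Module.Basis (Fin n) K (Fin n → K)) : basisDet (slBasis g e) = basisDet e := by
  have h : (slBasis g e : Fin n → Fin n → K)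
      = (Matrix.SpecialLinearGroup.toLin' g : (Fin n → K) →ₗ[K] (Fin n → K)) ∘ e := by
    ext1 j
    exact slBasis_apply g e j
  rw [basisDet, h, Module.Basis.det_comp, Matrix.SpecialLinearGroup.toLin'_to_linearMap,
    LinearMap.det_toLin', Matrix.SpecialLinearGroup.det_coe, one_mul]
  rfl

lemma smul_apply_slBasis (g : Matrix.SpecialLinearGroup (Fin n) K) (x : Es M)
    (e : Module.Basis (Fin n) K (Fin n → K)) (j : Fin n) :
    (g • x).1 (slBasis g e j) = x.1 (e j) := by
  rw [Es.smul_apply, slBasis_apply, inv_mulVec_mulVec]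

lemma isAdapted_smul (g : Matrix.SpecialLinearGroup (Fin n) K) {x : Es M}
    {e : Module.Basis (Fin n) K (Fin n → K)} (h : IsAdapted M.agg x e) :
    IsAdapted M.agg (g • x : Es M) (slBasis g e) := by
  intro a
  have h1 : ∑ i, a i • slBasis g e i = g.1.mulVec (∑ i, a i • e i) := by
    simp only [slBasis_apply, Matrix.mulVec_sum, Matrix.mulVec_smul]
  have h2 : ∀ i, (g • x).1 (slBasis g e i) = x.1 (e i) := smul_apply_slBasis g x e
  rw [h1]
  refine Eq.trans ?_ ((h a).trans ?_)
  · exact congrArg x.1 (inv_mulVec_mulVec g _)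
  · exact congrArg M.agg (funext fun i => by rw [h2])

lemma basisDet_basisFun : basisDet (Pi.basisFun K (Fin n)) = 1 := by
  rw [basisDet, Module.Basis.det_self]

lemma slBasis_basisFun (g : Matrix.SpecialLinearGroup (Fin n) K) (i j : Fin n) :
    slBasis g (Pi.basisFun K (Fin n)) j i = g.1 i j := by
  rw [slBasis_apply, Pi.basisFun_apply, Matrix.mulVec_single_one]
  rfl

lemma exists_slBasis_eq {e : Module.Basis (Fin n) K (Fin n → K)} (he : basisDet e = 1) :
    ∃ g : Matrix.SpecialLinearGroup (Fin n) K, slBasis g (Pi.basisFun K (Fin n)) = e := by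
  refine ⟨⟨basisMatrix e, by rw [det_basisMatrix, he]⟩, ?_⟩
  refine Module.Basis.eq_of_apply_eq fun j => ?_
  funext i
  exact slBasis_basisFun _ i j

/-- The marked flat of the canonical basis of `K ^ n`. -/
def stdFlat (hM : M.IsRegular) : Flat n → Es M :=
  flatMap hM (Pi.basisFun K (Fin n)) basisDet_basisFun

/-- The marked flats are the translates of the standard one under `SL_n`. -/
lemma mem_markedFlats_iff (hM : M.IsRegular) (f : Flat n → Es M) :
    f ∈ markedFlats M ↔
      ∃ g : Matrix.SpecialLinearGroup (Fin n) K, ∀ α, f α = g • stdFlat hM α := by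
  have hstd : ∀ (g : Matrix.SpecialLinearGroup (Fin n) K) α,
      IsAdapted M.agg (g • stdFlat hM α : Es M) (slBasis g (Pi.basisFun K (Fin n))) ∧
        ∀ i, (g • stdFlat hM α).1 (slBasis g (Pi.basisFun K (Fin n)) i) = Real.exp (-α.1 i) :=
    fun g α => ⟨isAdapted_smul g (flatMap_adapted hM _ _ α), fun i => by
      rw [smul_apply_slBasis]
      exact flatMap_apply hM _ _ α i⟩
  constructor
  · rintro ⟨e, he, h⟩
    obtain ⟨g, rfl⟩ := exists_slBasis_eq he
    exact ⟨g, fun α => Es.ext_of_adapted (h α).1 (hstd g α).1 fun i => by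
      rw [(h α).2, (hstd g α).2]⟩
  · rintro ⟨g, h⟩
    refine ⟨slBasis g (Pi.basisFun K (Fin n)), ?_, fun α => ?_⟩
    · rw [basisDet_slBasis, basisDet_basisFun]
    · rw [h]
      exact hstd g α

end Action

/-! ### The cone of `SL_n` -/

section ConeSL

variable {K : Type*} [NormedField K] {n : ℕ} (M : NormModel K n) (S : Scale)

lemma canonicalNorm_mulVec_le (u : Matrix (Fin n) (Fin n) K) (v : Fin n → K) :
    canonicalNorm M (u.mulVec v) ≤ (∑ i, ∑ j, ‖u i j‖) * canonicalNorm M v := by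
  refine (canonicalNorm_le_sum M _).trans ?_
  rw [Finset.sum_mul]
  refine Finset.sum_le_sum fun i _ => ?_
  rw [Finset.sum_mul]
  change ‖∑ j, u i j * v j‖ ≤ _
  refine (norm_sum_le _ _).trans (Finset.sum_le_sum fun j _ => ?_)
  rw [norm_mul]
  exact mul_le_mul_of_nonneg_left (norm_le_canonicalNorm M v j) (norm_nonneg _)

variable {M S}

lemma mem_boundedSL_iff (g : ℕ → Matrix.SpecialLinearGroup (Fin n) K) :
    g ∈ boundedSL M S ↔ ∀ i j, (fun k => (g k).1 i j) ∈ boundedSeq S K :=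
  isBounded_iff M S fun k => (g k).1

lemma exists_canonicalNorm_mulVec_le (hM : M.IsRegular)
    {g : ℕ → Matrix.SpecialLinearGroup (Fin n) K} (hg : g ∈ boundedSL M S) :
    ∃ D : ℝ, ∀ᶠ k in S.ω, ∀ v,
      canonicalNorm M ((g k).1.mulVec v) ≤ Real.exp (D * S.lam k) * canonicalNorm M v := by
  have h := (mem_boundedSL_iff g).1 hg
  choose C hC using h
  have hall : ∀ᶠ k in S.ω, ∀ i j, S.root k ‖(g k).1 i j‖ ≤ C i j :=
    eventually_all.2 fun i => eventually_all.2 fun j => hC i j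
  refine ⟨Real.log (max 1 (∑ i, ∑ j, C i j)), hall.mono fun k hk v => ?_⟩
  refine (canonicalNorm_mulVec_le M _ v).trans
    (mul_le_mul_of_nonneg_right ?_ (isGood_nonneg hM (isGood_canonicalNorm hM) v))
  refine S.le_exp_of_root_le ?_
  rw [Real.exp_log (lt_of_lt_of_le one_pos (le_max_left _ _))]
  refine le_trans ?_ (le_max_right _ _)
  refine (S.root_sum_le k _ _ fun i => Finset.sum_nonneg fun j _ => norm_nonneg _).trans ?_
  refine Finset.sum_le_sum fun i _ => ?_
  exact (S.root_sum_le k _ _ fun j => norm_nonneg _).trans (Finset.sum_le_sum fun j _ => hk i j)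

/-- Bounded sequences in `SL_n(K)` preserve bounded sequences of norms. -/
lemma isBoundedSeq_smul (hM : M.IsRegular) {g : ℕ → Matrix.SpecialLinearGroup (Fin n) K}
    (hg : g ∈ boundedSL M S) {x : ℕ → Es M} (hx : IsBoundedSeq M S x) :
    IsBoundedSeq M S fun k => g k • x k := by
  rw [isBoundedSeq_iff hM] at hx ⊢
  obtain ⟨C, hC⟩ := hx
  obtain ⟨D, hD⟩ := exists_canonicalNorm_mulVec_le hM hg
  obtain ⟨D', hD'⟩ := exists_canonicalNorm_mulVec_le hM ((boundedSL M S).inv_mem hg)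
  refine ⟨C + max D D', ?_⟩
  filter_upwards [hC, hD, hD'] with k h1 h2 h3 v
  have hN := fun v => isGood_nonneg hM (isGood_canonicalNorm hM) v
  have hmax : Real.exp (D * S.lam k) ≤ Real.exp (max D D' * S.lam k) :=
    Real.exp_le_exp.2 (mul_le_mul_of_nonneg_right (le_max_left _ _) (S.lam_pos k).le)
  have hmax' : Real.exp (D' * S.lam k) ≤ Real.exp (max D D' * S.lam k) :=
    Real.exp_le_exp.2 (mul_le_mul_of_nonneg_right (le_max_right _ _) (S.lam_pos k).le)
  rw [add_mul, Real.exp_add, Es.smul_apply]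
  set w := (g k)⁻¹.1.mulVec v with hw
  have hv : v = (g k).1.mulVec w := by
    have h : (g k).1 * (g k)⁻¹.1 = 1 := congrArg Subtype.val (mul_inv_cancel (g k))
    rw [hw, Matrix.mulVec_mulVec, h, Matrix.one_mulVec]
  constructor
  · refine (h1 w).1.trans ?_
    rw [mul_assoc]
    exact mul_le_mul_of_nonneg_left ((h3 v).trans (mul_le_mul_of_nonneg_right hmax' (hN v)))
      (Real.exp_pos _).le
  · calc canonicalNorm M v = canonicalNorm M ((g k).1.mulVec w) := by rw [← hv]
      _ ≤ Real.exp (max D D' * S.lam k) * canonicalNorm M w :=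
        (h2 w).trans (mul_le_mul_of_nonneg_right hmax (hN w))
      _ ≤ Real.exp (max D D' * S.lam k) * (Real.exp (C * S.lam k) * (x k).1 w) :=
        mul_le_mul_of_nonneg_left (h1 w).2 (Real.exp_pos _).le
      _ = _ := by ring

lemma psi_mk (g : boundedSL M S) : psi M S (SLCone.mk M S g) = psiSeq M S g := rfl

lemma psiSeq_apply (g : boundedSL M S) (i j : Fin n) :
    (psiSeq M S g).1 i j
      = FieldCone.mk S K ⟨fun k => (g.1 k).1 i j, (mem_boundedSL_iff g.1).1 g.2 i j⟩ := rfl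

/-- Every matrix of determinant one over `K_ω` comes from a bounded sequence in `SL_n(K)`: any lift
has determinant close to one, and dividing its first row by the determinant does not change its
class. -/
lemma psiSeq_surjective : Function.Surjective (psiSeq M S) := by
  intro G
  rcases n with _ | n
  · exact ⟨1, Subsingleton.elim _ _⟩
  choose A hA using fun i j => FieldCone.mk_surjective (G.1 i j)
  let A' : Matrix (Fin (n + 1)) (Fin (n + 1)) (boundedSeq S K) := Matrix.of A
  have hA' : A'.map (FieldCone.mk S K) = G.1 := by
    ext i j
    exact hA i j
  have hdet : FieldCone.mk S K A'.det = 1 := by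
    rw [RingHom.map_det]
    change (A'.map (FieldCone.mk S K)).det = 1
    rw [hA']
    exact G.2
  have hlow : ∀ᶠ k in S.ω, 1 / 2 ≤ S.root k ‖A'.det.1 k‖ := by
    have h := tendsto_norm_mk A'.det
    rw [hdet, norm_one] at h
    exact (h.eventually (lt_mem_nhds one_half_lt_one)).mono fun k hk => hk.le
  have hne : ∀ᶠ k in S.ω, A'.det.1 k ≠ 0 := by
    filter_upwards [hlow] with k hk h0
    rw [h0, norm_zero, S.root_zero] at hk
    linarith
  -- the inverse of the determinant of the lift, whose class is one
  let u : boundedSeq S K := ⟨_, inv_mem_boundedSeq one_half_pos hlow⟩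
  have hu : FieldCone.mk S K u = 1 := by
    have h : FieldCone.mk S K (u * A'.det) = FieldCone.mk S K 1 :=
      mk_eq_of_eventuallyEq (hne.mono fun k hk => inv_mul_cancel₀ hk)
    rwa [map_mul, hdet, mul_one, map_one] at h
  let B : Matrix (Fin (n + 1)) (Fin (n + 1)) (boundedSeq S K) := A'.updateRow 0 (u • A' 0)
  have hB : B.det = u * A'.det := by
    rw [Matrix.det_updateRow_smul, Matrix.updateRow_eq_self]
  have hBmk : ∀ i j, FieldCone.mk S K (B i j) = G.1 i j := by
    intro i j
    rw [← hA i j]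
    by_cases hi : i = 0
    · subst hi
      simp only [B, Matrix.updateRow_self, Pi.smul_apply, smul_eq_mul, map_mul, hu, one_mul]
      rfl
    · simp only [B, Matrix.updateRow_ne hi]
      rfl
  -- on the negligible set of indices where the determinant vanishes, the identity is a filler
  have hex : ∀ k, ∃ g : Matrix.SpecialLinearGroup (Fin (n + 1)) K,
      A'.det.1 k ≠ 0 → g.1 = B.map (evalSeq S K k) := by
    intro k
    by_cases hk : A'.det.1 k = 0
    · exact ⟨1, fun h => absurd hk h⟩
    · refine ⟨⟨B.map (evalSeq S K k), ?_⟩, fun _ => rfl⟩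
      have h := RingHom.map_det (evalSeq S K k) B
      rw [hB, map_mul] at h
      exact h.symm.trans (inv_mul_cancel₀ hk)
  choose g hg using hex
  have hev : ∀ i j, ∀ᶠ k in S.ω, (g k).1 i j = (B i j).1 k := fun i j =>
    hne.mono fun k hk => by
      rw [hg k hk]
      rfl
  refine ⟨⟨g, (mem_boundedSL_iff g).2 fun i j => mem_boundedSeq_of_eventuallyEq (hev i j)⟩, ?_⟩
  refine Matrix.SpecialLinearGroup.ext _ _ fun i j => ?_
  rw [psiSeq_apply, ← hBmk i j]
  exact mk_eq_of_eventuallyEq (hev i j)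

lemma psi_bijective : Function.Bijective (psi M S) := by
  constructor
  · intro p q h
    obtain ⟨g, rfl⟩ := Con.mk'_surjective p
    obtain ⟨g', rfl⟩ := Con.mk'_surjective q
    exact (Con.eq (slCon M S)).2 ((psiSeq_eq_iff M S g g').1 h)
  · intro G
    obtain ⟨g, hg⟩ := psiSeq_surjective (M := M) (S := S) G
    exact ⟨SLCone.mk M S g, hg⟩

end ConeSL

/-! ### Equivariance, apartments, and the isomorphism -/

section Iso

variable {K : Type*} [NormedField K] {n : ℕ} {M : NormModel K n} {S : Scale}

lemma IsLimitNorm.smul {x : ℕ → Es M} {P : EsCone S K n} (hP : IsLimitNorm x P)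
    (g : boundedSL M S) : IsLimitNorm (fun k => g.1 k • x k) (psiSeq M S g • P) := by
  intro a
  have hg := (mem_boundedSL_iff (g⁻¹).1).1 (g⁻¹).2
  let b : Fin n → boundedSeq S K := (seqMatrix S (g⁻¹).1 hg).1.mulVec a
  have h1 : ∀ k, (g.1 k • x k).1 (fun i => (a i).1 k) = (x k).1 fun i => (b i).1 k := by
    intro k
    rw [Es.smul_apply]
    refine congrArg (x k).1 (funext fun i => ?_)
    rw [← evalSeq_apply]
    simp only [b, Matrix.mulVec, dotProduct, map_sum, map_mul]
    rfl
  have h2 : (psiSeq M S g • P).1 (fun i => FieldCone.mk S K (a i))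
      = P.1 fun i => FieldCone.mk S K (b i) := by
    rw [Es.smul_apply, ← map_inv]
    refine congrArg P.1 (funext fun i => ?_)
    simp only [b, Matrix.mulVec, dotProduct, map_sum, map_mul]
    rfl
  rw [h2]
  exact (hP b).congr fun k => by rw [h1]

lemma limitMap_equivariant (hM : M.IsRegular) : IsPsiEquivariant M S (limitMap hM) := by
  intro g x
  have hb := isBoundedSeq_smul hM g.2 x.2
  refine ⟨hb, ?_⟩
  rw [psi_mk]
  exact limitMap_eq hM ⟨_, hb⟩ ((limitMap_spec hM x).smul g)

lemma canonicalNorm_basisFun (M : NormModel K n) (i : Fin n) :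
    canonicalNorm M (Pi.basisFun K (Fin n) i) = 1 := by
  rw [← agg_single M i zero_le_one, canonicalNorm]
  refine congrArg M.agg (funext fun j => ?_)
  by_cases hij : j = i
  · subst hij
    simp
  · simp [hij]

lemma isAdapted_canonicalNorm (M : NormModel K n) :
    IsAdapted M.agg (canonicalNorm M) (Pi.basisFun K (Fin n)) := by
  rw [isAdapted_iff_repr]
  intro v
  simp only [canonicalNorm_basisFun, one_mul, Pi.basisFun_repr]
  rfl

lemma isBoundedSeq_stdFlat (hM : M.IsRegular) (α : Flat n) :
    IsBoundedSeq M S fun k => stdFlat hM (S.lam k • α) := by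
  rw [isBoundedSeq_iff hM]
  refine ⟨∑ i, |α.1 i|, Eventually.of_forall fun k v => ?_⟩
  have hN0 := isAdapted_canonicalNorm M
  have hval0 := canonicalNorm_basisFun M
  have hx := flatMap_adapted hM (Pi.basisFun K (Fin n)) basisDet_basisFun (S.lam k • α)
  have hval := flatMap_apply hM (Pi.basisFun K (Fin n)) basisDet_basisFun (S.lam k • α)
  have habs : ∀ i, |α.1 i| * S.lam k ≤ (∑ i, |α.1 i|) * S.lam k := fun i =>
    mul_le_mul_of_nonneg_right (Finset.single_le_sum (f := fun i => |α.1 i|)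
      (fun j _ => abs_nonneg _) (Finset.mem_univ i)) (S.lam_pos k).le
  have hcoord : ∀ i, (S.lam k • α).1 i = S.lam k * α.1 i := fun i => rfl
  constructor
  · refine le_mul_of_adapted hM (stdFlat hM (S.lam k • α)).2.1 hN0 hx (Real.exp_pos _).le
      (fun i => ?_) v
    rw [hval0, mul_one]
    refine (hval i).le.trans (Real.exp_le_exp.2 (le_trans ?_ (habs i)))
    rw [hcoord]
    nlinarith [neg_abs_le (α.1 i), S.lam_pos k]
  · refine le_mul_of_adapted hM (isGood_canonicalNorm hM) hx hN0 (Real.exp_pos _).le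
      (fun i => ?_) v
    rw [hval0]
    refine le_trans ?_ (mul_le_mul_of_nonneg_left (hval i).ge (Real.exp_pos _).le)
    rw [← Real.exp_add]
    refine Real.one_le_exp ?_
    rw [hcoord]
    nlinarith [le_abs_self (α.1 i), habs i, S.lam_pos k]

/-- The rescaled standard flats of `K ^ n` converge to the standard flat of `K_ω ^ n`. -/
lemma isLimitNorm_stdFlat (hM : M.IsRegular) (α : Flat n) :
    IsLimitNorm (fun k => stdFlat hM (S.lam k • α))
      (stdFlat (ultraModel_isRegular (FieldCone S K) n) α) := by
  obtain ⟨P, hP⟩ := exists_isLimitNorm hM (isBoundedSeq_stdFlat (S := S) hM α)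
  have hA : IsUnit (1 : Matrix (Fin n) (Fin n) (boundedSeq S K)).det := by simp
  have h1 : ∀ k, seqBasis 1 hA k = Pi.basisFun K (Fin n) := by
    intro k
    refine Module.Basis.eq_of_apply_eq fun j => funext fun i => ?_
    rw [seqBasis_apply, Pi.basisFun_apply, ← evalSeq_apply, Matrix.one_apply, Pi.single_apply]
    split_ifs <;> simp
  have h2 : limBasis 1 hA = Pi.basisFun (FieldCone S K) (Fin n) := by
    refine Module.Basis.eq_of_apply_eq fun j => funext fun i => ?_
    rw [limBasis_apply, Pi.basisFun_apply, Matrix.one_apply, Pi.single_apply]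
    split_ifs <;> simp
  have had := hP.isAdapted hM (A := 1) (hA := hA) fun k => by
    rw [h1]
    exact flatMap_adapted hM _ _ _
  rw [h2] at had
  convert hP using 1
  refine Es.ext_of_adapted (flatMap_adapted _ _ _ α) had fun i => ?_
  have hlim := hP.tendsto_basis 1 hA i
  rw [h2] at hlim
  refine tendsto_nhds_unique (tendsto_const_nhds.congr fun k => ?_) hlim
  rw [h1]
  refine (flatMap_apply _ _ _ α i).trans ?_
  have := flatMap_apply hM (Pi.basisFun K (Fin n)) basisDet_basisFun (S.lam k • α) i
  rw [stdFlat, this, show (S.lam k • α).1 i = S.lam k * α.1 i from rfl, neg_mul_eq_mul_neg, mul_comm,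
    S.root_exp_mul_lam]

/-- The class in the cone of the rescaled point `α` of the flat `g_k • std`. -/
def coneFlat (hM : M.IsRegular) (g : boundedSL M S) (α : Flat n) : Cone M S :=
  Cone.mk M S ⟨fun k => g.1 k • stdFlat hM (S.lam k • α),
    isBoundedSeq_smul hM g.2 (isBoundedSeq_stdFlat hM α)⟩

lemma limitMap_coneFlat (hM : M.IsRegular) (g : boundedSL M S) (α : Flat n) :
    limitMap hM (coneFlat hM g α)
      = psiSeq M S g • stdFlat (ultraModel_isRegular (FieldCone S K) n) α :=
  limitMap_eq hM _ ((isLimitNorm_stdFlat hM α).smul g)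

/-- The marked apartments of the cone are the flats of bounded sequences in `SL_n(K)`: a sequence of
bases of determinant one is bounded as soon as the flats pass at bounded distance of the base
point. -/
lemma mem_coneApartments_iff (hM : M.IsRegular) (F : Flat n → Cone M S) :
    F ∈ coneApartments M S ↔ ∃ g : boundedSL M S, F = coneFlat hM g := by
  constructor
  · rintro ⟨f, hf, hb, hF⟩
    choose g hg using fun k => (mem_markedFlats_iff hM (f k)).1 (hf k)
    have hgb : g ∈ boundedSL M S := by
      rw [mem_boundedSL_iff]
      intro i j
      obtain ⟨C, hC⟩ := (isBoundedSeq_iff hM _).1 hb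
      refine ⟨Real.exp C, hC.mono fun k hk => ?_⟩
      have h1 := (hk (slBasis (g k) (Pi.basisFun K (Fin n)) j)).2
      have h2 : (f k 0).1 (slBasis (g k) (Pi.basisFun K (Fin n)) j) = 1 := by
        rw [hg, smul_apply_slBasis]
        refine (flatMap_apply hM _ _ 0 j).trans ?_
        simp
      rw [h2, mul_one] at h1
      rw [← S.root_exp_mul_lam k C]
      refine S.root_mono k (norm_nonneg _) (le_trans ?_ h1)
      have h3 := norm_le_canonicalNorm M (slBasis (g k) (Pi.basisFun K (Fin n)) j) i
      rwa [slBasis_basisFun] at h3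
    refine ⟨⟨g, hgb⟩, funext fun α => ?_⟩
    obtain ⟨h, hα⟩ := hF α
    rw [hα, coneFlat]
    congr 1
    apply Subtype.ext
    funext k
    exact hg k _
  · rintro ⟨g, rfl⟩
    refine ⟨fun k α => g.1 k • stdFlat hM α, fun k => (mem_markedFlats_iff hM _).2
      ⟨g.1 k, fun α => rfl⟩, ?_, fun α =>
      ⟨isBoundedSeq_smul hM g.2 (isBoundedSeq_stdFlat hM α), rfl⟩⟩
    have := isBoundedSeq_smul hM g.2 (isBoundedSeq_stdFlat (S := S) hM 0)
    simpa only [smul_zero] using this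

lemma limitMap_surjective (hM : M.IsRegular) : Function.Surjective (limitMap (S := S) hM) := by
  intro P
  have hMω := ultraModel_isRegular (FieldCone S K) n
  obtain ⟨e, he, had, -⟩ := exists_common_det_one hMω P.2.1 P.2.1
  obtain ⟨α, hα⟩ := (mem_range_iff hMω he
    (fun α => ⟨flatMap_adapted hMω e he α, flatMap_apply hMω e he α⟩) P).2 had
  obtain ⟨G, hG⟩ := (mem_markedFlats_iff hMω _).1 (flatMap_mem hMω e he)
  obtain ⟨g, rfl⟩ := psiSeq_surjective (M := M) G
  exact ⟨coneFlat hM g α, by rw [limitMap_coneFlat, ← hG, hα]⟩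

lemma limitMap_isBuildingIso (hM : M.IsRegular) :
    IsBuildingIso (coneApartments M S) (markedFlats (ultraModel (FieldCone S K) n))
      (limitMap hM) := by
  refine ⟨⟨limitMap_injective hM, limitMap_surjective hM⟩, fun F => ?_⟩
  rw [mem_coneApartments_iff hM, mem_markedFlats_iff (ultraModel_isRegular _ _)]
  constructor
  · rintro ⟨g, rfl⟩
    exact ⟨psiSeq M S g, fun α => limitMap_coneFlat hM g α⟩
  · rintro ⟨G, hG⟩
    obtain ⟨g, rfl⟩ := psiSeq_surjective (M := M) G
    refine ⟨g, funext fun α => limitMap_injective hM ?_⟩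
    rw [limitMap_coneFlat]
    exact hG α

/-- For every regular model, the asymptotic cone is the building of `SL_n(K_ω)`. -/
theorem NormModel.IsRegular.cone_iso_building (hM : M.IsRegular) :
    IsAffineBuilding (affineWeyl (FieldCone S K) n) (coneApartments M S) ∧
    IsAffineBuilding (affineWeyl (FieldCone S K) n)
      (markedFlats (ultraModel (FieldCone S K) n)) ∧
    Function.Bijective (psi M S) ∧
    ∃ φ : Cone M S → EsCone S K n,
      IsLimitMap M S φ ∧
      IsBuildingIso (coneApartments M S) (markedFlats (ultraModel (FieldCone S K) n)) φ ∧
      IsIsometric M S φ ∧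
      IsPsiEquivariant M S φ :=
  ⟨(isAffineBuilding_ultraModel _ n).of_iso (limitMap_isBuildingIso hM),
    isAffineBuilding_ultraModel _ n, psi_bijective, limitMap hM, limitMap_spec hM,
    limitMap_isBuildingIso hM, limitMap_isometric hM, limitMap_equivariant hM⟩

end Iso

end AsymptoticCone

end

theorem mainTheorem4 (S : Scale) (n : ℕ) :
    (∀ (K : Type*) [RCLike K],
      IsAffineBuilding (affineWeyl (FieldCone S K) n)
        (coneApartments (archModel K n) S) ∧
      IsAffineBuilding (affineWeyl (FieldCone S K) n)
        (markedFlats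
          (ultraModel (FieldCone S K) n)) ∧
      Function.Bijective (psi (archModel K n) S) ∧
      ∃ φ : Cone (archModel K n) S → EsCone S K n,
        IsLimitMap (archModel K n) S φ ∧
        IsBuildingIso
          (coneApartments (archModel K n) S)
          (markedFlats (ultraModel (FieldCone S K) n))
          φ ∧
        IsIsometric (archModel K n) S φ ∧
        IsPsiEquivariant (archModel K n) S φ) ∧
    (∀ (K : Type*) [NormedField K] [IsUltrametricDist K],
      IsAffineBuilding (affineWeyl (FieldCone S K) n)
        (coneApartments (ultraModel K n) S) ∧
      IsAffineBuilding (affineWeyl (FieldCone S K) n)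
        (markedFlats
          (ultraModel (FieldCone S K) n)) ∧
      Function.Bijective (psi (ultraModel K n) S) ∧
      ∃ φ : Cone (ultraModel K n) S → EsCone S K n,
        IsLimitMap (ultraModel K n) S φ ∧
        IsBuildingIso
          (coneApartments (ultraModel K n) S)
          (markedFlats (ultraModel (FieldCone S K) n))
          φ ∧
        IsIsometric (ultraModel K n) S φ ∧
        IsPsiEquivariant (ultraModel K n) S φ) := by
  exact ⟨fun K _ => (archModel_isRegular K n).cone_iso_building,
    fun K _ _ => (ultraModel_isRegular K n).cone_iso_building⟩
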